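/- **Setting.** Let $n\ge 1$, let $Q$ and $U_0,\dots,U_{n-1}$ be finite-dimensional smooth Riemannian manifolds (without boundary), let $\mathbb U_i\subseteq U_i$ be closed sets, let $F_i:Q\times U_i\to Q$ $(0\le i\le n-1)$ be $C^1$ maps, and fix $q_0\in Q$. Let $\mathcal U$ be the set of control sequences $\mathbf u=(u_i)_{i=0}^{n-1}$ with $u_i\in\mathbb U_i$, equipped with the distance $d_{\mathcal U}$ of the product Riemannian metric on $\prod_i U_i$, that is $d_{\mathcal U}(\mathbf u,\mathbf c)=\big(\sum_i d(u_i,c_i)^2\big)^{1/2}$; products $Q\times U_i$ also carry the product metric. (Riemannian distances between different connected components are $+\infty$.) A control sequence generates the states $q_i=F_{i-1}(q_{i-1},u_{i-1})$, $1\le i\le n$. Let $E$ be a metric space and let $\varphi_0:E\times U_0\to\mathbb R$, $\varphi_i:E\times(Q\times U_i)\to\mathbb R$ $(1\le i\le n-1)$, $\varphi_n:E\times Q\to\mathbb R$ be nonnegative and locally Lipschitz in the second variable $x$, locally uniformly in $e$ (each $(e_0,x_0)$ has a neighbourhood $W\times A$ and a constant $K$ such that $\varphi_i(e,\cdot)$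 is $K$-Lipschitz on $A$ for every $e\in W$). Put $S_i(e)=\{x:\varphi_i(e,x)=0\}$ and $$P(e,\mathbf u)=\varphi_0(e,u_0)+\varphi_n(e,q_n)+\sum_{i=1}^{n-1}\varphi_i(e,q_i,u_i),$$ and assume that $P$ is jointly continuous on $E\times\mathcal U$. Let $\mathcal A(e)$ be the set of $\mathbf u\in\mathcal U$ with $u_0\in S_0(e)$, $(q_i,u_i)\in S_i(e)$ for $1\le i\le n-1$, and $q_n\in S_n(e)$. Write $d_{\mathcal A(e)}(\mathbf u)=\inf\{d_{\mathcal U}(\mathbf u,\mathbf c):\mathbf c\in\mathcal A(e)\}$, which is $+\infty$ if $\mathcal A(e)=\emptyset$. **Nonsmooth analysis.** For a lower semicontinuous $f:M\to\mathbb R\cup\{\infty\}$ on a manifold, the Fréchet subdifferential of $f$ at a point $q$ with $f(q)<\infty$ is the set of all $dg(q)$ with $g:M\to\mathbb R$ of class $C^1$ and $f-g$ having a local minimum at $q$. The limiting subdifferential $\partial_Lf(q)$ is the set of limits in $T^*M$ of Fréchet subgradients $p_k$ at points $x_k\to q$ with $f(x_k)\to f(q)$. In $\partial_L\varphi_i(e,x)$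 below the subdifferential is taken in $x$ with $e$ fixed. For a closed set $S\subseteq M$ and $s\in S$, $N_S^L(s)=\partial_L\chi_S(s)$, where $\chi_S$ is $0$ on $S$ and $\infty$ off $S$, and $T^C_S(s)=\{v\in T_sM:\langle p,v\rangle\le 0\ \forall p\in N^L_S(s)\}$. The set $S$ is *Clarke regular* if for all $s\in S$, $v\in T_S^C(s)$ and $S\ni s_k\to s$ there are $v_k\in T_S^C(s_k)$ with $v_k\to v$ (in $TM$). **$\varphi$-regularity.** $S(e_0)=\{x:\varphi(e_0,x)=0\}$ is $\varphi$-regular at $x_0$ if (i) there are $\varepsilon,\Delta>0$ such that $\|p\|\ge\Delta$ whenever $d_E(e,e_0)+d(x,x_0)<\varepsilon$, $\varphi(e,x)>0$ and $p\in\partial_{L}\varphi(e,x)$; and (ii) whenever $(e_k,x_k)\to(e_0,x_0)$ and $p_k\in\partial_{L}\varphi(e_k,x_k)$, a subsequence of $(p_k)$ converges to an element of $\partial_{L}\varphi(e_0,x_0)$. The constraints are *$\varphi_i$-regular along* $\mathbf u\in\mathcal A(e)$ if $S_0(e)$ is $\varphi_0$-regular at $u_0$, $S_i(e)$ is $\varphi_i$-regular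 at $(q_i,u_i)$ for $1\le i\le n-1$, and $S_n(e)$ is $\varphi_n$-regular at $q_n$. **Strict normality.** $\mathbf u\in\mathcal A(e)$ is *strictly $\varphi_i$-normal* if the only $b_0\in\partial_{L}\varphi_0(e,u_0)$, $(a_i,b_i)\in\partial_{L}\varphi_i(e,q_i,u_i)$ $(1\le i\le n-1)$, $a_n\in\partial_{L}\varphi_n(e,q_n)$ for which the costates $p_i\in T^*_{q_i}Q$ defined by $$p_n=-a_n,\qquad p_{i-1}=-a_{i-1}+D_qF_{i-1}(q_{i-1},u_{i-1})^*p_i\quad(2\le i\le n)$$ satisfy $$0\le\langle b_{i-1}-D_uF_{i-1}(q_{i-1},u_{i-1})^*p_i,\,v\rangle\quad\text{for all }v\in T^C_{\mathbb U_{i-1}}(u_{i-1}),\ 1\le i\le n,$$ are $a_i=0$ $(1\le i\le n)$ and $b_i=0$ $(0\le i\le n-1)$. **Statement.** Let $\bar e\in E$ and $\bar{\mathbf u}\in\mathcal A(\bar e)$. Suppose that the sets $\mathbb U_i$ are Clarke regular, that the constraints are $\varphi_i$-regular along $\bar{\mathbf u}$ (at $\bar e$), and that $\bar{\mathbf u}$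 is strictly $\varphi_i$-normal (at $\bar e$). Then there exist $\varepsilon,\kappa>0$ such that $$d_{\mathcal A(e)}(\mathbf u)\le\kappa\,P(e,\mathbf u)\quad\text{for all }(e,\mathbf u)\in E\times\mathcal U\text{ with }d_E(e,\bar e)+d_{\mathcal U}(\mathbf u,\bar{\mathbf u})<\varepsilon.$$ In particular, $\mathcal A(e)\neq\emptyset$ for every $e\in E$ with $d_E(e,\bar e)<\varepsilon$. -/

import Mathlib

open Set Filter Topology Manifold Bundle
open scoped ENNReal ContDiff

noncomputable section

/-! ### Nonsmooth analysis on manifolds -/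

section Nonsmooth

variable {V : Type*} [NormedAddCommGroup V] [NormedSpace ℝ V]
  {H : Type*} [TopologicalSpace H] (I : ModelWithCorners ℝ V H)
  {M : Type*} [TopologicalSpace M] [ChartedSpace H M]

/-- The cotangent space `T_q^* M`. -/
abbrev CotangentSpace (q : M) : Type _ := TangentSpace I q →L[ℝ] ℝ

/-- The Fréchet subdifferential of an extended-real-valued function at a point of its domain:
all differentials `dg(q)` of functions `g` of class `C^1` such that `f - g` has a local minimum
at `q`. -/
def frechetSubdiff (f : M → EReal) (q : M) : Set (CotangentSpace I q) :=
  {p | f q ≠ ⊤ ∧ f q ≠ ⊥ ∧ ∃ g : M → ℝ, ContMDiff I 𝓘(ℝ, ℝ) 1 g ∧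
    (∀ v : TangentSpace I q, p v = mfderiv I 𝓘(ℝ, ℝ) g q v) ∧
    IsLocalMin (fun x => f x - (g x : EReal)) q}

/-- Convergence `v_k → v` of tangent vectors `v_k ∈ T_{x_k} M`, `v ∈ T_x M`, in the topology of
the tangent bundle. -/
def TangentTendsto [IsManifold I 1 M] (x : ℕ → M) (v : ∀ k, TangentSpace I (x k)) (x₀ : M)
    (v₀ : TangentSpace I x₀) : Prop :=
  Tendsto (fun k => (⟨x k, v k⟩ : TangentBundle I M)) atTop (𝓝 ⟨x₀, v₀⟩)

/-- Convergence `p_k → p` of covectors `p_k ∈ T_{x_k}^* M`, `p ∈ T_x^* M`, in the topology of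
the cotangent bundle `T^* M = Hom(TM, ℝ)`. -/
def CotangentTendsto [IsManifold I 1 M] (x : ℕ → M) (p : ∀ k, CotangentSpace I (x k)) (x₀ : M)
    (p₀ : CotangentSpace I x₀) : Prop :=
  Tendsto (fun k => (⟨x k, p k⟩ : TotalSpace (V →L[ℝ] ℝ)
      (fun y : M => TangentSpace I y →L[ℝ] Bundle.Trivial M ℝ y))) atTop (𝓝 ⟨x₀, p₀⟩)

/-- The limiting subdifferential of `f` at `q`. -/
def limitingSubdiff [IsManifold I 1 M] (f : M → EReal) (q : M) : Set (CotangentSpace I q) :=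
  {p | ∃ (x : ℕ → M) (ξ : ∀ k, CotangentSpace I (x k)),
    Tendsto x atTop (𝓝 q) ∧ (∀ k, ξ k ∈ frechetSubdiff I f (x k)) ∧
    Tendsto (fun k => f (x k)) atTop (𝓝 (f q)) ∧ CotangentTendsto I x ξ q p}

/-- The limiting subdifferential of a real-valued function. -/
def limitingSubdiffReal [IsManifold I 1 M] (f : M → ℝ) (q : M) : Set (CotangentSpace I q) :=
  limitingSubdiff I (fun x => ((f x : ℝ) : EReal)) q

open Classical in
/-- The indicator `χ_S` of a set: `0` on `S` and `∞` off `S`. -/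
def setIndicator (S : Set M) (x : M) : EReal := if x ∈ S then 0 else ⊤

/-- The limiting normal cone to `S` at `s`. -/
def limitingNormalCone [IsManifold I 1 M] (S : Set M) (s : M) : Set (CotangentSpace I s) :=
  limitingSubdiff I (setIndicator S) s

/-- The Clarke tangent cone to `S` at `s`: the polar of the limiting normal cone. -/
def clarkeTangentCone [IsManifold I 1 M] (S : Set M) (s : M) : Set (TangentSpace I s) :=
  {v | ∀ p ∈ limitingNormalCone I S s, p v ≤ 0}

/-- Clarke regularity of a set `S`: every Clarke tangent vector at `s ∈ S` is, along every sequence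
`s_k → s` in `S`, a limit of Clarke tangent vectors at the points `s_k`. -/
def IsClarkeRegular [IsManifold I 1 M] (S : Set M) : Prop :=
  ∀ s ∈ S, ∀ v ∈ clarkeTangentCone I S s, ∀ x : ℕ → M, (∀ k, x k ∈ S) →
    Tendsto x atTop (𝓝 s) →
    ∃ w : ∀ k, TangentSpace I (x k), (∀ k, w k ∈ clarkeTangentCone I S (x k)) ∧
      TangentTendsto I x w s v

/-- The set `S(e) = {x | φ(e, x) = 0}`. -/
def constraintSet {E : Type*} (φ : E → M → ℝ) (e : E) : Set M := {x | φ e x = 0}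

/-- `φ`-regularity of `S(e₀) = {x | φ(e₀, x) = 0}` at `x₀`, on a manifold with distance `d` and
norm `N` on its cotangent spaces. -/
def IsPhiRegularAt [IsManifold I 1 M] {E : Type*} [MetricSpace E]
    (d : M → M → ℝ≥0∞) (N : ∀ x : M, CotangentSpace I x → ℝ)
    (φ : E → M → ℝ) (e₀ : E) (x₀ : M) : Prop :=
  (∃ ε > (0 : ℝ), ∃ Δ > (0 : ℝ), ∀ (e : E) (x : M),
    edist e e₀ + d x x₀ < ENNReal.ofReal ε → 0 < φ e x →
      ∀ p ∈ limitingSubdiffReal I (φ e) x, Δ ≤ N x p) ∧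
  (∀ (e : ℕ → E) (x : ℕ → M) (p : ∀ k, CotangentSpace I (x k)),
    Tendsto e atTop (𝓝 e₀) → Tendsto x atTop (𝓝 x₀) →
    (∀ k, p k ∈ limitingSubdiffReal I (φ (e k)) (x k)) →
    ∃ (σ : ℕ → ℕ) (p₀ : CotangentSpace I x₀), StrictMono σ ∧
      CotangentTendsto I (fun k => x (σ k)) (fun k => p (σ k)) x₀ p₀ ∧
      p₀ ∈ limitingSubdiffReal I (φ e₀) x₀)

end Nonsmooth

/-- `φ(e, x)` is locally Lipschitz in `x`, (locally) uniformly with respect to `e`. -/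
def LocallyLipschitzUniformly {E M : Type*} [TopologicalSpace E] [PseudoEMetricSpace M]
    (φ : E → M → ℝ) : Prop :=
  ∀ (e₀ : E) (x₀ : M), ∃ K : NNReal, ∃ W ∈ 𝓝 e₀, ∃ A ∈ 𝓝 x₀, ∀ e ∈ W, LipschitzOnWith K (φ e) A

/-! ### Partial derivatives, norms and distances on a product manifold -/

section Product

variable {V V' : Type*} [NormedAddCommGroup V] [NormedSpace ℝ V]
  [NormedAddCommGroup V'] [NormedSpace ℝ V']
  {Q U : Type*}

section Partial

variable [TopologicalSpace Q] [ChartedSpace V Q] [TopologicalSpace U] [ChartedSpace V' U]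

/-- The `T_q^* Q`-component `a` of a covector `(a, b) ∈ T_{(q,u)}^* (Q × U)`. -/
def covectorFst (x : Q × U) (ξ : CotangentSpace (𝓘(ℝ, V).prod 𝓘(ℝ, V')) x) :
    CotangentSpace 𝓘(ℝ, V) x.1 :=
  ξ.comp (mfderiv 𝓘(ℝ, V) (𝓘(ℝ, V).prod 𝓘(ℝ, V')) (fun q : Q => (q, x.2)) x.1)

/-- The `T_u^* U`-component `b` of a covector `(a, b) ∈ T_{(q,u)}^* (Q × U)`. -/
def covectorSnd (x : Q × U) (ξ : CotangentSpace (𝓘(ℝ, V).prod 𝓘(ℝ, V')) x) :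
    CotangentSpace 𝓘(ℝ, V') x.2 :=
  ξ.comp (mfderiv 𝓘(ℝ, V') (𝓘(ℝ, V).prod 𝓘(ℝ, V')) (fun u : U => (x.1, u)) x.2)

/-- The partial derivative `D_q F(q, u) : T_q Q → T_{F(q,u)} Q`. -/
def partialFst (F : Q × U → Q) (x : Q × U) :
    TangentSpace 𝓘(ℝ, V) x.1 →L[ℝ] TangentSpace 𝓘(ℝ, V) (F x) :=
  mfderiv 𝓘(ℝ, V) 𝓘(ℝ, V) (fun q : Q => F (q, x.2)) x.1

/-- The partial derivative `D_u F(q, u) : T_u U → T_{F(q,u)} Q`. -/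
def partialSnd (F : Q × U → Q) (x : Q × U) :
    TangentSpace 𝓘(ℝ, V') x.2 →L[ℝ] TangentSpace 𝓘(ℝ, V) (F x) :=
  mfderiv 𝓘(ℝ, V') 𝓘(ℝ, V) (fun u : U => F (x.1, u)) x.2

end Partial

/-- The Riemannian norm of a covector. -/
def covectorNorm [TopologicalSpace Q] [ChartedSpace V Q]
    [RiemannianBundle (fun x : Q => TangentSpace 𝓘(ℝ, V) x)]
    (q : Q) (p : CotangentSpace 𝓘(ℝ, V) q) : ℝ := ‖p‖

/-- The norm of a covector `(a, b)` for the product Riemannian metric. -/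
def prodCovectorNorm [TopologicalSpace Q] [ChartedSpace V Q] [TopologicalSpace U]
    [ChartedSpace V' U] [RiemannianBundle (fun x : Q => TangentSpace 𝓘(ℝ, V) x)]
    [RiemannianBundle (fun x : U => TangentSpace 𝓘(ℝ, V') x)]
    (x : Q × U) (ξ : CotangentSpace (𝓘(ℝ, V).prod 𝓘(ℝ, V')) x) : ℝ :=
  Real.sqrt (covectorNorm x.1 (covectorFst x ξ) ^ 2 + covectorNorm x.2 (covectorSnd x ξ) ^ 2)

/-- The distance of the product Riemannian metric on `Q × U`. -/
def prodEDist [EMetricSpace Q] [EMetricSpace U] (x y : Q × U) : ℝ≥0∞ :=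
  (edist x.1 y.1 ^ 2 + edist x.2 y.2 ^ 2) ^ (1 / 2 : ℝ)

/-- The distance of the product Riemannian metric on `∏ i, U i`. -/
def piEDist {n : ℕ} {U : Fin n → Type*} [∀ i, EMetricSpace (U i)] (u c : ∀ i, U i) : ℝ≥0∞ :=
  (∑ i, edist (u i) (c i) ^ 2) ^ (1 / 2 : ℝ)

end Product

/-! ### Discrete-time geometric control systems

There are `n = m + 1` controls `u_0, …, u_m` and states `q_0, …, q_{m+1}`. -/

section Control

variable {m : ℕ} {E Q : Type*} {U : Fin (m + 1) → Type*}

/-- The state sequence `q_{i+1} = F_i(q_i, u_i)` started at `q₀`. -/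
def stateSeq (F : ∀ i, Q × U i → Q) (q₀ : Q) (u : ∀ i, U i) : Fin (m + 2) → Q :=
  Fin.induction q₀ (fun i q => F i (q, u i))

/-- The pair `(q_i, u_i)`, for `0 ≤ i ≤ m`. -/
def stateControl (F : ∀ i, Q × U i → Q) (q₀ : Q) (u : ∀ i, U i) (i : Fin (m + 1)) : Q × U i :=
  (stateSeq F q₀ u i.castSucc, u i)

/-- The final state `q_n`. -/
def finalState (F : ∀ i, Q × U i → Q) (q₀ : Q) (u : ∀ i, U i) : Q :=
  stateSeq F q₀ u (Fin.last (m + 1))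

/-- The set of control sequences: `u_i ∈ 𝕌_i` for all `i`. -/
def controlSet (𝕌 : ∀ i, Set (U i)) : Set (∀ i, U i) := {u | ∀ i, u i ∈ 𝕌 i}

/-- The feasible set `A(e)`. The functions `φ_1, …, φ_{n-1}` are indexed by `Fin m`, with `φ i`
standing for the function constraining `(q_{i+1}, u_{i+1})`. -/
def feasibleSet (F : ∀ i, Q × U i → Q) (q₀ : Q) (𝕌 : ∀ i, Set (U i))
    (φ₀ : E → U 0 → ℝ) (φ : ∀ i : Fin m, E → Q × U i.succ → ℝ) (φₙ : E → Q → ℝ) (e : E) :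
    Set (∀ i, U i) :=
  {u | u ∈ controlSet 𝕌 ∧ u 0 ∈ constraintSet φ₀ e ∧
    (∀ i : Fin m, stateControl F q₀ u i.succ ∈ constraintSet (φ i) e) ∧
    finalState F q₀ u ∈ constraintSet φₙ e}

/-- The penalty function `P(e, u) = φ_0(e, u_0) + φ_n(e, q_n) + ∑ φ_i(e, q_i, u_i)`. -/
def penalty (F : ∀ i, Q × U i → Q) (q₀ : Q)
    (φ₀ : E → U 0 → ℝ) (φ : ∀ i : Fin m, E → Q × U i.succ → ℝ) (φₙ : E → Q → ℝ)
    (e : E) (u : ∀ i, U i) : ℝ :=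
  φ₀ e (u 0) + φₙ e (finalState F q₀ u) + ∑ i : Fin m, φ i e (stateControl F q₀ u i.succ)

/-- The distance `d_{A(e)}(u)` from `u` to the feasible set, `∞` if the latter is empty. -/
def distFeasible [∀ i, EMetricSpace (U i)] (A : Set (∀ i, U i)) (u : ∀ i, U i) : ℝ≥0∞ :=
  ⨅ c ∈ A, piEDist u c

section Regular

variable {V : Type*} [NormedAddCommGroup V] [NormedSpace ℝ V]
  {W : Fin (m + 1) → Type*} [∀ i, NormedAddCommGroup (W i)] [∀ i, NormedSpace ℝ (W i)]
  [MetricSpace E]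

/-- The constraints are `φ_i`-regular along the control sequence `u` at the parameter `e`. -/
def IsPhiRegularAlong
    [EMetricSpace Q] [ChartedSpace V Q] [IsManifold 𝓘(ℝ, V) ∞ Q]
    [RiemannianBundle (fun x : Q => TangentSpace 𝓘(ℝ, V) x)]
    [∀ i, EMetricSpace (U i)] [∀ i, ChartedSpace (W i) (U i)]
    [∀ i, IsManifold 𝓘(ℝ, W i) ∞ (U i)]
    [∀ i, RiemannianBundle (fun x : U i => TangentSpace 𝓘(ℝ, W i) x)]
    (F : ∀ i, Q × U i → Q) (q₀ : Q)
    (φ₀ : E → U 0 → ℝ) (φ : ∀ i : Fin m, E → Q × U i.succ → ℝ) (φₙ : E → Q → ℝ)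
    (e : E) (u : ∀ i, U i) : Prop :=
  IsPhiRegularAt 𝓘(ℝ, W 0) edist covectorNorm φ₀ e (u 0) ∧
  (∀ i : Fin m, IsPhiRegularAt (𝓘(ℝ, V).prod 𝓘(ℝ, W i.succ)) prodEDist prodCovectorNorm
    (φ i) e (stateControl F q₀ u i.succ)) ∧
  IsPhiRegularAt 𝓘(ℝ, V) edist covectorNorm φₙ e (finalState F q₀ u)

/-- Strict `φ_i`-normality of the control sequence `u` at the parameter `e`. Here `b₀` is `b_0`,
`ξ i` is `(a_{i+1}, b_{i+1})`, `aₙ` is `a_n`, and `p j` is the costate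
`p_{j+1} ∈ T_{q_{j+1}}^* Q`, where `q_{j+1} = F_j(q_j, u_j)`. -/
def IsStrictlyNormal
    [TopologicalSpace Q] [ChartedSpace V Q] [IsManifold 𝓘(ℝ, V) ∞ Q]
    [∀ i, TopologicalSpace (U i)] [∀ i, ChartedSpace (W i) (U i)]
    [∀ i, IsManifold 𝓘(ℝ, W i) ∞ (U i)]
    (F : ∀ i, Q × U i → Q) (q₀ : Q) (𝕌 : ∀ i, Set (U i))
    (φ₀ : E → U 0 → ℝ) (φ : ∀ i : Fin m, E → Q × U i.succ → ℝ) (φₙ : E → Q → ℝ)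
    (e : E) (u : ∀ i, U i) : Prop :=
  ∀ (b₀ : CotangentSpace 𝓘(ℝ, W 0) (u 0))
    (ξ : ∀ i : Fin m, CotangentSpace (𝓘(ℝ, V).prod 𝓘(ℝ, W i.succ)) (stateControl F q₀ u i.succ))
    (aₙ : CotangentSpace 𝓘(ℝ, V) (finalState F q₀ u))
    (p : ∀ j : Fin (m + 1), CotangentSpace 𝓘(ℝ, V) (F j (stateControl F q₀ u j))),
    b₀ ∈ limitingSubdiffReal 𝓘(ℝ, W 0) (φ₀ e) (u 0) →
    (∀ i : Fin m, ξ i ∈ limitingSubdiffReal (𝓘(ℝ, V).prod 𝓘(ℝ, W i.succ)) (φ i e)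
      (stateControl F q₀ u i.succ)) →
    aₙ ∈ limitingSubdiffReal 𝓘(ℝ, V) (φₙ e) (finalState F q₀ u) →
    -- `p_n = -a_n`
    (∀ w : V, p (Fin.last m) w = - aₙ w) →
    -- `p_{i-1} = -a_{i-1} + D_q F_{i-1}(q_{i-1}, u_{i-1})^* p_i` for `2 ≤ i ≤ n`
    (∀ (i : Fin m) (w : V), p i.castSucc w =
      - covectorFst (stateControl F q₀ u i.succ) (ξ i) w +
        p i.succ (partialFst (F i.succ) (stateControl F q₀ u i.succ) w)) →
    -- `0 ≤ ⟨b_{i-1} - D_u F_{i-1}(q_{i-1}, u_{i-1})^* p_i, v⟩` for `1 ≤ i ≤ n`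
    (∀ v ∈ clarkeTangentCone 𝓘(ℝ, W 0) (𝕌 0) (u 0),
      0 ≤ b₀ v - p 0 (partialSnd (F 0) (stateControl F q₀ u 0) v)) →
    (∀ i : Fin m, ∀ v ∈ clarkeTangentCone 𝓘(ℝ, W i.succ) (𝕌 i.succ) (u i.succ),
      0 ≤ covectorSnd (stateControl F q₀ u i.succ) (ξ i) v -
        p i.succ (partialSnd (F i.succ) (stateControl F q₀ u i.succ) v)) →
    b₀ = 0 ∧ (∀ i, ξ i = 0) ∧ aₙ = 0

end Regular

end Control

end

noncomputable section

/-! The proof is by contradiction, with an explicit quadratic perturbation in the role of Ekeland's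
principle. If the bound fails for every constant, then arbitrarily near the reference pair there are
`e` and an admissible `w` with `P = P(e, w)` small and positive, whose distance to `A(e)` exceeds a
large multiple of `P`. Let `prox` be the squared distance in fixed coordinates and put `l = min (κP)
√P`, `η = P / l²`. Any admissible `u` with `P(e, u) + η prox(w, u) ≤ P(e, w)` has `prox ≤ l²`; it is
too close to `w` to be feasible, so its penalty is still positive. The differential of `η prox` has
size of order `P / l = max (1/κ) √P`, hence is as small as desired (`exists_decoupled_minimizer`).

To read off multipliers without a sum rule for nonsmooth functions, the minimization is decoupled.
The states `q` become independent variables and each control gets two copies: `u_j`, constrained to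
`𝕌_j`, and `v_j`, which enters `φ_j`. The defects of the dynamics and of `u = v` are penalized by
`K` times a squared coordinate norm. `exists_penalized_minimizer` shows that for suitable `K` a
minimizer stays in the interior of a compact neighbourhood and keeps a positive stage cost. In each
block of variables only one nonsmooth function now appears: `φ_0` in `v_0`, `φ_i` in `(q_i, v_i)`,
`φ_n` in `q_n`, the indicator of `𝕌_j` in `u_j`. Stationarity therefore gives exact Fréchet
subgradients and normals, expressed through the differentials of the penalties. The differentials of
the dynamics defects play the role of costates.

Along a sequence of such minimizers, part (ii) of regularity makes the subgradients converge after
extraction. The costates then converge by the backward recursion, with no bound on `K`, and the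
normals converge because the proximity term disappears. The limit satisfies the system in the
definition of strict normality, so all limiting subgradients vanish. Part (i) of regularity keeps
subgradients away from zero where `φ_i > 0`, so all stage costs are eventually zero
(`exists_stageCost_eq_zero`), contrary to the construction. -/

lemma tendsto_totalSpace_mk_iff {B F : Type*} {E : B → Type*} [TopologicalSpace B]
    [TopologicalSpace F] [TopologicalSpace (TotalSpace F E)] (e : Trivialization F (π F E))
    {x : ℕ → B} {p : ∀ k, E (x k)} {x₀ : B} {p₀ : E x₀} (h : (⟨x₀, p₀⟩ : TotalSpace F E) ∈ e.source) :
    Tendsto (fun k => (⟨x k, p k⟩ : TotalSpace F E)) atTop (𝓝 ⟨x₀, p₀⟩) ↔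
      Tendsto x atTop (𝓝 x₀) ∧
        Tendsto (fun k => (e ⟨x k, p k⟩).2) atTop (𝓝 (e ⟨x₀, p₀⟩).2) :=
  e.tendsto_nhds_iff h

/-! ### Covectors and differentials in the frame of a fixed chart -/

section TangentFrame

variable {V : Type*} [NormedAddCommGroup V] [NormedSpace ℝ V]
  {H : Type*} [TopologicalSpace H] (I : ModelWithCorners ℝ V H)
  {M : Type*} [TopologicalSpace M] [ChartedSpace H M] [IsManifold I 1 M]

/-- The inverse at `x` of the trivialization of the tangent bundle induced by the chart at `x₀`. -/
def tangentFrame (x₀ x : M) : V →L[ℝ] TangentSpace I x :=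
  (trivializationAt V (TangentSpace I) x₀).symmL ℝ x

lemma tangentFrame_eq_mfderivWithin {x₀ x : M} (hx : x ∈ (chartAt H x₀).source) :
    tangentFrame I x₀ x =
      mfderivWithin 𝓘(ℝ, V) I (extChartAt I x₀).symm (range I) (extChartAt I x₀ x) :=
  TangentBundle.symmL_trivializationAt hx

lemma tangentFrame_self (x₀ : M) (v : V) : tangentFrame I x₀ x₀ v = v := by
  rw [tangentFrame_eq_mfderivWithin I (mem_chart_source H x₀), mfderivWithin_range_extChartAt_symm]
  rfl

lemma mfderiv_extChartAt_comp_tangentFrame {x₀ x : M} (hx : x ∈ (chartAt H x₀).source) (v : V) :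
    mfderiv I 𝓘(ℝ, V) (extChartAt I x₀) x (tangentFrame I x₀ x v) = v := by
  rw [← TangentBundle.continuousLinearMapAt_trivializationAt hx, tangentFrame]
  exact (trivializationAt V (TangentSpace I) x₀).continuousLinearMapAt_symmL (R := ℝ)
    (by simpa using hx) v

lemma tangentFrame_comp_mfderiv_extChartAt {x₀ x : M} (hx : x ∈ (chartAt H x₀).source)
    (v : TangentSpace I x) :
    tangentFrame I x₀ x (mfderiv I 𝓘(ℝ, V) (extChartAt I x₀) x v) = v := by
  rw [← TangentBundle.continuousLinearMapAt_trivializationAt hx, tangentFrame]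
  exact (trivializationAt V (TangentSpace I) x₀).symmL_continuousLinearMapAt (R := ℝ)
    (by simpa using hx) v

lemma tangentFrame_unique {x₀ x : M} (hx : x ∈ (chartAt H x₀).source) {v : V}
    {w : TangentSpace I x} (h : mfderiv I 𝓘(ℝ, V) (extChartAt I x₀) x w = v) :
    tangentFrame I x₀ x v = w := by
  rw [← h]; exact tangentFrame_comp_mfderiv_extChartAt I hx w

/-- A covector read in the frame of the chart at `x₀`. -/
def covectorCoord (x₀ x : M) (p : CotangentSpace I x) : V →L[ℝ] ℝ :=
  p.comp (tangentFrame I x₀ x)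

lemma covectorCoord_apply (x₀ x : M) (p : CotangentSpace I x) (v : V) :
    covectorCoord I x₀ x p v = p (tangentFrame I x₀ x v) := rfl

lemma covectorCoord_self (x₀ : M) (p : CotangentSpace I x₀) (v : V) :
    covectorCoord I x₀ x₀ p v = p v := by
  rw [covectorCoord_apply, tangentFrame_self]

lemma hom_trivializationAt_snd (x₀ y : M) (q : CotangentSpace I y) :
    ((trivializationAt (V →L[ℝ] ℝ)
      (fun y : M => TangentSpace I y →L[ℝ] Bundle.Trivial M ℝ y) x₀) ⟨y, q⟩).2
      = covectorCoord I x₀ y q := by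
  rw [hom_trivializationAt_apply]
  ext v
  simp [ContinuousLinearMap.inCoordinates, covectorCoord, tangentFrame]

/-- The trivialization at the limit point reduces convergence in the cotangent bundle to convergence
of base points and of coordinates. Every limit of covectors below is thus taken in the single normed
space `V →L[ℝ] ℝ`. -/
lemma cotangentTendsto_iff {x : ℕ → M} {p : ∀ k, CotangentSpace I (x k)} {x₀ : M}
    {p₀ : CotangentSpace I x₀} :
    CotangentTendsto I x p x₀ p₀ ↔ Tendsto x atTop (𝓝 x₀) ∧
      Tendsto (fun k => covectorCoord I x₀ (x k) (p k)) atTop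
        (𝓝 (covectorCoord I x₀ x₀ p₀)) := by
  have h0 : (⟨x₀, p₀⟩ : TotalSpace (V →L[ℝ] ℝ)
      (fun y : M => TangentSpace I y →L[ℝ] Bundle.Trivial M ℝ y)) ∈
      (trivializationAt (V →L[ℝ] ℝ)
    (fun y : M => TangentSpace I y →L[ℝ] Bundle.Trivial M ℝ y) x₀).source := by
      rw [Trivialization.mem_source]
      exact mem_baseSet_trivializationAt _ _ _
  have h := tendsto_totalSpace_mk_iff (E := fun y : M => TangentSpace I y →L[ℝ] Bundle.Trivial M ℝ y) (trivializationAt (V →L[ℝ] ℝ)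
    (fun y : M => TangentSpace I y →L[ℝ] Bundle.Trivial M ℝ y) x₀) (x := x) (p := p) (x₀ := x₀)
    (p₀ := p₀) h0
  simp only [hom_trivializationAt_snd] at h
  exact h

/-- The differential of a map to a vector space, read in the frame of the chart at `x₀`. -/
def mfderivCoord {V' : Type*} [NormedAddCommGroup V'] [NormedSpace ℝ V'] (g : M → V')
    (x₀ x : M) : V →L[ℝ] V' :=
  ContinuousLinearMap.comp (M₂ := TangentSpace I x) (M₃ := V') (mfderiv I 𝓘(ℝ, V') g x)
    (tangentFrame I x₀ x)

lemma mfderivCoord_apply {V' : Type*} [NormedAddCommGroup V'] [NormedSpace ℝ V'] (g : M → V')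
    (x₀ x : M) (v : V) :
    mfderivCoord I g x₀ x v = mfderiv I 𝓘(ℝ, V') g x (tangentFrame I x₀ x v) := rfl

lemma mfderivCoord_self {V' : Type*} [NormedAddCommGroup V'] [NormedSpace ℝ V'] (g : M → V')
    (x₀ : M) (v : V) :
    mfderivCoord I g x₀ x₀ v = mfderiv I 𝓘(ℝ, V') g x₀ v := by
  rw [mfderivCoord_apply, tangentFrame_self]

/-- For a vector space target the tangent coordinates on the target side are trivial, so continuity
of the differential of a `C^1` map is continuity of its expression in the source frame alone. -/
lemma tendsto_mfderivCoord {V' : Type*} [NormedAddCommGroup V'] [NormedSpace ℝ V']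
    {g : M → V'} (hg : ContMDiff I 𝓘(ℝ, V') 1 g) (x₀ : M) :
    Tendsto (mfderivCoord I g x₀) (𝓝 x₀) (𝓝 (mfderivCoord I g x₀ x₀)) := by
  have h := ((hg x₀).mfderiv_const (m := 0) (by simp)).continuousAt
  have key : inTangentCoordinates I 𝓘(ℝ, V') id g (mfderiv I 𝓘(ℝ, V') g) x₀ =
      mfderivCoord I g x₀ := by
    ext x v
    simp [inTangentCoordinates, ContinuousLinearMap.inCoordinates, tangentFrame, mfderivCoord]
    rfl
  rw [key] at h
  exact h

end TangentFrame

/-! ### Frames, partial derivatives and covector components on products -/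

section ProductFrame

variable {V : Type*} [NormedAddCommGroup V] [NormedSpace ℝ V]
  {H : Type*} [TopologicalSpace H] {I : ModelWithCorners ℝ V H}
  {M : Type*} [TopologicalSpace M] [ChartedSpace H M] [IsManifold I 1 M]
  {V' : Type*} [NormedAddCommGroup V'] [NormedSpace ℝ V']
  {H' : Type*} [TopologicalSpace H'] {I' : ModelWithCorners ℝ V' H'}
  {M' : Type*} [TopologicalSpace M'] [ChartedSpace H' M'] [IsManifold I' 1 M']

/-- The frame inverts the differential of the chart, and the chart of a product is the product of
the charts. -/
lemma tangentFrame_prod {a x : M} {b y : M'} (hx : x ∈ (chartAt H a).source)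
    (hy : y ∈ (chartAt H' b).source) (v : V) (w : V') :
    tangentFrame (I.prod I') (a, b) (x, y) (v, w) =
      (tangentFrame I a x v, tangentFrame I' b y w) := by
  have hxy : (x, y) ∈ (chartAt (ModelProd H H') (a, b)).source := by
    simp [hx, hy]
  refine tangentFrame_unique (I.prod I') hxy ?_
  have h1 : MDifferentiableAt I 𝓘(ℝ, V) (extChartAt I a) x := mdifferentiableAt_extChartAt hx
  have h2 : MDifferentiableAt I' 𝓘(ℝ, V') (extChartAt I' b) y := mdifferentiableAt_extChartAt hy
  have h3 : (extChartAt (I.prod I') (a, b) : M × M' → V × V') =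
      Prod.map (extChartAt I a) (extChartAt I' b) := by
    rw [extChartAt_prod]; rfl
  have h4 := mfderiv_prodMap (p := (x, y)) h1 h2
  rw [modelWithCornersSelf_prod, ← chartedSpaceSelf_prod]
  rw [h3]
  have h5 := congrArg (fun L => L (tangentFrame I a x v, tangentFrame I' b y w)) h4
  refine h5.trans ?_
  exact Prod.ext (mfderiv_extChartAt_comp_tangentFrame I hx v)
    (mfderiv_extChartAt_comp_tangentFrame I' hy w)
end ProductFrame

section ProductCovector
variable {V V' : Type*} [NormedAddCommGroup V] [NormedSpace ℝ V]
  [NormedAddCommGroup V'] [NormedSpace ℝ V']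
  {Q U : Type*} [TopologicalSpace Q] [ChartedSpace V Q] [TopologicalSpace U] [ChartedSpace V' U]

lemma mfderiv_comp_prodMk_left {G : Type*} [NormedAddCommGroup G] [NormedSpace ℝ G]
    {P : Type*} [TopologicalSpace P] [ChartedSpace G P]
    {g : Q × U → P} (hg : ContMDiff (𝓘(ℝ, V).prod 𝓘(ℝ, V')) 𝓘(ℝ, G) 1 g) (x : Q × U) (v : V) :
    mfderiv 𝓘(ℝ, V) 𝓘(ℝ, G) (fun q : Q => g (q, x.2)) x.1 v =
      mfderiv (𝓘(ℝ, V).prod 𝓘(ℝ, V')) 𝓘(ℝ, G) g x (v, 0) := by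
  have h1 : MDifferentiableAt (𝓘(ℝ, V).prod 𝓘(ℝ, V')) 𝓘(ℝ, G) g (x.1, x.2) :=
    (hg.mdifferentiable one_ne_zero) _
  have h2 : MDifferentiableAt 𝓘(ℝ, V) (𝓘(ℝ, V).prod 𝓘(ℝ, V')) (fun q : Q => (q, x.2)) x.1 :=
    mdifferentiableAt_id.prodMk mdifferentiableAt_const
  have h3 := mfderiv_comp x.1 h1 h2
  have h4 : mfderiv 𝓘(ℝ, V) (𝓘(ℝ, V).prod 𝓘(ℝ, V')) (fun q : Q => (q, x.2)) x.1 v = (v, 0) := by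
    rw [mfderiv_prod_left]; rfl
  have h5 := congrArg (fun L => L v) h3
  refine h5.trans ?_
  exact congrArg (mfderiv (𝓘(ℝ, V).prod 𝓘(ℝ, V')) 𝓘(ℝ, G) g x) h4

lemma mfderiv_comp_prodMk_right {G : Type*} [NormedAddCommGroup G] [NormedSpace ℝ G]
    {P : Type*} [TopologicalSpace P] [ChartedSpace G P]
    {g : Q × U → P} (hg : ContMDiff (𝓘(ℝ, V).prod 𝓘(ℝ, V')) 𝓘(ℝ, G) 1 g) (x : Q × U) (v : V') :
    mfderiv 𝓘(ℝ, V') 𝓘(ℝ, G) (fun u : U => g (x.1, u)) x.2 v =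
      mfderiv (𝓘(ℝ, V).prod 𝓘(ℝ, V')) 𝓘(ℝ, G) g x (0, v) := by
  have h1 : MDifferentiableAt (𝓘(ℝ, V).prod 𝓘(ℝ, V')) 𝓘(ℝ, G) g (x.1, x.2) :=
    (hg.mdifferentiable one_ne_zero) _
  have h2 : MDifferentiableAt 𝓘(ℝ, V') (𝓘(ℝ, V).prod 𝓘(ℝ, V')) (fun u : U => (x.1, u)) x.2 :=
    mdifferentiableAt_const.prodMk mdifferentiableAt_id
  have h3 := mfderiv_comp x.2 h1 h2
  have h4 : mfderiv 𝓘(ℝ, V') (𝓘(ℝ, V).prod 𝓘(ℝ, V')) (fun u : U => (x.1, u)) x.2 v = (0, v) := by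
    rw [mfderiv_prod_right]; rfl
  have h5 := congrArg (fun L => L v) h3
  refine h5.trans ?_
  exact congrArg (mfderiv (𝓘(ℝ, V).prod 𝓘(ℝ, V')) 𝓘(ℝ, G) g x) h4

lemma covectorFst_apply (x : Q × U) (ξ : CotangentSpace (𝓘(ℝ, V).prod 𝓘(ℝ, V')) x) (v : V) :
    covectorFst x ξ v = ξ (v, 0) := by
  unfold covectorFst
  have h4 : mfderiv 𝓘(ℝ, V) (𝓘(ℝ, V).prod 𝓘(ℝ, V')) (fun q : Q => (q, x.2)) x.1 v = (v, 0) := by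
    rw [mfderiv_prod_left]; rfl
  exact congrArg ξ h4

lemma covectorSnd_apply (x : Q × U) (ξ : CotangentSpace (𝓘(ℝ, V).prod 𝓘(ℝ, V')) x) (v : V') :
    covectorSnd x ξ v = ξ (0, v) := by
  unfold covectorSnd
  have h4 : mfderiv 𝓘(ℝ, V') (𝓘(ℝ, V).prod 𝓘(ℝ, V')) (fun u : U => (x.1, u)) x.2 v = (0, v) := by
    rw [mfderiv_prod_right]; rfl
  exact congrArg ξ h4

variable [IsManifold 𝓘(ℝ, V) 1 Q] [IsManifold 𝓘(ℝ, V') 1 U]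

lemma covectorCoord_covectorFst {a x : Q × U} (hx : x.1 ∈ (chartAt V a.1).source)
    (hy : x.2 ∈ (chartAt V' a.2).source) (ξ : CotangentSpace (𝓘(ℝ, V).prod 𝓘(ℝ, V')) x) (v : V) :
    covectorCoord 𝓘(ℝ, V) a.1 x.1 (covectorFst x ξ) v =
      covectorCoord (𝓘(ℝ, V).prod 𝓘(ℝ, V')) a x ξ (v, 0) := by
  rw [covectorCoord_apply, covectorCoord_apply]
  refine (covectorFst_apply x ξ _).trans ?_
  have := tangentFrame_prod (I := 𝓘(ℝ, V)) (I' := 𝓘(ℝ, V')) hx hy v 0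
  rw [map_zero] at this
  exact congrArg ξ this.symm

lemma covectorCoord_covectorSnd {a x : Q × U} (hx : x.1 ∈ (chartAt V a.1).source)
    (hy : x.2 ∈ (chartAt V' a.2).source) (ξ : CotangentSpace (𝓘(ℝ, V).prod 𝓘(ℝ, V')) x) (v : V') :
    covectorCoord 𝓘(ℝ, V') a.2 x.2 (covectorSnd x ξ) v =
      covectorCoord (𝓘(ℝ, V).prod 𝓘(ℝ, V')) a x ξ (0, v) := by
  rw [covectorCoord_apply, covectorCoord_apply]
  refine (covectorSnd_apply x ξ _).trans ?_
  have := tangentFrame_prod (I := 𝓘(ℝ, V)) (I' := 𝓘(ℝ, V')) hx hy 0 v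
  rw [map_zero] at this
  exact congrArg ξ this.symm

lemma mfderivCoord_partial_left {G : Type*} [NormedAddCommGroup G] [NormedSpace ℝ G]
    {g : Q × U → G} (hg : ContMDiff (𝓘(ℝ, V).prod 𝓘(ℝ, V')) 𝓘(ℝ, G) 1 g) {a x : Q × U}
    (hx : x.1 ∈ (chartAt V a.1).source) (hy : x.2 ∈ (chartAt V' a.2).source) (v : V) :
    mfderivCoord 𝓘(ℝ, V) (fun q : Q => g (q, x.2)) a.1 x.1 v =
      mfderivCoord (𝓘(ℝ, V).prod 𝓘(ℝ, V')) g a x (v, 0) := by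
  rw [mfderivCoord_apply, mfderivCoord_apply]
  have := tangentFrame_prod (I := 𝓘(ℝ, V)) (I' := 𝓘(ℝ, V')) hx hy v 0
  rw [map_zero] at this
  refine (mfderiv_comp_prodMk_left hg x _).trans ?_
  exact congrArg (mfderiv (𝓘(ℝ, V).prod 𝓘(ℝ, V')) 𝓘(ℝ, G) g x) this.symm

lemma mfderivCoord_partial_right {G : Type*} [NormedAddCommGroup G] [NormedSpace ℝ G]
    {g : Q × U → G} (hg : ContMDiff (𝓘(ℝ, V).prod 𝓘(ℝ, V')) 𝓘(ℝ, G) 1 g) {a x : Q × U}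
    (hx : x.1 ∈ (chartAt V a.1).source) (hy : x.2 ∈ (chartAt V' a.2).source) (v : V') :
    mfderivCoord 𝓘(ℝ, V') (fun u : U => g (x.1, u)) a.2 x.2 v =
      mfderivCoord (𝓘(ℝ, V).prod 𝓘(ℝ, V')) g a x (0, v) := by
  rw [mfderivCoord_apply, mfderivCoord_apply]
  have := tangentFrame_prod (I := 𝓘(ℝ, V)) (I' := 𝓘(ℝ, V')) hx hy 0 v
  rw [map_zero] at this
  refine (mfderiv_comp_prodMk_right hg x _).trans ?_
  exact congrArg (mfderiv (𝓘(ℝ, V).prod 𝓘(ℝ, V')) 𝓘(ℝ, G) g x) this.symm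

end ProductCovector

/-! ### Local comparison of Riemannian quantities with coordinates -/

section RiemannianComparison

variable {V : Type*} [NormedAddCommGroup V] [NormedSpace ℝ V]
  {M : Type*}

/-- The norm of the local trivialization is bounded near `x₀`. Only this direction is needed:
covectors with small coordinates have small Riemannian norm, which is what contradicts the lower
bound `Δ` in regularity. -/
lemma exists_covectorNorm_le [TopologicalSpace M] [ChartedSpace V M] [IsManifold 𝓘(ℝ, V) 1 M]
    [RiemannianBundle (fun x : M => TangentSpace 𝓘(ℝ, V) x)]
    [IsContinuousRiemannianBundle V (fun x : M => TangentSpace 𝓘(ℝ, V) x)] (x₀ : M) :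
    ∃ C > (0 : ℝ), ∀ᶠ x in 𝓝 x₀, ∀ p : CotangentSpace 𝓘(ℝ, V) x,
      covectorNorm x p ≤ C * ‖covectorCoord 𝓘(ℝ, V) x₀ x p‖ := by
  obtain ⟨C, hC, h⟩ := eventually_norm_trivializationAt_lt V
    (fun x : M => TangentSpace 𝓘(ℝ, V) x) x₀
  refine ⟨C, hC, ?_⟩
  filter_upwards [h, chart_source_mem_nhds V x₀] with x hx hxs p
  unfold covectorNorm
  refine ContinuousLinearMap.opNorm_le_bound _ (by positivity) fun v => ?_
  have h1 : p v = covectorCoord 𝓘(ℝ, V) x₀ x p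
      ((trivializationAt V (TangentSpace 𝓘(ℝ, V)) x₀).continuousLinearMapAt ℝ x v) := by
    rw [covectorCoord_apply, TangentBundle.continuousLinearMapAt_trivializationAt hxs]
    exact congrArg p (tangentFrame_comp_mfderiv_extChartAt _ hxs v).symm
  rw [h1]
  refine (ContinuousLinearMap.le_opNorm _ _).trans ?_
  have h2 := (ContinuousLinearMap.le_opNorm
    ((trivializationAt V (TangentSpace 𝓘(ℝ, V)) x₀).continuousLinearMapAt ℝ x) v)
  calc _ ≤ ‖covectorCoord 𝓘(ℝ, V) x₀ x p‖ * (C * ‖v‖) := by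
        gcongr
        exact h2.trans (by gcongr)
    _ = _ := by ring

/-- The straight segment between the two coordinate points, pulled back by the chart, is a path
whose speed is controlled by the norm of the frame. A ball in coordinates is used because it is
convex. -/
lemma exists_edist_le_edist_extChartAt [PseudoEMetricSpace M] [ChartedSpace V M]
    [IsManifold 𝓘(ℝ, V) 1 M]
    [RiemannianBundle (fun x : M => TangentSpace 𝓘(ℝ, V) x)]
    [IsContinuousRiemannianBundle V (fun x : M => TangentSpace 𝓘(ℝ, V) x)]
    [IsRiemannianManifold 𝓘(ℝ, V) M] (x₀ : M) :
    ∃ C > (0 : ℝ), ∃ A ∈ 𝓝 x₀, ∀ x ∈ A, ∀ y ∈ A, edist x y ≤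
      ENNReal.ofReal (C * ‖extChartAt 𝓘(ℝ, V) x₀ y - extChartAt 𝓘(ℝ, V) x₀ x‖) := by
  obtain ⟨C, C_pos, hC⟩ := eventually_norm_symmL_trivializationAt_lt V
    (fun x : M => TangentSpace 𝓘(ℝ, V) x) x₀
  refine ⟨C, C_pos, ?_⟩
  set S : Set M := {y | ‖tangentFrame 𝓘(ℝ, V) x₀ y‖ < C} with hS
  have hS_mem : S ∈ 𝓝 x₀ := hC
  obtain ⟨r, r_pos, hr⟩ : ∃ r > 0, Metric.ball (extChartAt 𝓘(ℝ, V) x₀ x₀) r ⊆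
      (extChartAt 𝓘(ℝ, V) x₀).target ∩ (extChartAt 𝓘(ℝ, V) x₀).symm ⁻¹' S :=
    Metric.mem_nhds_iff.1 (inter_mem (extChartAt_target_mem_nhds x₀)
      (extChartAt_preimage_mem_nhds hS_mem))
  have A : (extChartAt 𝓘(ℝ, V) x₀) ⁻¹' (Metric.ball (extChartAt 𝓘(ℝ, V) x₀ x₀) r) ∈ 𝓝 x₀ :=
    (continuousAt_extChartAt x₀).preimage_mem_nhds (Metric.ball_mem_nhds _ r_pos)
  refine ⟨_, inter_mem A (extChartAt_source_mem_nhds (I := 𝓘(ℝ, V)) x₀), ?_⟩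
  rintro x ⟨hx, hxs⟩ y ⟨hy, hys⟩
  set a := extChartAt 𝓘(ℝ, V) x₀ x with ha
  set b := extChartAt 𝓘(ℝ, V) x₀ y with hb
  let η : ℝ → V := fun t => a + t • (b - a)
  set γ := (extChartAt 𝓘(ℝ, V) x₀).symm ∘ η with hγ
  have hη : ∀ t ∈ Icc (0 : ℝ) 1, η t ∈ (extChartAt 𝓘(ℝ, V) x₀).target ∧ γ t ∈ S := by
    intro t ht
    exact hr ((convex_ball _ _).add_smul_sub_mem hx hy ht)
  have hηd : ∀ t, HasFDerivAt η ((1 : ℝ →L[ℝ] ℝ).smulRight (b - a)) t := fun t =>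
    ((hasFDerivAt_id t).smul_const (b - a)).const_add a
  have η_smooth : ContMDiffOn 𝓘(ℝ, ℝ) 𝓘(ℝ, V) 1 η (Icc 0 1) := by
    apply ContMDiff.contMDiffOn
    rw [contMDiff_iff_contDiff]
    exact contDiff_const.add (contDiff_id.smul contDiff_const)
  rw [IsRiemannianManifold.out (I := 𝓘(ℝ, V)) x y]
  have : riemannianEDist 𝓘(ℝ, V) x y ≤ pathELength 𝓘(ℝ, V) γ 0 1 := by
    apply riemannianEDist_le_pathELength _ _ _ zero_le_one
    · exact (contMDiffOn_extChartAt_symm x₀).comp η_smooth fun t ht => (hη t ht).1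
    · simp only [γ, η, Function.comp_apply, zero_smul, add_zero]
      exact (extChartAt 𝓘(ℝ, V) x₀).left_inv hxs
    · simp only [γ, η, Function.comp_apply, one_smul, add_sub_cancel]
      exact (extChartAt 𝓘(ℝ, V) x₀).left_inv hys
  apply this.trans
  rw [pathELength_eq_lintegral_mfderiv_Icc]
  -- The velocity of the path is the frame applied to the constant vector `b - a`, and the frame has
  -- norm less than `C` on `S`.
  have hbound : ∀ t ∈ Icc (0 : ℝ) 1, ‖mfderiv 𝓘(ℝ, ℝ) 𝓘(ℝ, V) γ t 1‖ₑ ≤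
      ENNReal.ofReal (C * ‖b - a‖) := by
    intro t ht
    obtain ⟨h1, h2⟩ := hη t ht
    have hsrc : γ t ∈ (chartAt V x₀).source := by
      rw [← extChartAt_source 𝓘(ℝ, V)]
      exact (extChartAt 𝓘(ℝ, V) x₀).map_target h1
    have hval : extChartAt 𝓘(ℝ, V) x₀ (γ t) = η t := (extChartAt 𝓘(ℝ, V) x₀).right_inv h1
    have hd : HasMFDerivAt 𝓘(ℝ, V) 𝓘(ℝ, V) (extChartAt 𝓘(ℝ, V) x₀).symm (η t)
        (mfderivWithin 𝓘(ℝ, V) 𝓘(ℝ, V) (extChartAt 𝓘(ℝ, V) x₀).symm (range 𝓘(ℝ, V)) (η t)) := by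
      have h3 := (mdifferentiableWithinAt_extChartAt_symm (I := 𝓘(ℝ, V)) h1).hasMFDerivWithinAt
      have h4 : range (𝓘(ℝ, V) : ModelWithCorners ℝ V V) = univ := by simp
      rw [h4] at h3 ⊢
      exact hasMFDerivWithinAt_univ.1 h3
    have hγd := (hd.comp t (hηd t).hasMFDerivAt).mfderiv
    have hframe := tangentFrame_eq_mfderivWithin 𝓘(ℝ, V) hsrc
    rw [hval] at hframe
    have h5 : mfderiv 𝓘(ℝ, ℝ) 𝓘(ℝ, V) γ t 1 = tangentFrame 𝓘(ℝ, V) x₀ (γ t) (b - a) := by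
      rw [hframe, hγd]
      have h6 : ((1 : ℝ →L[ℝ] ℝ).smulRight (b - a)) 1 = b - a := by simp
      exact congrArg (mfderivWithin 𝓘(ℝ, V) 𝓘(ℝ, V) (extChartAt 𝓘(ℝ, V) x₀).symm
        (range 𝓘(ℝ, V)) (η t)) h6
    rw [h5, ← ofReal_norm]
    apply ENNReal.ofReal_le_ofReal
    refine (ContinuousLinearMap.le_opNorm _ _).trans ?_
    gcongr
    exact le_of_lt h2
  refine (MeasureTheory.setLIntegral_mono' measurableSet_Icc hbound).trans ?_
  simp

end RiemannianComparison

/-! ### Globally defined coordinates -/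

section SmoothCoordinates

variable {V : Type*} [NormedAddCommGroup V] [NormedSpace ℝ V]
  {M : Type*} [TopologicalSpace M] [ChartedSpace V M] [IsManifold 𝓘(ℝ, V) ∞ M]

lemma mfderivCoord_of_eventuallyEq {Ψ : M → V} {x₀ x : M}
    (h : Ψ =ᶠ[𝓝 x] extChartAt 𝓘(ℝ, V) x₀) (hx : x ∈ (chartAt V x₀).source) :
    mfderivCoord 𝓘(ℝ, V) Ψ x₀ x = ContinuousLinearMap.id ℝ V := by
  ext v
  rw [mfderivCoord_apply, h.mfderiv_eq]
  exact mfderiv_extChartAt_comp_tangentFrame 𝓘(ℝ, V) hx v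

/-- A bump function cuts off the chart. A map on the whole manifold is needed because the test
functions in the Fréchet subdifferential are globally `C^1`. -/
lemma exists_contMDiff_eventuallyEq_extChartAt [FiniteDimensional ℝ V] [T2Space M] (x₀ : M) :
    ∃ Ψ : M → V, ContMDiff 𝓘(ℝ, V) 𝓘(ℝ, V) 1 Ψ ∧ Ψ =ᶠ[𝓝 x₀] extChartAt 𝓘(ℝ, V) x₀ := by
  let f : SmoothBumpFunction 𝓘(ℝ, V) x₀ := Classical.arbitrary _
  refine ⟨fun x => f x • extChartAt 𝓘(ℝ, V) x₀ x, ?_, ?_⟩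
  · have : ContMDiff 𝓘(ℝ, V) 𝓘(ℝ, V) ∞ (fun x => f x • extChartAt 𝓘(ℝ, V) x₀ x) :=
      f.contMDiff_smul contMDiffOn_extChartAt
    exact this.of_le (by exact_mod_cast le_top)
  · filter_upwards [f.eventuallyEq_one] with x hx
    simp [hx]

end SmoothCoordinates

/-! ### Subgradients and normals from smooth perturbations -/

section Frechet

variable {V : Type*} [NormedAddCommGroup V] [NormedSpace ℝ V]
  {H : Type*} [TopologicalSpace H] {I : ModelWithCorners ℝ V H}
  {M : Type*} [TopologicalSpace M] [ChartedSpace H M]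

/-- If `f + s` has a local minimum, then `-s` is itself a test function for `f`. This exact rule
replaces any sum rule for nonsmooth functions. -/
lemma mem_frechetSubdiff_of_isLocalMin {f s : M → ℝ} {x : M} (hs : ContMDiff I 𝓘(ℝ, ℝ) 1 s)
    (hmin : IsLocalMin (fun y => f y + s y) x) {p : CotangentSpace I x}
    (hp : ∀ v, p v = - mfderiv I 𝓘(ℝ, ℝ) s x v) :
    p ∈ frechetSubdiff I (fun y => ((f y : ℝ) : EReal)) x := by
  refine ⟨EReal.coe_ne_top _, EReal.coe_ne_bot _, fun y => - s y, hs.neg, ?_, ?_⟩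
  · intro v
    rw [hp]
    have := mfderiv_neg (I := I) (f := s) (x := x)
    exact (congrArg (fun L => L v) this).symm
  · filter_upwards [hmin] with y hy
    rw [← EReal.coe_sub, ← EReal.coe_sub, EReal.coe_le_coe_iff]
    simpa using hy

/-- Same test function `-s`, now for the indicator: off `S` the required inequality is trivial, so a
minimum relative to `S` suffices. -/
lemma mem_frechetSubdiff_setIndicator {S : Set M} {s : M → ℝ} {x : M}
    (hs : ContMDiff I 𝓘(ℝ, ℝ) 1 s) (hx : x ∈ S)
    (hmin : ∀ᶠ y in 𝓝 x, y ∈ S → s x ≤ s y) {p : CotangentSpace I x}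
    (hp : ∀ v, p v = - mfderiv I 𝓘(ℝ, ℝ) s x v) :
    p ∈ frechetSubdiff I (setIndicator S) x := by
  refine ⟨by simp [setIndicator, hx], by simp [setIndicator, hx], fun y => - s y, hs.neg, ?_, ?_⟩
  · intro v
    rw [hp]
    have := mfderiv_neg (I := I) (f := s) (x := x)
    exact (congrArg (fun L => L v) this).symm
  · filter_upwards [hmin] with y hy
    by_cases hyS : y ∈ S
    · simp only [setIndicator, hx, hyS, if_true]
      have := hy hyS
      rw [← EReal.coe_zero, ← EReal.coe_sub, ← EReal.coe_sub, EReal.coe_le_coe_iff]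
      simpa using this
    · simp only [setIndicator, hyS, if_false]
      rw [EReal.top_sub_coe]
      exact le_top

lemma frechetSubdiff_subset_limitingSubdiff [IsManifold I 1 M] (f : M → EReal) (x : M) :
    frechetSubdiff I f x ⊆ limitingSubdiff I f x := fun p hp =>
  ⟨fun _ => x, fun _ => p, tendsto_const_nhds, fun _ => hp, tendsto_const_nhds,
    tendsto_const_nhds⟩

lemma mem_limitingNormalCone_of_tendsto [IsManifold I 1 M] {S : Set M} {x : ℕ → M} {x₀ : M}
    {p : ∀ k, CotangentSpace I (x k)} {p₀ : CotangentSpace I x₀} (hx : ∀ k, x k ∈ S)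
    (hx₀ : x₀ ∈ S) (hp : ∀ k, p k ∈ frechetSubdiff I (setIndicator S) (x k))
    (h : CotangentTendsto I x p x₀ p₀) : p₀ ∈ limitingNormalCone I S x₀ :=
  ⟨x, p, ((cotangentTendsto_iff I).1 h).1, hp, by simp [setIndicator, hx, hx₀], h⟩

end Frechet

/-! ### A smooth squared norm in finite dimension -/

section SquaredNorm

variable {V : Type*} [NormedAddCommGroup V] [NormedSpace ℝ V] [FiniteDimensional ℝ V]

/-- The square of a Euclidean norm on a finite-dimensional space. -/
def euclideanSq (v : V) : ℝ := ‖toEuclidean v‖ ^ 2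

lemma contDiff_euclideanSq : ContDiff ℝ 1 (euclideanSq : V → ℝ) :=
  (contDiff_norm_sq ℝ).comp (toEuclidean (E := V)).contDiff

lemma euclideanSq_nonneg (v : V) : 0 ≤ euclideanSq v := by unfold euclideanSq; positivity

@[simp] lemma euclideanSq_zero : euclideanSq (0 : V) = 0 := by simp [euclideanSq]

lemma euclideanSq_eq_zero {v : V} : euclideanSq v = 0 ↔ v = 0 := by simp [euclideanSq]

variable (V) in
lemma exists_norm_sq_le_euclideanSq : ∃ c > (0 : ℝ), ∀ v : V, ‖v‖ ^ 2 ≤ c * euclideanSq v := by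
  refine ⟨(‖((toEuclidean (E := V)).symm : EuclideanSpace ℝ (Fin (Module.finrank ℝ V)) →L[ℝ] V)‖ + 1) ^ 2, by positivity, fun v => ?_⟩
  rw [euclideanSq, ← mul_pow]
  gcongr
  calc ‖v‖ = ‖((toEuclidean (E := V)).symm : EuclideanSpace ℝ (Fin (Module.finrank ℝ V)) →L[ℝ] V) (toEuclidean v)‖ := by simp
    _ ≤ ‖((toEuclidean (E := V)).symm : EuclideanSpace ℝ (Fin (Module.finrank ℝ V)) →L[ℝ] V)‖ * ‖toEuclidean v‖ :=
        ContinuousLinearMap.le_opNorm _ _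
    _ ≤ _ := by gcongr; linarith

variable (V) in
-- The differential of a squared norm is linear in the norm. This makes the differential of the
-- proximity term of order `η l` where that term is of order `η l²`.
lemma exists_norm_fderiv_euclideanSq_le :
    ∃ c > (0 : ℝ), ∀ v : V, ‖fderiv ℝ euclideanSq v‖ ≤ c * Real.sqrt (euclideanSq v) := by
  refine ⟨2 * (‖(toEuclidean (E := V) : V →L[ℝ] EuclideanSpace ℝ (Fin (Module.finrank ℝ V)))‖ + 1), by positivity, fun v => ?_⟩
  have h : HasFDerivAt (euclideanSq : V → ℝ)
      ((2 • innerSL ℝ (toEuclidean v)).comp (toEuclidean (E := V) : V →L[ℝ] EuclideanSpace ℝ (Fin (Module.finrank ℝ V)))) v :=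
    (hasStrictFDerivAt_norm_sq (toEuclidean v)).hasFDerivAt.comp v
      (toEuclidean (E := V)).hasFDerivAt
  rw [h.fderiv, euclideanSq, Real.sqrt_sq (norm_nonneg _)]
  refine (ContinuousLinearMap.opNorm_comp_le _ _).trans ?_
  have : ‖(2 • innerSL ℝ (toEuclidean v) : _ →L[ℝ] ℝ)‖ ≤ 2 * ‖toEuclidean v‖ := by
    rw [two_nsmul]
    refine (norm_add_le _ _).trans (le_of_eq ?_)
    rw [innerSL_apply_norm]; ring
  calc _ ≤ (2 * ‖toEuclidean v‖) * (‖(toEuclidean (E := V) : V →L[ℝ] EuclideanSpace ℝ (Fin (Module.finrank ℝ V)))‖ + 1) := by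
        gcongr; linarith
    _ = _ := by ring

end SquaredNorm

lemma isContinuousRiemannianBundle_of_contMDiff {V : Type*} [NormedAddCommGroup V]
    [NormedSpace ℝ V] {M : Type*} [TopologicalSpace M] [ChartedSpace V M]
    [IsManifold 𝓘(ℝ, V) ∞ M] [RiemannianBundle (fun x : M => TangentSpace 𝓘(ℝ, V) x)]
    [h : IsContMDiffRiemannianBundle 𝓘(ℝ, V) ∞ V (fun x : M => TangentSpace 𝓘(ℝ, V) x)] :
    IsContinuousRiemannianBundle V (fun x : M => TangentSpace 𝓘(ℝ, V) x) := by
  obtain ⟨g, hg, h'⟩ := h.exists_contMDiff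
  exact ⟨g, hg.continuous, h'⟩

/-! ### Penalization on compact sets and extraction of subsequences -/

section Optimization

variable {Z : Type*} [TopologicalSpace Z]

/-- On a compact set, minimizers of `f + K g` for large `K` satisfy any open condition that
holds at all points with `g z = 0` and `f z ≤ f z₀`. -/
lemma exists_penalized_minimizer {C : Set Z} (hC : IsCompact C) {f g h : Z → ℝ}
    (hf : ContinuousOn f C) (hg : ContinuousOn g C) (hh : ContinuousOn h C)
    (hg0 : ∀ z ∈ C, 0 ≤ g z) {z₀ : Z} (hz₀ : z₀ ∈ C) (hgz₀ : g z₀ = 0)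
    {O : Set Z} (hO : IsOpen O) (hpos : ∀ z ∈ C, g z = 0 → f z ≤ f z₀ → z ∈ O ∧ 0 < h z) :
    ∃ K : ℝ, 0 ≤ K ∧ ∃ z ∈ C, z ∈ O ∧ 0 < h z ∧ IsMinOn (fun y => f y + K * g y) C z := by
  have hmin : ∀ K : ℝ, ∃ z ∈ C, IsMinOn (fun y => f y + K * g y) C z := fun K =>
    hC.exists_isMinOn ⟨z₀, hz₀⟩ (hf.add (continuousOn_const.mul hg))
  by_contra! hcon
  choose z hzC hz using hmin
  have hle : ∀ n : ℕ, z n ∈ O → h (z n) ≤ 0 := by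
    intro n hnO
    by_contra! hn
    exact hcon n (Nat.cast_nonneg n) (z n) (hzC n) hnO hn (hz n)
  -- The space is not assumed first countable, so cluster points of the minimizers for `K = n` are
  -- reached along a free ultrafilter rather than a subsequence.
  let l : Ultrafilter ℕ := Filter.hyperfilter ℕ
  have hl : (l : Filter ℕ) ≤ atTop := Nat.hyperfilter_le_atTop
  obtain ⟨y, hyC, hy⟩ := hC.ultrafilter_le_nhds (l.map fun n : ℕ => z n)
    (by
      rw [le_principal_iff]
      change (fun n : ℕ => z n) ⁻¹' C ∈ l
      exact univ_mem' fun n : ℕ => hzC n)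
  have hy' : Tendsto (fun n : ℕ => z n) l (𝓝[C] y) :=
    tendsto_nhdsWithin_iff.2 ⟨hy, univ_mem' fun n : ℕ => hzC n⟩
  have hfy := (hf y hyC).tendsto.comp hy'
  have hgy := (hg y hyC).tendsto.comp hy'
  have hhy := (hh y hyC).tendsto.comp hy'
  have hval : ∀ n : ℕ, f (z n) + n * g (z n) ≤ f z₀ := by
    intro n
    have := hz n hz₀
    simpa [hgz₀] using this
  have hf_le : f y ≤ f z₀ := le_of_tendsto hfy (univ_mem' fun n : ℕ => by
    have h1 := hval n
    have h2 := mul_nonneg (Nat.cast_nonneg (α := ℝ) n) (hg0 _ (hzC n))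
    change f (z n) ≤ f z₀
    linarith)
  have hg_zero : g y = 0 := by
    refine le_antisymm ?_ (hg0 y hyC)
    -- Comparison with `z₀` gives `g (z n) ≤ (f z₀ - f (z n)) / n`, and the numerator converges, so
    -- the limit point has `g = 0`.
    have h1 : Tendsto (fun n : ℕ => (f z₀ - f (z n)) * (1 / (n : ℝ))) l
        (𝓝 ((f z₀ - f y) * 0)) :=
      (tendsto_const_nhds.sub hfy).mul (tendsto_one_div_atTop_nhds_zero_nat.mono_left hl)
    rw [mul_zero] at h1
    refine le_of_tendsto_of_tendsto hgy h1
      (((eventually_gt_atTop 0).filter_mono hl).mono fun n hn => ?_)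
    have hn' : (0 : ℝ) < n := by exact_mod_cast hn
    change g (z n) ≤ (f z₀ - f (z n)) * (1 / (n : ℝ))
    rw [mul_one_div, le_div_iff₀ hn']
    linarith [hval n]
  obtain ⟨hyO, hy_pos⟩ := hpos y hyC hg_zero hf_le
  have hO' : ∀ᶠ n : ℕ in l, z n ∈ O := hy (hO.mem_nhds hyO)
  exact absurd (le_of_tendsto hhy (hO'.mono fun n hn => hle n hn)) (not_le.2 hy_pos)

end Optimization

/-- Successive refinement over a finite index set; heredity ensures that a later extraction does not
destroy the properties already obtained. -/
lemma exists_common_subseq {ι : Type*} [Finite ι] (p : ι → (ℕ → ℕ) → Prop)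
    (hered : ∀ i (σ τ : ℕ → ℕ), StrictMono τ → p i σ → p i (σ ∘ τ))
    (hex : ∀ i (σ : ℕ → ℕ), StrictMono σ → ∃ τ : ℕ → ℕ, StrictMono τ ∧ p i (σ ∘ τ)) :
    ∃ σ : ℕ → ℕ, StrictMono σ ∧ ∀ i, p i σ := by
  classical
  cases nonempty_fintype ι
  suffices h : ∀ s : Finset ι, ∃ σ : ℕ → ℕ, StrictMono σ ∧ ∀ i ∈ s, p i σ by
    obtain ⟨σ, hσ, h⟩ := h Finset.univ
    exact ⟨σ, hσ, fun i => h i (Finset.mem_univ i)⟩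
  intro s
  induction s using Finset.induction_on with
  | empty => exact ⟨id, strictMono_id, by simp⟩
  | insert a s ha ih =>
    obtain ⟨σ, hσ, h⟩ := ih
    obtain ⟨τ, hτ, h'⟩ := hex a σ hσ
    refine ⟨σ ∘ τ, hσ.comp hτ, fun i hi => ?_⟩
    rcases Finset.mem_insert.1 hi with rfl | hi
    · exact h'
    · exact hered i σ τ hτ (h i hi)

/-! ### Differentials of the quadratic penalties -/

section CoordinateCalculus

variable {V : Type*} [NormedAddCommGroup V] [NormedSpace ℝ V]
  {H : Type*} [TopologicalSpace H] {I : ModelWithCorners ℝ V H}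
  {M : Type*} [TopologicalSpace M] [ChartedSpace H M] [IsManifold I 1 M]
  {G : Type*} [NormedAddCommGroup G] [NormedSpace ℝ G]

lemma mfderivCoord_add {f g : M → G} (hf : ContMDiff I 𝓘(ℝ, G) 1 f)
    (hg : ContMDiff I 𝓘(ℝ, G) 1 g) (x₀ x : M) :
    mfderivCoord I (fun y => f y + g y) x₀ x = mfderivCoord I f x₀ x + mfderivCoord I g x₀ x := by
  ext v
  have := mfderiv_add (hf.mdifferentiable one_ne_zero x) (hg.mdifferentiable one_ne_zero x)
  exact congrArg (fun L => L (tangentFrame I x₀ x v)) this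

lemma mfderivCoord_const (c : G) (x₀ x : M) : mfderivCoord I (fun _ => c) x₀ x = 0 := by
  ext v
  have := mfderiv_const (I := I) (I' := 𝓘(ℝ, G)) (c := c) (x := x)
  exact congrArg (fun L => L (tangentFrame I x₀ x v)) this

lemma mfderivCoord_comp_of_hasFDerivAt {G' : Type*} [NormedAddCommGroup G'] [NormedSpace ℝ G']
    {f : M → G} (hf : ContMDiff I 𝓘(ℝ, G) 1 f) {h : G → G'} {L : G →L[ℝ] G'} {x : M}
    (hh : HasFDerivAt h L (f x)) (x₀ : M) :
    mfderivCoord I (fun y => h (f y)) x₀ x = L.comp (mfderivCoord I f x₀ x) := by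
  ext v
  have h1 := (hh.hasMFDerivAt.comp x (hf.mdifferentiable one_ne_zero x).hasMFDerivAt).mfderiv
  exact congrArg (fun L => L (tangentFrame I x₀ x v)) h1

variable [FiniteDimensional ℝ G]

lemma contMDiff_const_mul_euclideanSq {M : Type*} [TopologicalSpace M] [ChartedSpace H M]
    {f : M → G} (hf : ContMDiff I 𝓘(ℝ, G) 1 f) (K : ℝ) :
    ContMDiff I 𝓘(ℝ, ℝ) 1 (fun y => K * euclideanSq (f y)) :=
  (contDiff_const.mul contDiff_euclideanSq).contMDiff.comp hf

lemma hasFDerivAt_euclideanSq (v : G) :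
    HasFDerivAt (euclideanSq : G → ℝ) (fderiv ℝ euclideanSq v) v :=
  (contDiff_euclideanSq.differentiable one_ne_zero v).hasFDerivAt

lemma mfderivCoord_sq_sub_const {f : M → G} (hf : ContMDiff I 𝓘(ℝ, G) 1 f) (K : ℝ) (c : G)
    (x₀ x : M) :
    mfderivCoord I (fun y => K * euclideanSq (f y - c)) x₀ x =
      (K • fderiv ℝ euclideanSq (f x - c)).comp (mfderivCoord I f x₀ x) := by
  refine mfderivCoord_comp_of_hasFDerivAt (h := fun z => K * euclideanSq (z - c)) hf ?_ x₀
  have := (hasFDerivAt_euclideanSq (f x - c)).comp (f x) ((hasFDerivAt_id (f x)).sub_const c)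
  rw [ContinuousLinearMap.comp_id] at this
  exact this.const_mul K

lemma mfderivCoord_sq_const_sub {f : M → G} (hf : ContMDiff I 𝓘(ℝ, G) 1 f) (K : ℝ) (c : G)
    (x₀ x : M) :
    mfderivCoord I (fun y => K * euclideanSq (c - f y)) x₀ x =
      -(K • fderiv ℝ euclideanSq (c - f x)).comp (mfderivCoord I f x₀ x) := by
  rw [← ContinuousLinearMap.neg_comp]
  refine mfderivCoord_comp_of_hasFDerivAt (h := fun z => K * euclideanSq (c - z)) hf ?_ x₀
  have := (hasFDerivAt_euclideanSq (c - f x)).comp (f x) ((hasFDerivAt_id (f x)).const_sub c)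
  rw [ContinuousLinearMap.comp_neg, ContinuousLinearMap.comp_id] at this
  have h2 := this.const_mul K
  rw [smul_neg] at h2
  exact h2

end CoordinateCalculus

section NegDifferential

variable {V : Type*} [NormedAddCommGroup V] [NormedSpace ℝ V]
  {H : Type*} [TopologicalSpace H] (I : ModelWithCorners ℝ V H)
  {M : Type*} [TopologicalSpace M] [ChartedSpace H M]

/-- The covector `-ds(x)`. -/
def negDifferential (s : M → ℝ) (x : M) : CotangentSpace I x :=
  -(show TangentSpace I x →L[ℝ] ℝ from mfderiv I 𝓘(ℝ, ℝ) s x)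

lemma covectorCoord_negDifferential [IsManifold I 1 M] (s : M → ℝ) (x₀ x : M) :
    covectorCoord I x₀ x (negDifferential I s x) = - mfderivCoord I s x₀ x := rfl

end NegDifferential

section ProductCalculus

variable {V V' : Type*} [NormedAddCommGroup V] [NormedSpace ℝ V]
  [NormedAddCommGroup V'] [NormedSpace ℝ V']
  {Q U : Type*} [TopologicalSpace Q] [ChartedSpace V Q] [TopologicalSpace U] [ChartedSpace V' U]
  [IsManifold 𝓘(ℝ, V) 1 Q] [IsManifold 𝓘(ℝ, V') 1 U]
  {G : Type*} [NormedAddCommGroup G] [NormedSpace ℝ G]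

lemma mfderivCoord_comp_fst {f : Q → G} (hf : ContMDiff 𝓘(ℝ, V) 𝓘(ℝ, G) 1 f) {a x : Q × U}
    (hx : x.1 ∈ (chartAt V a.1).source) (hy : x.2 ∈ (chartAt V' a.2).source) :
    mfderivCoord (𝓘(ℝ, V).prod 𝓘(ℝ, V')) (fun y : Q × U => f y.1) a x =
      (mfderivCoord 𝓘(ℝ, V) f a.1 x.1).comp (ContinuousLinearMap.fst ℝ V V') := by
  ext v
  · have h1 := mfderivCoord_partial_left (hf.comp contMDiff_fst : ContMDiff
      (𝓘(ℝ, V).prod 𝓘(ℝ, V')) 𝓘(ℝ, G) 1 (fun y : Q × U => f y.1)) hx hy v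
    exact h1.symm
  · have h1 := mfderivCoord_partial_right (hf.comp contMDiff_fst : ContMDiff
      (𝓘(ℝ, V).prod 𝓘(ℝ, V')) 𝓘(ℝ, G) 1 (fun y : Q × U => f y.1)) hx hy v
    have h2 := mfderivCoord_const (I := 𝓘(ℝ, V')) (f x.1) a.2 x.2
    exact (h1.symm.trans (congrArg (fun L => L v) h2)).trans (by simp)

lemma mfderivCoord_comp_snd {f : U → G} (hf : ContMDiff 𝓘(ℝ, V') 𝓘(ℝ, G) 1 f) {a x : Q × U}
    (hx : x.1 ∈ (chartAt V a.1).source) (hy : x.2 ∈ (chartAt V' a.2).source) :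
    mfderivCoord (𝓘(ℝ, V).prod 𝓘(ℝ, V')) (fun y : Q × U => f y.2) a x =
      (mfderivCoord 𝓘(ℝ, V') f a.2 x.2).comp (ContinuousLinearMap.snd ℝ V V') := by
  ext v
  · have h1 := mfderivCoord_partial_left (hf.comp contMDiff_snd : ContMDiff
      (𝓘(ℝ, V).prod 𝓘(ℝ, V')) 𝓘(ℝ, G) 1 (fun y : Q × U => f y.2)) hx hy v
    have h2 := mfderivCoord_const (I := 𝓘(ℝ, V)) (f x.2) a.1 x.1
    exact (h1.symm.trans (congrArg (fun L => L v) h2)).trans (by simp)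
  · have h1 := mfderivCoord_partial_right (hf.comp contMDiff_snd : ContMDiff
      (𝓘(ℝ, V).prod 𝓘(ℝ, V')) 𝓘(ℝ, G) 1 (fun y : Q × U => f y.2)) hx hy v
    exact h1.symm

end ProductCalculus

/-! ### Perturbing one block of variables in a sum -/

section SumUpdate

lemma sum_apply_update {ι : Type*} [Fintype ι] [DecidableEq ι] {β : ι → Type*}
    (G : ∀ j, β j → ℝ) (v : ∀ j, β j) (i : ι) (x : β i) :
    ∑ j, G j (Function.update v i x j) = ∑ j, G j (v j) + (G i x - G i (v i)) := by
  rw [← sub_eq_iff_eq_add', ← Finset.sum_sub_distrib, Finset.sum_eq_single i]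
  · simp
  · intro j _ hj
    rw [Function.update_of_ne hj, sub_self]
  · simp

/-- Meant for an intermediate state, which enters the dynamics twice: as the value reached at stage
`a` and as the state preceding stage `b`. -/
lemma sum_apply_update₂ {ι β γ : Type*} [Fintype ι] [DecidableEq ι]
    (G : ι → β → γ → ℝ) (q : ι → β) (p : ι → γ) {a b : ι} (hab : a ≠ b) (x : β) (y : γ) :
    ∑ j, G j (Function.update q a x j) (Function.update p b y j) = ∑ j, G j (q j) (p j) +
      ((G a x (p a) - G a (q a) (p a)) + (G b (q b) y - G b (q b) (p b))) := by
  rw [← sub_eq_iff_eq_add', ← Finset.sum_sub_distrib, Finset.sum_eq_add a b hab]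
  · simp [Function.update_of_ne hab, Function.update_of_ne hab.symm]
  · intro j _ hj
    rw [Function.update_of_ne hj.1, Function.update_of_ne hj.2, sub_self]
  · simp
  · simp

end SumUpdate

/-! ### The decoupled problem and its stationarity conditions -/

section Decoupling

variable {m : ℕ} {E Q : Type*} {U : Fin (m + 1) → Type*}

/-- The state preceding each stage, when the states `q 0, q 1, …` follow the initial state `q₀`. -/
def precedingState (q₀ : Q) (q : Fin (m + 1) → Q) : Fin (m + 1) → Q :=
  Fin.cases q₀ fun i => q i.castSucc

@[simp] lemma precedingState_zero (q₀ : Q) (q : Fin (m + 1) → Q) : precedingState q₀ q 0 = q₀ := rfl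

@[simp] lemma precedingState_succ (q₀ : Q) (q : Fin (m + 1) → Q) (i : Fin m) :
    precedingState q₀ q i.succ = q i.castSucc := rfl

lemma precedingState_update_castSucc (q₀ : Q) (q : Fin (m + 1) → Q) (i : Fin m) (x : Q) :
    precedingState q₀ (Function.update q i.castSucc x) =
      Function.update (precedingState q₀ q) i.succ x := by
  funext j
  cases j using Fin.cases with
  | zero => rw [Function.update_of_ne (Fin.succ_ne_zero i).symm]; rfl
  | succ k =>
    by_cases h : k = i
    · subst h; simp
    · have h1 : k.castSucc ≠ i.castSucc := fun h' => h (Fin.castSucc_injective _ h')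
      have h2 : k.succ ≠ i.succ := fun h' => h (Fin.succ_injective _ h')
      rw [Function.update_of_ne h2, precedingState_succ, precedingState_succ,
        Function.update_of_ne h1]

lemma precedingState_update_last (q₀ : Q) (q : Fin (m + 1) → Q) (x : Q) :
    precedingState q₀ (Function.update q (Fin.last m) x) = precedingState q₀ q := by
  funext j
  cases j using Fin.cases with
  | zero => rfl
  | succ k => rw [precedingState_succ, precedingState_succ,
      Function.update_of_ne (Fin.castSucc_lt_last k).ne]

/-- The states `q_1, …, q_{m+1}` generated by a control sequence. -/
def trajectory (F : ∀ i, Q × U i → Q) (q₀ : Q) (u : ∀ i, U i) : Fin (m + 1) → Q :=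
  fun j => stateSeq F q₀ u j.succ

lemma trajectory_eq (F : ∀ i, Q × U i → Q) (q₀ : Q) (u : ∀ i, U i) (j : Fin (m + 1)) :
    trajectory F q₀ u j = F j (stateControl F q₀ u j) := rfl

lemma precedingState_trajectory (F : ∀ i, Q × U i → Q) (q₀ : Q) (u : ∀ i, U i) (j : Fin (m + 1)) :
    precedingState q₀ (trajectory F q₀ u) j = stateSeq F q₀ u j.castSucc := by
  cases j using Fin.cases with
  | zero => rfl
  | succ k => rfl

lemma eq_trajectory (F : ∀ i, Q × U i → Q) (q₀ : Q) (u : ∀ i, U i) (q : Fin (m + 1) → Q)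
    (h : ∀ j, q j = F j (precedingState q₀ q j, u j)) : q = trajectory F q₀ u := by
  funext j
  induction j using Fin.induction with
  | zero => rw [h, trajectory_eq]; rfl
  | succ i ih => rw [h, precedingState_succ, ih, trajectory_eq]; rfl

/-- The penalty function in terms of independent states and controls. -/
def stageCost (φ₀ : E → U 0 → ℝ) (φ : ∀ i : Fin m, E → Q × U i.succ → ℝ) (φₙ : E → Q → ℝ)
    (e : E) (v : ∀ i, U i) (q : Fin (m + 1) → Q) : ℝ :=
  φ₀ e (v 0) + φₙ e (q (Fin.last m)) + ∑ i : Fin m, φ i e (q i.castSucc, v i.succ)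

lemma stageCost_trajectory (F : ∀ i, Q × U i → Q) (q₀ : Q)
    (φ₀ : E → U 0 → ℝ) (φ : ∀ i : Fin m, E → Q × U i.succ → ℝ) (φₙ : E → Q → ℝ)
    (e : E) (u : ∀ i, U i) :
    stageCost φ₀ φ φₙ e u (trajectory F q₀ u) = penalty F q₀ φ₀ φ φₙ e u := rfl

variable {V : Type*} [NormedAddCommGroup V] [NormedSpace ℝ V] [FiniteDimensional ℝ V]
  {W : Fin (m + 1) → Type*} [∀ i, NormedAddCommGroup (W i)] [∀ i, NormedSpace ℝ (W i)]
  [∀ i, FiniteDimensional ℝ (W i)]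

/-- The squared coordinate defect of the dynamics and of the equality of both control copies. -/
def couplingCost (Ψ : Fin (m + 1) → Q → V) (Θ : ∀ i, U i → W i) (F : ∀ i, Q × U i → Q) (q₀ : Q)
    (u v : ∀ i, U i) (q : Fin (m + 1) → Q) : ℝ :=
  ∑ j, euclideanSq (Ψ j (q j) - Ψ j (F j (precedingState q₀ q j, u j))) +
    ∑ j, euclideanSq (Θ j (v j) - Θ j (u j))

/-- The squared coordinate distance between two control sequences. -/
def proximityCost (Θ : ∀ i, U i → W i) (w u : ∀ i, U i) : ℝ :=
  ∑ j, euclideanSq (Θ j (u j) - Θ j (w j))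

/-- The cost function of the decoupled problem, in which dynamics are penalized. -/
def decoupledCost (Ψ : Fin (m + 1) → Q → V) (Θ : ∀ i, U i → W i) (F : ∀ i, Q × U i → Q) (q₀ : Q)
    (φ₀ : E → U 0 → ℝ) (φ : ∀ i : Fin m, E → Q × U i.succ → ℝ) (φₙ : E → Q → ℝ)
    (e : E) (w : ∀ i, U i) (η K : ℝ) (z : (∀ i, U i) × (∀ i, U i) × (Fin (m + 1) → Q)) : ℝ :=
  stageCost φ₀ φ φₙ e z.2.1 z.2.2 + η * proximityCost Θ w z.1 +
    K * couplingCost Ψ Θ F q₀ z.1 z.2.1 z.2.2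

/-- The multiplier of the dynamics. -/
def stateMultiplier (Ψ : Fin (m + 1) → Q → V) (F : ∀ i, Q × U i → Q) (q₀ : Q) (K : ℝ)
    (u : ∀ i, U i) (q : Fin (m + 1) → Q) (j : Fin (m + 1)) : V →L[ℝ] ℝ :=
  K • fderiv ℝ euclideanSq (Ψ j (q j) - Ψ j (F j (precedingState q₀ q j, u j)))

/-- The scaled differential of the squared coordinate distance of two control sequences. -/
def controlMultiplier (Θ : ∀ i, U i → W i) (K : ℝ) (u v : ∀ i, U i) (j : Fin (m + 1)) :
    W j →L[ℝ] ℝ :=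
  K • fderiv ℝ euclideanSq (Θ j (v j) - Θ j (u j))

section Stationarity

variable [TopologicalSpace Q] [ChartedSpace V Q] [IsManifold 𝓘(ℝ, V) ∞ Q]
  [∀ i, TopologicalSpace (U i)] [∀ i, ChartedSpace (W i) (U i)]
  [∀ i, IsManifold 𝓘(ℝ, W i) ∞ (U i)]
  {Ψ : Fin (m + 1) → Q → V} {Θ : ∀ i, U i → W i} {F : ∀ i, Q × U i → Q} {q₀ : Q}
  {𝕌 : ∀ i, Set (U i)}
  {φ₀ : E → U 0 → ℝ} {φ : ∀ i : Fin m, E → Q × U i.succ → ℝ} {φₙ : E → Q → ℝ}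
  {e : E} {w u v : ∀ i, U i} {q : Fin (m + 1) → Q} {η K : ℝ}

/-- As a function of `v 0` alone the cost is `φ₀ e` plus the smooth penalty for `v 0 = u 0`, up to a
constant. The second copy of the controls is not constrained to `𝕌`, so this is an unconstrained
minimum. -/
lemma exists_initial_subgradient (hΘ : ∀ j, ContMDiff 𝓘(ℝ, W j) 𝓘(ℝ, W j) 1 (Θ j))
    (hu : u ∈ controlSet 𝕌)
    (hmin : ∀ᶠ z in 𝓝 (u, v, q), z.1 ∈ controlSet 𝕌 →
      decoupledCost Ψ Θ F q₀ φ₀ φ φₙ e w η K (u, v, q) ≤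
        decoupledCost Ψ Θ F q₀ φ₀ φ φₙ e w η K z) :
    ∃ b ∈ frechetSubdiff 𝓘(ℝ, W 0) (fun x => ((φ₀ e x : ℝ) : EReal)) (v 0), ∀ x₀,
      covectorCoord 𝓘(ℝ, W 0) x₀ (v 0) b =
        -(controlMultiplier Θ K u v 0).comp (mfderivCoord 𝓘(ℝ, W 0) (Θ 0) x₀ (v 0)) := by
  set s : U 0 → ℝ := fun x => K * euclideanSq (Θ 0 x - Θ 0 (u 0)) with hs
  refine ⟨negDifferential 𝓘(ℝ, W 0) s (v 0), mem_frechetSubdiff_of_isLocalMin (s := s)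
    (contMDiff_const_mul_euclideanSq ((hΘ 0).sub contMDiff_const) K) ?_ fun _ => rfl, fun x₀ => ?_⟩
  · have hc : ContinuousAt (fun x : U 0 => (u, Function.update v 0 x, q)) (v 0) := by fun_prop
    have hev := hc.tendsto
    simp only [Function.update_eq_self] at hev
    filter_upwards [hev.eventually hmin] with x hx
    have h1 := hx hu
    have h2 : ∀ i : Fin m, Function.update v 0 x i.succ = v i.succ := fun i =>
      Function.update_of_ne (Fin.succ_ne_zero i) _ _
    simp only [decoupledCost, stageCost, couplingCost, h2, Function.update_self] at h1
    rw [sum_apply_update (fun j y => euclideanSq (Θ j y - Θ j (u j)))] at h1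
    simp only [hs]
    linarith
  · rw [covectorCoord_negDifferential, mfderivCoord_sq_sub_const (hΘ 0)]
    rfl

lemma exists_final_subgradient (hΨ : ∀ j, ContMDiff 𝓘(ℝ, V) 𝓘(ℝ, V) 1 (Ψ j))
    (hu : u ∈ controlSet 𝕌)
    (hmin : ∀ᶠ z in 𝓝 (u, v, q), z.1 ∈ controlSet 𝕌 →
      decoupledCost Ψ Θ F q₀ φ₀ φ φₙ e w η K (u, v, q) ≤
        decoupledCost Ψ Θ F q₀ φ₀ φ φₙ e w η K z) :
    ∃ a ∈ frechetSubdiff 𝓘(ℝ, V) (fun x => ((φₙ e x : ℝ) : EReal)) (q (Fin.last m)), ∀ x₀,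
      covectorCoord 𝓘(ℝ, V) x₀ (q (Fin.last m)) a =
        -(stateMultiplier Ψ F q₀ K u q (Fin.last m)).comp
          (mfderivCoord 𝓘(ℝ, V) (Ψ (Fin.last m)) x₀ (q (Fin.last m))) := by
  set c := Ψ (Fin.last m) (F (Fin.last m) (precedingState q₀ q (Fin.last m), u (Fin.last m)))
    with hc
  set s : Q → ℝ := fun x => K * euclideanSq (Ψ (Fin.last m) x - c) with hs
  refine ⟨negDifferential 𝓘(ℝ, V) s (q (Fin.last m)), mem_frechetSubdiff_of_isLocalMin (s := s)
    (contMDiff_const_mul_euclideanSq ((hΨ _).sub contMDiff_const) K) ?_ fun _ => rfl, fun x₀ => ?_⟩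
  · have hcont : ContinuousAt (fun x : Q => (u, v, Function.update q (Fin.last m) x))
        (q (Fin.last m)) := by fun_prop
    have hev := hcont.tendsto
    simp only [Function.update_eq_self] at hev
    filter_upwards [hev.eventually hmin] with x hx
    have h1 := hx hu
    have h2 : ∀ i : Fin m, Function.update q (Fin.last m) x i.castSucc = q i.castSucc := fun i =>
      Function.update_of_ne (Fin.castSucc_lt_last i).ne _ _
    simp only [decoupledCost, stageCost, couplingCost, h2, Function.update_self,
      precedingState_update_last] at h1
    rw [sum_apply_update
      (fun j y => euclideanSq (Ψ j y - Ψ j (F j (precedingState q₀ q j, u j))))] at h1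
    simp only [hs]
    linarith
  · rw [covectorCoord_negDifferential, mfderivCoord_sq_sub_const (hΨ _)]
    rfl

/-- The pair `(q_i, v_i)` enters one nonsmooth term and three penalties: the defect of the stage
that produces `q_i`, the defect of the stage that starts from it, and the equality of the control
copies. The first two produce the costate recursion, the third the control component. -/
lemma exists_intermediate_subgradient (hΨ : ∀ j, ContMDiff 𝓘(ℝ, V) 𝓘(ℝ, V) 1 (Ψ j))
    (hΘ : ∀ j, ContMDiff 𝓘(ℝ, W j) 𝓘(ℝ, W j) 1 (Θ j))
    (hF : ∀ i, ContMDiff (𝓘(ℝ, V).prod 𝓘(ℝ, W i)) 𝓘(ℝ, V) 1 (F i))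
    (hu : u ∈ controlSet 𝕌)
    (hmin : ∀ᶠ z in 𝓝 (u, v, q), z.1 ∈ controlSet 𝕌 →
      decoupledCost Ψ Θ F q₀ φ₀ φ φₙ e w η K (u, v, q) ≤
        decoupledCost Ψ Θ F q₀ φ₀ φ φₙ e w η K z) (i : Fin m) :
    ∃ ξ ∈ frechetSubdiff (𝓘(ℝ, V).prod 𝓘(ℝ, W i.succ)) (fun x => ((φ i e x : ℝ) : EReal))
        (q i.castSucc, v i.succ), ∀ x₀ : Q × U i.succ, q i.castSucc ∈ (chartAt V x₀.1).source →
      v i.succ ∈ (chartAt (W i.succ) x₀.2).source →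
      covectorCoord (𝓘(ℝ, V).prod 𝓘(ℝ, W i.succ)) x₀ (q i.castSucc, v i.succ) ξ =
        (-(stateMultiplier Ψ F q₀ K u q i.castSucc).comp
            (mfderivCoord 𝓘(ℝ, V) (Ψ i.castSucc) x₀.1 (q i.castSucc)) +
          (stateMultiplier Ψ F q₀ K u q i.succ).comp
            (mfderivCoord 𝓘(ℝ, V) (fun x => Ψ i.succ (F i.succ (x, u i.succ))) x₀.1
              (q i.castSucc))).comp (ContinuousLinearMap.fst ℝ V (W i.succ)) -
        ((controlMultiplier Θ K u v i.succ).comp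
          (mfderivCoord 𝓘(ℝ, W i.succ) (Θ i.succ) x₀.2 (v i.succ))).comp
            (ContinuousLinearMap.snd ℝ V (W i.succ)) := by
  set c₁ := Ψ i.castSucc (F i.castSucc (precedingState q₀ q i.castSucc, u i.castSucc)) with hc₁
  set s₁ : Q → ℝ := fun x => K * euclideanSq (Ψ i.castSucc x - c₁) with hs₁
  set s₂ : Q → ℝ := fun x =>
    K * euclideanSq (Ψ i.succ (q i.succ) - Ψ i.succ (F i.succ (x, u i.succ))) with hs₂
  set s₃ : U i.succ → ℝ := fun x => K * euclideanSq (Θ i.succ x - Θ i.succ (u i.succ)) with hs₃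
  have hG : ContMDiff 𝓘(ℝ, V) 𝓘(ℝ, V) 1 (fun x => Ψ i.succ (F i.succ (x, u i.succ))) :=
    (hΨ i.succ).comp ((hF i.succ).comp (contMDiff_id.prodMk contMDiff_const))
  have h₁ : ContMDiff 𝓘(ℝ, V) 𝓘(ℝ, ℝ) 1 s₁ :=
    contMDiff_const_mul_euclideanSq ((hΨ _).sub contMDiff_const) K
  have h₂ : ContMDiff 𝓘(ℝ, V) 𝓘(ℝ, ℝ) 1 s₂ :=
    contMDiff_const_mul_euclideanSq (contMDiff_const.sub hG) K
  have h₁₂ : ContMDiff 𝓘(ℝ, V) 𝓘(ℝ, ℝ) 1 (fun x => s₁ x + s₂ x) := h₁.add h₂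
  have h₃ : ContMDiff 𝓘(ℝ, W i.succ) 𝓘(ℝ, ℝ) 1 s₃ :=
    contMDiff_const_mul_euclideanSq ((hΘ _).sub contMDiff_const) K
  have h₁₂' : ContMDiff (𝓘(ℝ, V).prod 𝓘(ℝ, W i.succ)) 𝓘(ℝ, ℝ) 1
      (fun y : Q × U i.succ => s₁ y.1 + s₂ y.1) := h₁₂.comp contMDiff_fst
  have h₃' : ContMDiff (𝓘(ℝ, V).prod 𝓘(ℝ, W i.succ)) 𝓘(ℝ, ℝ) 1
      (fun y : Q × U i.succ => s₃ y.2) := h₃.comp contMDiff_snd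
  set s : Q × U i.succ → ℝ := fun y => (s₁ y.1 + s₂ y.1) + s₃ y.2 with hs
  refine ⟨negDifferential _ s (q i.castSucc, v i.succ),
    mem_frechetSubdiff_of_isLocalMin (s := s) (h₁₂'.add h₃') ?_ fun _ => rfl,
    fun x₀ hx hy => ?_⟩
  · have hcont : ContinuousAt (fun y : Q × U i.succ =>
        (u, Function.update v i.succ y.2, Function.update q i.castSucc y.1))
        (q i.castSucc, v i.succ) := by fun_prop
    have hev := hcont.tendsto
    simp only [Function.update_eq_self] at hev
    filter_upwards [hev.eventually hmin] with y hy
    have h1 := hy hu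
    have hne : i.castSucc ≠ i.succ := (Fin.castSucc_lt_succ).ne
    have h2 : Function.update v i.succ y.2 0 = v 0 :=
      Function.update_of_ne (Fin.succ_ne_zero i).symm _ _
    have h3 : Function.update q i.castSucc y.1 (Fin.last m) = q (Fin.last m) :=
      Function.update_of_ne (Fin.castSucc_lt_last i).ne' _ _
    have h4 : ∑ k : Fin m, φ k e (Function.update q i.castSucc y.1 k.castSucc,
        Function.update v i.succ y.2 k.succ) =
        ∑ k : Fin m, φ k e (q k.castSucc, v k.succ) +
          (φ i e y - φ i e (q i.castSucc, v i.succ)) := by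
      rw [← sub_eq_iff_eq_add', ← Finset.sum_sub_distrib, Finset.sum_eq_single i]
      · simp
      · intro k _ hk
        rw [Function.update_of_ne fun h => hk (Fin.castSucc_injective _ h),
          Function.update_of_ne fun h => hk (Fin.succ_injective _ h), sub_self]
      · simp
    simp only [decoupledCost, stageCost, couplingCost, h2, h3, h4,
      precedingState_update_castSucc] at h1
    rw [sum_apply_update (fun j y => euclideanSq (Θ j y - Θ j (u j))),
      sum_apply_update₂ (fun j y p => euclideanSq (Ψ j y - Ψ j (F j (p, u j)))) _ _ hne] at h1
    simp only [hs, hs₁, hs₂, hs₃, hc₁]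
    rw [precedingState_succ] at h1
    linarith
  · rw [covectorCoord_negDifferential, hs, mfderivCoord_add h₁₂' h₃',
      mfderivCoord_comp_fst h₁₂ hx hy, mfderivCoord_comp_snd h₃ hx hy, mfderivCoord_add h₁ h₂,
      hs₁, hs₂, hs₃, mfderivCoord_sq_sub_const (hΨ _), mfderivCoord_sq_sub_const (hΘ _),
      mfderivCoord_sq_const_sub hG]
    ext x <;> simp [stateMultiplier, controlMultiplier, hc₁] <;> ring

/-- The copy `u j` does not enter the stage cost, so its only nonsmooth term is the constraint `𝕌
j`. The three smooth terms are the defect of stage `j`, the equality of copies and the proximity to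
`w`. -/
lemma exists_normal (hΨ : ∀ j, ContMDiff 𝓘(ℝ, V) 𝓘(ℝ, V) 1 (Ψ j))
    (hΘ : ∀ j, ContMDiff 𝓘(ℝ, W j) 𝓘(ℝ, W j) 1 (Θ j))
    (hF : ∀ i, ContMDiff (𝓘(ℝ, V).prod 𝓘(ℝ, W i)) 𝓘(ℝ, V) 1 (F i))
    (hu : u ∈ controlSet 𝕌)
    (hmin : ∀ᶠ z in 𝓝 (u, v, q), z.1 ∈ controlSet 𝕌 →
      decoupledCost Ψ Θ F q₀ φ₀ φ φₙ e w η K (u, v, q) ≤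
        decoupledCost Ψ Θ F q₀ φ₀ φ φₙ e w η K z) (j : Fin (m + 1)) :
    ∃ ν ∈ frechetSubdiff 𝓘(ℝ, W j) (setIndicator (𝕌 j)) (u j), ∀ x₀,
      covectorCoord 𝓘(ℝ, W j) x₀ (u j) ν =
        (stateMultiplier Ψ F q₀ K u q j).comp
          (mfderivCoord 𝓘(ℝ, W j) (fun x => Ψ j (F j (precedingState q₀ q j, x))) x₀ (u j)) +
        (controlMultiplier Θ K u v j).comp (mfderivCoord 𝓘(ℝ, W j) (Θ j) x₀ (u j)) -
        (controlMultiplier Θ η w u j).comp (mfderivCoord 𝓘(ℝ, W j) (Θ j) x₀ (u j)) := by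
  set s₁ : U j → ℝ := fun x =>
    K * euclideanSq (Ψ j (q j) - Ψ j (F j (precedingState q₀ q j, x))) with hs₁
  set s₂ : U j → ℝ := fun x => K * euclideanSq (Θ j (v j) - Θ j x) with hs₂
  set s₃ : U j → ℝ := fun x => η * euclideanSq (Θ j x - Θ j (w j)) with hs₃
  have hG : ContMDiff 𝓘(ℝ, W j) 𝓘(ℝ, V) 1 (fun x => Ψ j (F j (precedingState q₀ q j, x))) :=
    (hΨ j).comp ((hF j).comp (contMDiff_const.prodMk contMDiff_id))
  have h₁ : ContMDiff 𝓘(ℝ, W j) 𝓘(ℝ, ℝ) 1 s₁ :=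
    contMDiff_const_mul_euclideanSq (contMDiff_const.sub hG) K
  have h₂ : ContMDiff 𝓘(ℝ, W j) 𝓘(ℝ, ℝ) 1 s₂ :=
    contMDiff_const_mul_euclideanSq (contMDiff_const.sub (hΘ j)) K
  have h₁₂ : ContMDiff 𝓘(ℝ, W j) 𝓘(ℝ, ℝ) 1 (fun x => s₁ x + s₂ x) := h₁.add h₂
  have h₃ : ContMDiff 𝓘(ℝ, W j) 𝓘(ℝ, ℝ) 1 s₃ :=
    contMDiff_const_mul_euclideanSq ((hΘ j).sub contMDiff_const) η
  set s : U j → ℝ := fun x => (s₁ x + s₂ x) + s₃ x with hs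
  refine ⟨negDifferential _ s (u j),
    mem_frechetSubdiff_setIndicator (s := s) (h₁₂.add h₃) (hu j) ?_ fun _ => rfl, fun x₀ => ?_⟩
  · have hcont : ContinuousAt (fun x : U j => (Function.update u j x, v, q)) (u j) := by fun_prop
    have hev := hcont.tendsto
    simp only [Function.update_eq_self] at hev
    filter_upwards [hev.eventually hmin] with x hx hx𝕌
    have h1 := hx (by
      intro k
      by_cases hk : k = j
      · subst hk; simpa using hx𝕌
      · exact (congrArg (· ∈ 𝕌 k) (Function.update_of_ne hk x u)).mpr (hu k))
    simp only [decoupledCost, couplingCost, proximityCost] at h1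
    rw [sum_apply_update (fun k y => euclideanSq (Θ k y - Θ k (w k))),
      sum_apply_update (fun k y => euclideanSq (Θ k (v k) - Θ k y)),
      sum_apply_update
        (fun k y => euclideanSq (Ψ k (q k) - Ψ k (F k (precedingState q₀ q k, y))))] at h1
    simp only [hs, hs₁, hs₂, hs₃]
    linarith
  · rw [covectorCoord_negDifferential, hs, mfderivCoord_add h₁₂ h₃, mfderivCoord_add h₁ h₂,
      hs₁, hs₂, hs₃, mfderivCoord_sq_sub_const (hΘ j), mfderivCoord_sq_const_sub (hΘ j),
      mfderivCoord_sq_const_sub hG]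
    ext x
    simp [stateMultiplier, controlMultiplier]
    ring

end Stationarity

end Decoupling

/-! ### Consequences of `φ`-regularity -/

section RegularityConsequences

variable {V : Type*} [NormedAddCommGroup V] [NormedSpace ℝ V]
  {H : Type*} [TopologicalSpace H] {I : ModelWithCorners ℝ V H}
  {M : Type*} [TopologicalSpace M] [ChartedSpace H M] [IsManifold I 1 M]
  {E : Type*} [MetricSpace E]
  {d : M → M → ℝ≥0∞} {N : ∀ x : M, CotangentSpace I x → ℝ} {φ : E → M → ℝ} {e₀ : E} {x₀ : M}

lemma IsPhiRegularAt.exists_subseq (h : IsPhiRegularAt I d N φ e₀ x₀) {e : ℕ → E} {x : ℕ → M}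
    {p : ∀ k, CotangentSpace I (x k)} (he : Tendsto e atTop (𝓝 e₀)) (hx : Tendsto x atTop (𝓝 x₀))
    (hp : ∀ k, p k ∈ frechetSubdiff I (fun y => ((φ (e k) y : ℝ) : EReal)) (x k))
    {σ : ℕ → ℕ} (hσ : StrictMono σ) :
    ∃ τ : ℕ → ℕ, StrictMono τ ∧ ∃ p₀ ∈ limitingSubdiffReal I (φ e₀) x₀,
      Tendsto (fun k => covectorCoord I x₀ (x ((σ ∘ τ) k)) (p ((σ ∘ τ) k))) atTop
        (𝓝 (covectorCoord I x₀ x₀ p₀)) := by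
  obtain ⟨τ, p₀, hτ, hlim, hp₀⟩ := h.2 (e ∘ σ) (x ∘ σ) (fun k => p (σ k))
    (he.comp hσ.tendsto_atTop) (hx.comp hσ.tendsto_atTop)
    (fun k => frechetSubdiff_subset_limitingSubdiff _ _ (hp (σ k)))
  exact ⟨τ, hτ, p₀, hp₀, ((cotangentTendsto_iff I).1 hlim).2⟩

/-- Where `φ` is positive near the reference point, subgradients have norm at least `Δ`. Coordinates
tending to zero force the norms below `Δ`, so positivity fails from some index on. -/
lemma IsPhiRegularAt.eventually_eq_zero (h : IsPhiRegularAt I d N φ e₀ x₀)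
    (hφ : ∀ e x, 0 ≤ φ e x) (hd : Tendsto (fun x => d x x₀) (𝓝 x₀) (𝓝 0))
    (hN : ∃ C > (0 : ℝ), ∀ᶠ x in 𝓝 x₀, ∀ p : CotangentSpace I x,
      N x p ≤ C * ‖covectorCoord I x₀ x p‖)
    {e : ℕ → E} {x : ℕ → M} {p : ∀ k, CotangentSpace I (x k)}
    (he : Tendsto e atTop (𝓝 e₀)) (hx : Tendsto x atTop (𝓝 x₀))
    (hp : ∀ k, p k ∈ frechetSubdiff I (fun y => ((φ (e k) y : ℝ) : EReal)) (x k))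
    (hp0 : Tendsto (fun k => covectorCoord I x₀ (x k) (p k)) atTop (𝓝 0)) :
    ∀ᶠ k in atTop, φ (e k) (x k) = 0 := by
  obtain ⟨ε, hε, Δ, hΔ, hreg⟩ := h.1
  obtain ⟨C, hC, hN⟩ := hN
  have h1 : Tendsto (fun k => edist (e k) e₀ + d (x k) x₀) atTop (𝓝 (0 + 0)) :=
    (tendsto_iff_edist_tendsto_0.1 he).add (hd.comp hx)
  rw [add_zero] at h1
  have h2 : Tendsto (fun k => C * ‖covectorCoord I x₀ (x k) (p k)‖) atTop (𝓝 (C * 0)) :=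
    (by simpa using hp0.norm : Tendsto (fun k => ‖covectorCoord I x₀ (x k) (p k)‖) atTop
      (𝓝 0)).const_mul C
  rw [mul_zero] at h2
  filter_upwards [h1.eventually_lt_const (ENNReal.ofReal_pos.2 hε), h2.eventually_lt_const hΔ,
    hx.eventually hN] with k hk1 hk2 hk3
  by_contra hne
  have hpos : 0 < φ (e k) (x k) := lt_of_le_of_ne (hφ _ _) (Ne.symm hne)
  have := hreg (e k) (x k) hk1 hpos (p k) (frechetSubdiff_subset_limitingSubdiff _ _ (hp k))
  linarith [hk3 (p k)]

end RegularityConsequences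

section ProductRegularity

variable {V V' : Type*} [NormedAddCommGroup V] [NormedSpace ℝ V]
  [NormedAddCommGroup V'] [NormedSpace ℝ V']

lemma exists_prodCovectorNorm_le {Q U : Type*} [TopologicalSpace Q] [ChartedSpace V Q]
    [TopologicalSpace U] [ChartedSpace V' U] [IsManifold 𝓘(ℝ, V) 1 Q] [IsManifold 𝓘(ℝ, V') 1 U]
    [RiemannianBundle (fun x : Q => TangentSpace 𝓘(ℝ, V) x)]
    [IsContinuousRiemannianBundle V (fun x : Q => TangentSpace 𝓘(ℝ, V) x)]
    [RiemannianBundle (fun x : U => TangentSpace 𝓘(ℝ, V') x)]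
    [IsContinuousRiemannianBundle V' (fun x : U => TangentSpace 𝓘(ℝ, V') x)] (x₀ : Q × U) :
    ∃ C > (0 : ℝ), ∀ᶠ x in 𝓝 x₀, ∀ ξ : CotangentSpace (𝓘(ℝ, V).prod 𝓘(ℝ, V')) x,
      prodCovectorNorm x ξ ≤ C * ‖covectorCoord (𝓘(ℝ, V).prod 𝓘(ℝ, V')) x₀ x ξ‖ := by
  obtain ⟨C₁, hC₁, h₁⟩ := exists_covectorNorm_le (V := V) x₀.1
  obtain ⟨C₂, hC₂, h₂⟩ := exists_covectorNorm_le (V := V') x₀.2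
  refine ⟨C₁ + C₂, by positivity, ?_⟩
  filter_upwards [continuousAt_fst.eventually h₁, continuousAt_snd.eventually h₂,
    continuousAt_fst.eventually (chart_source_mem_nhds V x₀.1),
    continuousAt_snd.eventually (chart_source_mem_nhds V' x₀.2)] with x hx₁ hx₂ hs₁ hs₂ ξ
  set c := covectorCoord (𝓘(ℝ, V).prod 𝓘(ℝ, V')) x₀ x ξ with hc
  have e₁ : covectorCoord 𝓘(ℝ, V) x₀.1 x.1 (covectorFst x ξ) =
      c.comp (ContinuousLinearMap.inl ℝ V V') := by
    ext w; exact covectorCoord_covectorFst hs₁ hs₂ ξ w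
  have e₂ : covectorCoord 𝓘(ℝ, V') x₀.2 x.2 (covectorSnd x ξ) =
      c.comp (ContinuousLinearMap.inr ℝ V V') := by
    ext w; exact covectorCoord_covectorSnd hs₁ hs₂ ξ w
  have b₁ : covectorNorm x.1 (covectorFst x ξ) ≤ C₁ * ‖c‖ := by
    refine (hx₁ _).trans ?_
    rw [e₁]
    gcongr
    exact (ContinuousLinearMap.opNorm_comp_le _ _).trans
      (mul_le_of_le_one_right (norm_nonneg _) (ContinuousLinearMap.norm_inl_le_one ℝ V V'))
  have b₂ : covectorNorm x.2 (covectorSnd x ξ) ≤ C₂ * ‖c‖ := by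
    refine (hx₂ _).trans ?_
    rw [e₂]
    gcongr
    exact (ContinuousLinearMap.opNorm_comp_le _ _).trans
      (mul_le_of_le_one_right (norm_nonneg _) (ContinuousLinearMap.norm_inr_le_one ℝ V V'))
  have n₁ : 0 ≤ covectorNorm x.1 (covectorFst x ξ) := ContinuousLinearMap.opNorm_nonneg _
  have n₂ : 0 ≤ covectorNorm x.2 (covectorSnd x ξ) := ContinuousLinearMap.opNorm_nonneg _
  rw [prodCovectorNorm]
  refine Real.sqrt_le_iff.2 ⟨by positivity, ?_⟩
  nlinarith

lemma tendsto_edist_nhds_zero {M : Type*} [PseudoEMetricSpace M] (x₀ : M) :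
    Tendsto (fun x => edist x x₀) (𝓝 x₀) (𝓝 0) := by
  have h : ContinuousAt (fun x => edist x x₀) x₀ := by fun_prop
  simpa [ContinuousAt] using h

lemma tendsto_prodEDist_nhds_zero {Q U : Type*} [EMetricSpace Q] [EMetricSpace U] (x₀ : Q × U) :
    Tendsto (fun x => prodEDist x x₀) (𝓝 x₀) (𝓝 0) := by
  have h₁ : Tendsto (fun x : Q × U => edist x.1 x₀.1) (𝓝 x₀) (𝓝 0) :=
    (tendsto_edist_nhds_zero x₀.1).comp continuousAt_fst
  have h₂ : Tendsto (fun x : Q × U => edist x.2 x₀.2) (𝓝 x₀) (𝓝 0) :=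
    (tendsto_edist_nhds_zero x₀.2).comp continuousAt_snd
  have h := (ENNReal.continuous_rpow_const (y := (1 / 2 : ℝ))).continuousAt.tendsto.comp
    ((((ENNReal.continuous_pow 2).tendsto _).comp h₁).add
      (((ENNReal.continuous_pow 2).tendsto _).comp h₂))
  simpa [prodEDist, Function.comp_def] using h

end ProductRegularity

lemma tendsto_clm_comp {α G₁ G₂ G₃ : Type*} [NormedAddCommGroup G₁] [NormedSpace ℝ G₁]
    [NormedAddCommGroup G₂] [NormedSpace ℝ G₂] [NormedAddCommGroup G₃] [NormedSpace ℝ G₃]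
    {l : Filter α} {f : α → G₂ →L[ℝ] G₃} {g : α → G₁ →L[ℝ] G₂} {f₀ : G₂ →L[ℝ] G₃}
    {g₀ : G₁ →L[ℝ] G₂} (hf : Tendsto f l (𝓝 f₀)) (hg : Tendsto g l (𝓝 g₀)) :
    Tendsto (fun k => (f k).comp (g k)) l (𝓝 (f₀.comp g₀)) :=
  (isBoundedBilinearMap_comp.continuous.tendsto (f₀, g₀)).comp (hf.prodMk_nhds hg)

lemma nonneg_sub_of_add_neg {a b : ℝ} (h : b + -a ≤ 0) : 0 ≤ a - b := by linarith

/-! ### Passage to the limit in the multipliers -/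

section MultiplierLimit

variable {m : ℕ} {E : Type*} [MetricSpace E]
  {V : Type*} [NormedAddCommGroup V] [NormedSpace ℝ V]
  {Q : Type*} [EMetricSpace Q] [ChartedSpace V Q] [IsManifold 𝓘(ℝ, V) ∞ Q]
  [RiemannianBundle (fun x : Q => TangentSpace 𝓘(ℝ, V) x)]
  [IsContinuousRiemannianBundle V (fun x : Q => TangentSpace 𝓘(ℝ, V) x)]
  {W : Fin (m + 1) → Type*} [∀ i, NormedAddCommGroup (W i)] [∀ i, NormedSpace ℝ (W i)]
  {U : Fin (m + 1) → Type*} [∀ i, EMetricSpace (U i)] [∀ i, ChartedSpace (W i) (U i)]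
  [∀ i, IsManifold 𝓘(ℝ, W i) ∞ (U i)]
  [∀ i, RiemannianBundle (fun x : U i => TangentSpace 𝓘(ℝ, W i) x)]
  [∀ i, IsContinuousRiemannianBundle (W i) (fun x : U i => TangentSpace 𝓘(ℝ, W i) x)]

/-- Approximate multipliers along a convergent sequence, for a strictly normal limit, force the
stage costs to vanish eventually. -/
lemma exists_stageCost_eq_zero {𝕌 : ∀ i, Set (U i)} {F : ∀ i, Q × U i → Q} {q₀ : Q}
    {φ₀ : E → U 0 → ℝ} {φ : ∀ i : Fin m, E → Q × U i.succ → ℝ} {φₙ : E → Q → ℝ}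
    (hφ₀_nonneg : ∀ e x, 0 ≤ φ₀ e x) (hφ_nonneg : ∀ i e x, 0 ≤ φ i e x)
    (hφₙ_nonneg : ∀ e x, 0 ≤ φₙ e x) {e₀ : E} {u₀ : ∀ i, U i} (hu₀ : u₀ ∈ controlSet 𝕌)
    (hreg : IsPhiRegularAlong (V := V) (W := W) F q₀ φ₀ φ φₙ e₀ u₀)
    (hnormal : IsStrictlyNormal (V := V) (W := W) F q₀ 𝕌 φ₀ φ φₙ e₀ u₀)
    {e : ℕ → E} {u v : ℕ → ∀ i, U i} {q : ℕ → Fin (m + 1) → Q}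
    (he : Tendsto e atTop (𝓝 e₀)) (hu : ∀ j, Tendsto (fun k => u k j) atTop (𝓝 (u₀ j)))
    (hv : ∀ j, Tendsto (fun k => v k j) atTop (𝓝 (u₀ j)))
    (hq : ∀ j, Tendsto (fun k => q k j) atTop (𝓝 (trajectory F q₀ u₀ j)))
    (hu𝕌 : ∀ k, u k ∈ controlSet 𝕌)
    {P : ℕ → Fin (m + 1) → V →L[ℝ] ℝ} {R S : ℕ → ∀ j, W j →L[ℝ] ℝ}
    {A : ℕ → Fin m → V →L[ℝ] V} {A₀ : Fin m → V →L[ℝ] V}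
    {B : ℕ → ∀ j, W j →L[ℝ] V} {B₀ : ∀ j, W j →L[ℝ] V}
    (hS : ∀ j, Tendsto (fun k => S k j) atTop (𝓝 0))
    (hA : ∀ i, Tendsto (fun k => A k i) atTop (𝓝 (A₀ i)))
    (hB : ∀ j, Tendsto (fun k => B k j) atTop (𝓝 (B₀ j)))
    (hA₀ : ∀ (i : Fin m) (w : V),
      A₀ i w = partialFst (V := V) (F i.succ) (stateControl F q₀ u₀ i.succ) w)
    (hB₀ : ∀ (j : Fin (m + 1)) (w : W j),
      B₀ j w = partialSnd (V := V) (V' := W j) (F j) (stateControl F q₀ u₀ j) w)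
    (hb : ∀ k, ∃ b ∈ frechetSubdiff 𝓘(ℝ, W 0) (fun x => ((φ₀ (e k) x : ℝ) : EReal)) (v k 0),
      covectorCoord 𝓘(ℝ, W 0) (u₀ 0) (v k 0) b = -R k 0)
    (ha : ∀ k, ∃ a ∈ frechetSubdiff 𝓘(ℝ, V) (fun x => ((φₙ (e k) x : ℝ) : EReal))
        (q k (Fin.last m)),
      covectorCoord 𝓘(ℝ, V) (finalState F q₀ u₀) (q k (Fin.last m)) a = -P k (Fin.last m))
    (hξ : ∀ (k : ℕ) (i : Fin m), ∃ ξ ∈ frechetSubdiff (𝓘(ℝ, V).prod 𝓘(ℝ, W i.succ))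
        (fun x => ((φ i (e k) x : ℝ) : EReal)) (q k i.castSucc, v k i.succ),
      covectorCoord (𝓘(ℝ, V).prod 𝓘(ℝ, W i.succ)) (stateControl F q₀ u₀ i.succ)
          (q k i.castSucc, v k i.succ) ξ =
        (-P k i.castSucc + (P k i.succ).comp (A k i)).comp
          (ContinuousLinearMap.fst ℝ V (W i.succ)) -
        (R k i.succ).comp (ContinuousLinearMap.snd ℝ V (W i.succ)))
    (hν : ∀ (k : ℕ) (j : Fin (m + 1)), ∃ ν ∈ frechetSubdiff 𝓘(ℝ, W j) (setIndicator (𝕌 j)) (u k j),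
      covectorCoord 𝓘(ℝ, W j) (u₀ j) (u k j) ν = (P k j).comp (B k j) + R k j - S k j) :
    ∃ k, stageCost φ₀ φ φₙ (e k) (v k) (q k) = 0 := by
  choose b hb hbc using hb
  choose a ha hac using ha
  choose ξ hξ hξc using hξ
  choose ν hν hνc using hν
  obtain ⟨hreg₀, hreg, hregₙ⟩ := hreg
  have hx : ∀ i : Fin m, Tendsto (fun k => (q k i.castSucc, v k i.succ)) atTop
      (𝓝 (stateControl F q₀ u₀ i.succ)) := fun i => (hq i.castSucc).prodMk_nhds (hv i.succ)
  -- a common subsequence along which all subgradients converge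
  obtain ⟨σ₁, hσ₁, hlim₁⟩ := exists_common_subseq (ι := Fin m)
    (fun i σ => ∃ p₀ ∈ limitingSubdiffReal (𝓘(ℝ, V).prod 𝓘(ℝ, W i.succ)) (φ i e₀)
        (stateControl F q₀ u₀ i.succ),
      Tendsto (fun k => covectorCoord (𝓘(ℝ, V).prod 𝓘(ℝ, W i.succ)) (stateControl F q₀ u₀ i.succ)
        (q (σ k) i.castSucc, v (σ k) i.succ) (ξ (σ k) i)) atTop
        (𝓝 (covectorCoord (𝓘(ℝ, V).prod 𝓘(ℝ, W i.succ)) (stateControl F q₀ u₀ i.succ) _ p₀)))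
    (fun i σ τ hτ ⟨p₀, hp₀, h⟩ => ⟨p₀, hp₀, h.comp hτ.tendsto_atTop⟩)
    (fun i σ hσ => (hreg i).exists_subseq he (hx i) (fun k => hξ k i) hσ)
  obtain ⟨τ₂, hτ₂, b₀, hb₀, hlim_b⟩ := hreg₀.exists_subseq he (hv 0) hb hσ₁
  obtain ⟨τ₃, hτ₃, a₀, ha₀, hlim_a⟩ :=
    hregₙ.exists_subseq he (hq (Fin.last m)) ha (hσ₁.comp hτ₂)
  set σ : ℕ → ℕ := (σ₁ ∘ τ₂) ∘ τ₃ with hσ_def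
  have hσ : Tendsto σ atTop atTop := ((hσ₁.comp hτ₂).comp hτ₃).tendsto_atTop
  choose ξ₀ hξ₀ hlim_ξ using hlim₁
  replace hlim_ξ := fun i => (hlim_ξ i).comp (hτ₂.comp hτ₃).tendsto_atTop
  replace hlim_b := hlim_b.comp hτ₃.tendsto_atTop
  set c₀ := fun i : Fin m => covectorCoord (𝓘(ℝ, V).prod 𝓘(ℝ, W i.succ))
    (stateControl F q₀ u₀ i.succ) _ (ξ₀ i) with hc₀
  -- convergence of the multipliers
  have hRsucc : ∀ i : Fin m, Tendsto (fun k => R (σ k) i.succ) atTop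
      (𝓝 (-(c₀ i).comp (ContinuousLinearMap.inr ℝ V (W i.succ)))) := by
    intro i
    have h1 := (tendsto_clm_comp (hlim_ξ i)
      (tendsto_const_nhds (x := ContinuousLinearMap.inr ℝ V (W i.succ)))).neg
    refine h1.congr fun k => ?_
    simp only [Function.comp_apply]
    rw [hξc]
    ext w
    simp [σ]
  have hR0 : Tendsto (fun k => R (σ k) 0) atTop
      (𝓝 (-covectorCoord 𝓘(ℝ, W 0) (u₀ 0) (u₀ 0) b₀)) := by
    refine hlim_b.neg.congr fun k => ?_
    simp only [Function.comp_apply]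
    rw [hbc]
    simp [σ]
  have hPlast : Tendsto (fun k => P (σ k) (Fin.last m)) atTop
      (𝓝 (-covectorCoord 𝓘(ℝ, V) (finalState F q₀ u₀) (finalState F q₀ u₀) a₀)) := by
    refine hlim_a.neg.congr fun k => ?_
    rw [hac]
    simp [σ]
  have hPstep : ∀ (i : Fin m) (L : V →L[ℝ] ℝ),
      Tendsto (fun k => P (σ k) i.succ) atTop (𝓝 L) →
      Tendsto (fun k => P (σ k) i.castSucc) atTop
        (𝓝 (-(c₀ i).comp (ContinuousLinearMap.inl ℝ V (W i.succ)) + L.comp (A₀ i))) := by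
    intro i L hL
    have h1 := (tendsto_clm_comp (hlim_ξ i)
      (tendsto_const_nhds (x := ContinuousLinearMap.inl ℝ V (W i.succ)))).neg
    refine (h1.add (tendsto_clm_comp hL ((hA i).comp hσ))).congr fun k => ?_
    simp only [Function.comp_apply]
    rw [hξc]
    ext w
    simp [σ]
  -- Backward induction on the stage: the last costate is minus a convergent subgradient, and each
  -- earlier one is determined by the next through the recursion. Hence no bound on the penalization
  -- parameter is required.
  have hPconv : ∀ j, ∃ L : V →L[ℝ] ℝ, Tendsto (fun k => P (σ k) j) atTop (𝓝 L) := by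
    intro j
    induction j using Fin.reverseInduction with
    | last => exact ⟨_, hPlast⟩
    | cast i ih =>
      obtain ⟨L, hL⟩ := ih
      exact ⟨_, hPstep i L hL⟩
  choose P₀ hP₀ using hPconv
  have hRconv : ∀ j, ∃ L : W j →L[ℝ] ℝ, Tendsto (fun k => R (σ k) j) atTop (𝓝 L) := by
    intro j
    cases j using Fin.cases with
    | zero => exact ⟨_, hR0⟩
    | succ i => exact ⟨_, hRsucc i⟩
  choose R₀ hR₀ using hRconv
  have hPlast_eq := tendsto_nhds_unique (hP₀ (Fin.last m)) hPlast
  have hPstep_eq := fun i => tendsto_nhds_unique (hP₀ i.castSucc) (hPstep i _ (hP₀ i.succ))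
  have hR0_eq := tendsto_nhds_unique (hR₀ 0) hR0
  have hRsucc_eq := fun i => tendsto_nhds_unique (hR₀ i.succ) (hRsucc i)
  -- the limiting normals
  have hν₀ : ∀ j, ∀ w ∈ clarkeTangentCone 𝓘(ℝ, W j) (𝕌 j) (u₀ j),
      P₀ j (B₀ j w) + R₀ j w ≤ 0 := by
    intro j w hw
    -- The proximity contribution `S` vanishes in the limit, so the Fréchet normals converge to a
    -- limiting normal. Clarke tangent vectors are by definition polar to such normals, which yields
    -- the inequality.
    have h1 : Tendsto (fun k => covectorCoord 𝓘(ℝ, W j) (u₀ j) (u (σ k) j) (ν (σ k) j)) atTop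
        (𝓝 ((P₀ j).comp (B₀ j) + R₀ j - 0)) := by
      refine (((tendsto_clm_comp (hP₀ j) ((hB j).comp hσ)).add (hR₀ j)).sub ((hS j).comp hσ)).congr
        fun k => ?_
      rw [hνc]
      rfl
    rw [sub_zero] at h1
    let ν₀ : CotangentSpace 𝓘(ℝ, W j) (u₀ j) := (P₀ j).comp (B₀ j) + R₀ j
    have h2 : covectorCoord 𝓘(ℝ, W j) (u₀ j) (u₀ j) ν₀ = (P₀ j).comp (B₀ j) + R₀ j := by
      ext w
      exact covectorCoord_self _ _ _ _
    have h3 : ν₀ ∈ limitingNormalCone 𝓘(ℝ, W j) (𝕌 j) (u₀ j) := by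
      refine mem_limitingNormalCone_of_tendsto (x := fun k => u (σ k) j)
        (p := fun k => ν (σ k) j) (fun k => hu𝕌 (σ k) j) (hu₀ j) (fun k => hν (σ k) j) ?_
      rw [cotangentTendsto_iff, h2]
      exact ⟨(hu j).comp hσ, h1⟩
    exact hw ν₀ h3
  -- strict normality
  obtain ⟨hb₀0, hξ₀0, ha₀0⟩ := hnormal b₀ ξ₀ a₀ P₀ hb₀ hξ₀ ha₀
    (by
      intro w
      rw [hPlast_eq]
      exact congrArg Neg.neg (covectorCoord_self 𝓘(ℝ, V) (finalState F q₀ u₀) a₀ w))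
    (by
      intro i w
      rw [hPstep_eq]
      have h1 := covectorFst_apply (stateControl F q₀ u₀ i.succ) (ξ₀ i) w
      have h2 := covectorCoord_self (𝓘(ℝ, V).prod 𝓘(ℝ, W i.succ))
        (stateControl F q₀ u₀ i.succ) (ξ₀ i) (w, 0)
      exact congrArg₂ (· + ·) (congrArg Neg.neg (h2.trans h1.symm))
        (congrArg (P₀ i.succ) (hA₀ i w)))
    (by
      intro w hw
      have h1 := hν₀ 0 w hw
      rw [hR0_eq] at h1
      have h2 := covectorCoord_self 𝓘(ℝ, W 0) (u₀ 0) b₀ w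
      have h3 := congrArg (P₀ 0) (hB₀ 0 w)
      have h4 : P₀ 0 (B₀ 0 w) + -(covectorCoord 𝓘(ℝ, W 0) (u₀ 0) (u₀ 0) b₀ w) ≤ 0 := h1
      rw [h2, h3] at h4
      exact nonneg_sub_of_add_neg h4)
    (by
      intro i w hw
      have h1 := hν₀ i.succ w hw
      rw [hRsucc_eq] at h1
      have h2 := (covectorCoord_self (𝓘(ℝ, V).prod 𝓘(ℝ, W i.succ))
        (stateControl F q₀ u₀ i.succ) (ξ₀ i) (0, w)).trans
        (covectorSnd_apply (stateControl F q₀ u₀ i.succ) (ξ₀ i) w).symm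
      have h3 := congrArg (P₀ i.succ) (hB₀ i.succ w)
      have h4 : P₀ i.succ (B₀ i.succ w) + -(c₀ i (0, w)) ≤ 0 := h1
      rw [hc₀] at h4
      simp only [h2, h3] at h4
      exact nonneg_sub_of_add_neg h4)
  -- all the constraints are eventually satisfied
  have hz₀ : ∀ᶠ k in atTop, φ₀ (e (σ k)) (v (σ k) 0) = 0 := by
    refine hreg₀.eventually_eq_zero hφ₀_nonneg (tendsto_edist_nhds_zero _)
      (exists_covectorNorm_le _) (e := e ∘ σ) (x := fun k => v (σ k) 0) (p := fun k => b (σ k))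
      (he.comp hσ) ((hv 0).comp hσ) (fun k => hb (σ k)) ?_
    have : covectorCoord 𝓘(ℝ, W 0) (u₀ 0) (u₀ 0) b₀ = 0 := by rw [hb₀0]; rfl
    rw [this] at hlim_b
    exact hlim_b
  have hzₙ : ∀ᶠ k in atTop, φₙ (e (σ k)) (q (σ k) (Fin.last m)) = 0 := by
    refine hregₙ.eventually_eq_zero hφₙ_nonneg (tendsto_edist_nhds_zero _)
      (exists_covectorNorm_le _) (e := e ∘ σ) (x := fun k => q (σ k) (Fin.last m))
      (p := fun k => a (σ k)) (he.comp hσ) ((hq _).comp hσ) (fun k => ha (σ k)) ?_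
    have : covectorCoord 𝓘(ℝ, V) (finalState F q₀ u₀) (finalState F q₀ u₀) a₀ = 0 := by
      rw [ha₀0]; rfl
    rw [this] at hlim_a
    exact hlim_a
  have hz : ∀ᶠ k in atTop, ∀ i : Fin m,
      φ i (e (σ k)) (q (σ k) i.castSucc, v (σ k) i.succ) = 0 := by
    rw [eventually_all]
    intro i
    refine (hreg i).eventually_eq_zero (hφ_nonneg i) (tendsto_prodEDist_nhds_zero _)
      (exists_prodCovectorNorm_le _) (e := e ∘ σ)
      (x := fun k => (q (σ k) i.castSucc, v (σ k) i.succ))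
      (p := fun k => ξ (σ k) i) (he.comp hσ) ((hx i).comp hσ) (fun k => hξ (σ k) i) ?_
    have : c₀ i = 0 := by simp only [hc₀]; rw [hξ₀0 i]; rfl
    have h1 : Tendsto _ atTop (𝓝 (c₀ i)) := hlim_ξ i
    rw [this] at h1
    exact h1
  obtain ⟨k, hk₀, hkₙ, hk⟩ := (hz₀.and (hzₙ.and hz)).exists
  exact ⟨σ k, by simp [stageCost, hk₀, hkₙ, hk]⟩

end MultiplierLimit

/-! ### Neighbourhoods measured by the squared coordinate distance -/

section Neighborhoods

variable {m : ℕ} {E Q : Type*} {U : Fin (m + 1) → Type*}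

lemma euclideanSq_add_le {V : Type*} [NormedAddCommGroup V] [NormedSpace ℝ V]
    [FiniteDimensional ℝ V] (v w : V) :
    euclideanSq (v + w) ≤ 2 * euclideanSq v + 2 * euclideanSq w := by
  simp only [euclideanSq, map_add]
  have h := norm_add_le (toEuclidean v) (toEuclidean w)
  have h' := norm_nonneg (toEuclidean v + toEuclidean w)
  nlinarith [sq_nonneg (‖toEuclidean v‖ - ‖toEuclidean w‖)]

lemma piEDist_self [∀ i, EMetricSpace (U i)] (u : ∀ i, U i) : piEDist u u = 0 := by
  simp [piEDist]

lemma edist_le_piEDist [∀ i, EMetricSpace (U i)] (u w : ∀ i, U i) (j : Fin (m + 1)) :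
    edist (u j) (w j) ≤ piEDist u w := by
  have h : edist (u j) (w j) ^ 2 ≤ ∑ i, edist (u i) (w i) ^ 2 :=
    Finset.single_le_sum (f := fun i => edist (u i) (w i) ^ 2) (fun _ _ => zero_le) (Finset.mem_univ j)
  calc edist (u j) (w j) = (edist (u j) (w j) ^ 2) ^ (1 / 2 : ℝ) := by
        rw [← ENNReal.rpow_natCast, ← ENNReal.rpow_mul]; norm_num
    _ ≤ _ := ENNReal.rpow_le_rpow h (by norm_num)

lemma exists_pos_of_mem_nhds [MetricSpace E] [∀ i, EMetricSpace (U i)] {e₀ : E} {u₀ : ∀ i, U i}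
    {N : Set (E × ∀ i, U i)} (hN : N ∈ 𝓝 (e₀, u₀)) :
    ∃ ε > (0 : ℝ), ∀ e u, edist e e₀ + piEDist u u₀ < ENNReal.ofReal ε → (e, u) ∈ N := by
  obtain ⟨ρ, hρ, h⟩ := EMetric.mem_nhds_iff.1 hN
  obtain ⟨ε, hε0, hε⟩ := ENNReal.lt_iff_exists_real_btwn.1 hρ
  refine ⟨ε, ENNReal.ofReal_pos.1 hε.1, fun e u heu => h ?_⟩
  rw [Metric.mem_eball, Prod.edist_eq, max_lt_iff]
  refine ⟨(le_self_add.trans_lt heu).trans hε.2, ?_⟩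
  refine lt_of_le_of_lt ?_ ((le_add_self.trans_lt heu).trans hε.2)
  exact edist_pi_le_iff.2 fun j => edist_le_piEDist u u₀ j

lemma mem_feasibleSet_of_penalty_eq_zero {F : ∀ i, Q × U i → Q} {q₀ : Q} {𝕌 : ∀ i, Set (U i)}
    {φ₀ : E → U 0 → ℝ} {φ : ∀ i : Fin m, E → Q × U i.succ → ℝ} {φₙ : E → Q → ℝ}
    (hφ₀_nonneg : ∀ e x, 0 ≤ φ₀ e x) (hφ_nonneg : ∀ i e x, 0 ≤ φ i e x)
    (hφₙ_nonneg : ∀ e x, 0 ≤ φₙ e x) {e : E} {u : ∀ i, U i} (hu : u ∈ controlSet 𝕌)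
    (h : penalty F q₀ φ₀ φ φₙ e u = 0) : u ∈ feasibleSet F q₀ 𝕌 φ₀ φ φₙ e := by
  have hs : ∀ i ∈ (Finset.univ : Finset (Fin m)), 0 ≤ φ i e (stateControl F q₀ u i.succ) :=
    fun i _ => hφ_nonneg _ _ _
  have h1 := Finset.sum_nonneg hs
  have h2 := hφ₀_nonneg e (u 0)
  have h3 := hφₙ_nonneg e (finalState F q₀ u)
  unfold penalty at h
  have h4 : ∑ i : Fin m, φ i e (stateControl F q₀ u i.succ) = 0 := by linarith
  refine ⟨hu, ?_, fun i => ?_, ?_⟩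
  · change φ₀ e (u 0) = 0; linarith
  · exact (Finset.sum_eq_zero_iff_of_nonneg hs).1 h4 i (Finset.mem_univ i)
  · change φₙ e (finalState F q₀ u) = 0; linarith

lemma stageCost_nonneg {φ₀ : E → U 0 → ℝ} {φ : ∀ i : Fin m, E → Q × U i.succ → ℝ} {φₙ : E → Q → ℝ}
    (hφ₀_nonneg : ∀ e x, 0 ≤ φ₀ e x) (hφ_nonneg : ∀ i e x, 0 ≤ φ i e x)
    (hφₙ_nonneg : ∀ e x, 0 ≤ φₙ e x) (e : E) (v : ∀ i, U i) (q : Fin (m + 1) → Q) :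
    0 ≤ stageCost φ₀ φ φₙ e v q :=
  add_nonneg (add_nonneg (hφ₀_nonneg _ _) (hφₙ_nonneg _ _))
    (Finset.sum_nonneg fun _ _ => hφ_nonneg _ _ _)

variable {W : Fin (m + 1) → Type*} [∀ i, NormedAddCommGroup (W i)] [∀ i, NormedSpace ℝ (W i)]
  [∀ i, FiniteDimensional ℝ (W i)]

lemma euclideanSq_le_proximityCost (Θ : ∀ i, U i → W i) (w u : ∀ i, U i) (j : Fin (m + 1)) :
    euclideanSq (Θ j (u j) - Θ j (w j)) ≤ proximityCost Θ w u :=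
  Finset.single_le_sum (f := fun j => euclideanSq (Θ j (u j) - Θ j (w j)))
    (fun _ _ => euclideanSq_nonneg _) (Finset.mem_univ j)

lemma proximityCost_nonneg (Θ : ∀ i, U i → W i) (w u : ∀ i, U i) : 0 ≤ proximityCost Θ w u :=
  Finset.sum_nonneg fun _ _ => euclideanSq_nonneg _

lemma proximityCost_self (Θ : ∀ i, U i → W i) (u : ∀ i, U i) : proximityCost Θ u u = 0 := by
  simp [proximityCost]

lemma proximityCost_triangle (Θ : ∀ i, U i → W i) (a w u : ∀ i, U i) :
    proximityCost Θ a u ≤ 2 * proximityCost Θ w u + 2 * proximityCost Θ a w := by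
  simp only [proximityCost, Finset.mul_sum]
  rw [← Finset.sum_add_distrib]
  refine Finset.sum_le_sum fun j _ => ?_
  have := euclideanSq_add_le (Θ j (u j) - Θ j (w j)) (Θ j (w j) - Θ j (a j))
  rwa [sub_add_sub_cancel] at this

lemma continuous_proximityCost [∀ i, TopologicalSpace (U i)] {Θ : ∀ i, U i → W i}
    (hΘ : ∀ j, Continuous (Θ j)) (w : ∀ i, U i) : Continuous (proximityCost Θ w) := by
  refine continuous_finsetSum _ fun j _ => ?_
  exact contDiff_euclideanSq.continuous.comp
    (((hΘ j).comp (continuous_apply j)).sub continuous_const)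

/-- Near `u₀`, control sequences with close coordinates are close. -/
lemma exists_mem_of_proximityCost_lt [∀ i, TopologicalSpace (U i)] [∀ i, ChartedSpace (W i) (U i)]
    {Θ : ∀ i, U i → W i} {u₀ : ∀ i, U i} {G : Set (∀ i, U i)} (hG : G ∈ 𝓝 u₀) :
    ∃ r > (0 : ℝ), ∀ u : ∀ i, U i, (∀ j, Θ j (u j) = extChartAt 𝓘(ℝ, W j) (u₀ j) (u j)) →
      (∀ j, u j ∈ (extChartAt 𝓘(ℝ, W j) (u₀ j)).source) →
      (∀ j, Θ j (u₀ j) = extChartAt 𝓘(ℝ, W j) (u₀ j) (u₀ j)) →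
      proximityCost Θ u₀ u < r → u ∈ G := by
  set A : Set (∀ i, U i) := {u | (∀ j, Θ j (u j) = extChartAt 𝓘(ℝ, W j) (u₀ j) (u j)) ∧
      (∀ j, u j ∈ (extChartAt 𝓘(ℝ, W j) (u₀ j)).source) ∧
      (∀ j, Θ j (u₀ j) = extChartAt 𝓘(ℝ, W j) (u₀ j) (u₀ j))} with hA
  set L : Filter (∀ i, U i) := comap (proximityCost Θ u₀) (𝓝 0) ⊓ 𝓟 A with hL
  have hle : Tendsto (fun u : ∀ i, U i => u) L (𝓝 u₀) := by
    rw [tendsto_pi_nhds]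
    intro j
    obtain ⟨c, hc, hcN⟩ := exists_norm_sq_le_euclideanSq (W j)
    have h0 : Tendsto (proximityCost Θ u₀) L (𝓝 0) := tendsto_comap.mono_left inf_le_left
    have h1 : Tendsto (fun u : ∀ i, U i => ‖Θ j (u j) - Θ j (u₀ j)‖ ^ 2) L (𝓝 0) := by
      refine squeeze_zero (fun _ => by positivity) (fun u => (hcN _).trans
        (mul_le_mul_of_nonneg_left (euclideanSq_le_proximityCost Θ u₀ u j) hc.le)) ?_
      simpa using h0.const_mul c
    have h2 : Tendsto (fun u : ∀ i, U i => Θ j (u j)) L (𝓝 (Θ j (u₀ j))) := by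
      rw [tendsto_iff_norm_sub_tendsto_zero]
      have := h1.sqrt
      simpa [Real.sqrt_sq] using this
    have hAL : ∀ᶠ u in L, u ∈ A := mem_inf_of_right (mem_principal_self A)
    -- The identity of `Θ` with the chart at `u₀` is part of membership in `A`. It is extracted from
    -- one element of `A`, which requires `L` to be nontrivial; otherwise there is nothing to prove.
    by_cases hne : L.NeBot
    · obtain ⟨u', hu'⟩ := hAL.exists
      rw [hu'.2.2 j] at h2
      have h3 := (continuousAt_extChartAt_symm (I := 𝓘(ℝ, W j)) (u₀ j)).tendsto.comp h2
      rw [extChartAt_to_inv] at h3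
      refine h3.congr' ?_
      filter_upwards [hAL] with u hu
      simp only [Function.comp_apply]
      rw [hu.1 j]
      exact (extChartAt 𝓘(ℝ, W j) (u₀ j)).left_inv (hu.2.1 j)
    · rw [not_neBot.1 hne]; exact tendsto_bot
  have hGL : G ∈ L := hle hG
  rw [hL, mem_inf_principal, mem_comap] at hGL
  obtain ⟨t, ht, htG⟩ := hGL
  obtain ⟨r, hr, hrt⟩ := Metric.mem_nhds_iff.1 ht
  refine ⟨r, hr, fun u h1 h2 h3 h4 => htG (a := u) ?_ ⟨h1, h2, h3⟩⟩
  refine hrt ?_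
  rw [Metric.mem_ball, dist_zero_right, Real.norm_of_nonneg (proximityCost_nonneg _ _ _)]
  exact h4

/-- Each component is compared with its coordinates by `exists_edist_le_edist_extChartAt`. The sum
of the resulting constants is admissible because a sum of squares is at most the square of the sum.
-/
lemma exists_piEDist_le [∀ i, EMetricSpace (U i)] [∀ i, ChartedSpace (W i) (U i)]
    [∀ i, IsManifold 𝓘(ℝ, W i) ∞ (U i)]
    [∀ i, RiemannianBundle (fun x : U i => TangentSpace 𝓘(ℝ, W i) x)]
    [∀ i, IsContinuousRiemannianBundle (W i) (fun x : U i => TangentSpace 𝓘(ℝ, W i) x)]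
    [∀ i, IsRiemannianManifold 𝓘(ℝ, W i) (U i)]
    {Θ : ∀ i, U i → W i} {u₀ : ∀ i, U i}
    (hΘ : ∀ j, Θ j =ᶠ[𝓝 (u₀ j)] extChartAt 𝓘(ℝ, W j) (u₀ j)) :
    ∃ D > (0 : ℝ), ∃ A ∈ 𝓝 u₀, ∀ w ∈ A, ∀ u ∈ A,
      piEDist w u ≤ ENNReal.ofReal (D * Real.sqrt (proximityCost Θ w u)) := by
  choose C hC A hA hCA using fun j => exists_edist_le_edist_extChartAt (V := W j) (u₀ j)
  choose c hc hcN using fun j => exists_norm_sq_le_euclideanSq (W j)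
  have hD : ∀ j, 0 < C j * Real.sqrt (c j) := fun j =>
    mul_pos (hC j) (Real.sqrt_pos.2 (hc j))
  refine ⟨∑ j, C j * Real.sqrt (c j), Finset.sum_pos (fun j _ => hD j) Finset.univ_nonempty,
    Set.pi univ fun j => A j ∩ {x | Θ j x = extChartAt 𝓘(ℝ, W j) (u₀ j) x},
    set_pi_mem_nhds finite_univ fun j _ => inter_mem (hA j) (hΘ j), ?_⟩
  intro w hw u hu
  set s := Real.sqrt (proximityCost Θ w u) with hs
  have hs0 : 0 ≤ s := Real.sqrt_nonneg _
  have h1 : ∀ j, edist (w j) (u j) ≤ ENNReal.ofReal (C j * Real.sqrt (c j) * s) := by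
    intro j
    refine (hCA j _ (hw j trivial).1 _ (hu j trivial).1).trans (ENNReal.ofReal_le_ofReal ?_)
    have e1 : Θ j (w j) = _ := (hw j trivial).2
    have e2 : Θ j (u j) = _ := (hu j trivial).2
    rw [← e1, ← e2, mul_assoc]
    refine mul_le_mul_of_nonneg_left ?_ (hC j).le
    rw [hs, ← Real.sqrt_mul (hc j).le]
    refine Real.le_sqrt_of_sq_le ((hcN j _).trans ?_)
    exact mul_le_mul_of_nonneg_left (euclideanSq_le_proximityCost Θ w u j) (hc j).le
  have h2 : ∑ j, edist (w j) (u j) ^ 2 ≤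
      ENNReal.ofReal ((∑ j, C j * Real.sqrt (c j)) * s) ^ 2 := by
    calc ∑ j, edist (w j) (u j) ^ 2
        ≤ ∑ j, ENNReal.ofReal ((C j * Real.sqrt (c j) * s) ^ 2) := by
          refine Finset.sum_le_sum fun j _ => ?_
          rw [ENNReal.ofReal_pow (mul_nonneg (hD j).le hs0)]
          exact pow_le_pow_left' (h1 j) 2
      _ = ENNReal.ofReal (∑ j, (C j * Real.sqrt (c j) * s) ^ 2) :=
          (ENNReal.ofReal_sum_of_nonneg fun _ _ => by positivity).symm
      _ ≤ ENNReal.ofReal (((∑ j, C j * Real.sqrt (c j)) * s) ^ 2) := by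
          refine ENNReal.ofReal_le_ofReal ?_
          rw [Finset.sum_mul]
          exact Finset.sum_sq_le_sq_sum_of_nonneg fun j _ => mul_nonneg (hD j).le hs0
      _ = _ := ENNReal.ofReal_pow
          (mul_nonneg (Finset.sum_nonneg fun j _ => (hD j).le) hs0) 2
  calc piEDist w u ≤ (ENNReal.ofReal ((∑ j, C j * Real.sqrt (c j)) * s) ^ 2) ^ (1 / 2 : ℝ) :=
        ENNReal.rpow_le_rpow h2 (by norm_num)
    _ = _ := by rw [← ENNReal.rpow_natCast, ← ENNReal.rpow_mul]; norm_num

end Neighborhoods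

/-! ### Existence of decoupled minimizers -/

section Construction

variable {m : ℕ} {E Q : Type*} {U : Fin (m + 1) → Type*}

lemma LocallyLipschitzUniformly.continuous [TopologicalSpace E] {M : Type*} [PseudoEMetricSpace M]
    {φ : E → M → ℝ} (hφ : LocallyLipschitzUniformly φ) (e : E) : Continuous (φ e) := by
  refine continuous_iff_continuousAt.2 fun x => ?_
  obtain ⟨K, N, hN, A, hA, h⟩ := hφ e x
  exact (h e (mem_of_mem_nhds hN)).continuousOn.continuousAt hA

lemma continuous_trajectory [TopologicalSpace Q] [∀ i, TopologicalSpace (U i)]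
    {F : ∀ i, Q × U i → Q} (hF : ∀ i, Continuous (F i)) (q₀ : Q) :
    Continuous (trajectory F q₀) := by
  refine continuous_pi fun j => ?_
  induction j using Fin.induction with
  | zero => exact (hF 0).comp (continuous_const.prodMk (continuous_apply 0))
  | succ i ih => exact (hF i.succ).comp (ih.prodMk (continuous_apply i.succ))

lemma continuous_precedingState [TopologicalSpace Q] (q₀ : Q) (j : Fin (m + 1)) :
    Continuous fun q : Fin (m + 1) → Q => precedingState q₀ q j := by
  cases j using Fin.cases with
  | zero => exact continuous_const
  | succ i => exact continuous_apply i.castSucc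

lemma continuous_stageCost [TopologicalSpace E] [PseudoEMetricSpace Q]
    [∀ i, PseudoEMetricSpace (U i)]
    {φ₀ : E → U 0 → ℝ} {φ : ∀ i : Fin m, E → Q × U i.succ → ℝ} {φₙ : E → Q → ℝ}
    (hφ₀ : LocallyLipschitzUniformly φ₀) (hφ : ∀ i, LocallyLipschitzUniformly (φ i))
    (hφₙ : LocallyLipschitzUniformly φₙ) (e : E) :
    Continuous fun z : (∀ i, U i) × (Fin (m + 1) → Q) => stageCost φ₀ φ φₙ e z.1 z.2 := by
  have h₀ := hφ₀.continuous e
  have hₙ := hφₙ.continuous e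
  have h := fun i => (hφ i).continuous e
  unfold stageCost
  fun_prop

variable {V : Type*} [NormedAddCommGroup V] [NormedSpace ℝ V] [FiniteDimensional ℝ V]
  {W : Fin (m + 1) → Type*} [∀ i, NormedAddCommGroup (W i)] [∀ i, NormedSpace ℝ (W i)]
  [∀ i, FiniteDimensional ℝ (W i)]

lemma couplingCost_nonneg (Ψ : Fin (m + 1) → Q → V) (Θ : ∀ i, U i → W i) (F : ∀ i, Q × U i → Q)
    (q₀ : Q) (u v : ∀ i, U i) (q : Fin (m + 1) → Q) : 0 ≤ couplingCost Ψ Θ F q₀ u v q :=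
  add_nonneg (Finset.sum_nonneg fun _ _ => euclideanSq_nonneg _)
    (Finset.sum_nonneg fun _ _ => euclideanSq_nonneg _)

lemma couplingCost_trajectory (Ψ : Fin (m + 1) → Q → V) (Θ : ∀ i, U i → W i)
    (F : ∀ i, Q × U i → Q) (q₀ : Q) (u : ∀ i, U i) :
    couplingCost Ψ Θ F q₀ u u (trajectory F q₀ u) = 0 := by
  simp [couplingCost, precedingState_trajectory, trajectory_eq, stateControl]

lemma continuous_couplingCost [TopologicalSpace Q] [∀ i, TopologicalSpace (U i)]
    {Ψ : Fin (m + 1) → Q → V} {Θ : ∀ i, U i → W i} {F : ∀ i, Q × U i → Q} {q₀ : Q}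
    (hΨ : ∀ j, Continuous (Ψ j)) (hΘ : ∀ j, Continuous (Θ j)) (hF : ∀ i, Continuous (F i)) :
    Continuous fun z : (∀ i, U i) × (∀ i, U i) × (Fin (m + 1) → Q) =>
      couplingCost Ψ Θ F q₀ z.1 z.2.1 z.2.2 := by
  have h1 : Continuous (euclideanSq : V → ℝ) := contDiff_euclideanSq.continuous
  have h2 : ∀ j, Continuous (euclideanSq : W j → ℝ) := fun j => contDiff_euclideanSq.continuous
  have h3 := continuous_precedingState (m := m) q₀
  have h4 : ∀ j, Continuous fun z : (∀ i, U i) × (∀ i, U i) × (Fin (m + 1) → Q) =>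
      F j (precedingState q₀ z.2.2 j, z.1 j) := fun j =>
    (hF j).comp (((h3 j).comp (by fun_prop)).prodMk (by fun_prop))
  unfold couplingCost
  refine Continuous.add (continuous_finsetSum _ fun j _ => h1.comp ?_)
    (continuous_finsetSum _ fun j _ => (h2 j).comp ?_)
  · exact ((hΨ j).comp (by fun_prop)).sub ((hΨ j).comp (h4 j))
  · exact ((hΘ j).comp (by fun_prop)).sub ((hΘ j).comp (by fun_prop))

variable [EMetricSpace Q] [ChartedSpace V Q] [∀ i, EMetricSpace (U i)]
  [∀ i, ChartedSpace (W i) (U i)]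

/-- Near a trajectory, the coupling cost vanishes only along trajectories. -/
lemma eventually_eq_trajectory_of_couplingCost_eq_zero
    {Ψ : Fin (m + 1) → Q → V} {Θ : ∀ i, U i → W i} {F : ∀ i, Q × U i → Q} {q₀ : Q}
    (hF : ∀ i, Continuous (F i)) {u₀ : ∀ i, U i}
    (hΨ : ∀ j, Ψ j =ᶠ[𝓝 (trajectory F q₀ u₀ j)] extChartAt 𝓘(ℝ, V) (trajectory F q₀ u₀ j))
    (hΘ : ∀ j, Θ j =ᶠ[𝓝 (u₀ j)] extChartAt 𝓘(ℝ, W j) (u₀ j)) :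
    ∀ᶠ z : (∀ i, U i) × (∀ i, U i) × (Fin (m + 1) → Q) in 𝓝 (u₀, u₀, trajectory F q₀ u₀),
      couplingCost Ψ Θ F q₀ z.1 z.2.1 z.2.2 = 0 → z.2.1 = z.1 ∧ z.2.2 = trajectory F q₀ z.1 := by
  set z₀ : (∀ i, U i) × (∀ i, U i) × (Fin (m + 1) → Q) := (u₀, u₀, trajectory F q₀ u₀) with hz₀
  have c1 : ∀ j, Tendsto (fun z : (∀ i, U i) × (∀ i, U i) × (Fin (m + 1) → Q) => z.1 j) (𝓝 z₀)
      (𝓝 (u₀ j)) := fun j => Continuous.tendsto' (by fun_prop) _ _ rfl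
  have c2 : ∀ j, Tendsto (fun z : (∀ i, U i) × (∀ i, U i) × (Fin (m + 1) → Q) => z.2.1 j) (𝓝 z₀)
      (𝓝 (u₀ j)) := fun j => Continuous.tendsto' (by fun_prop) _ _ rfl
  have c3 : ∀ j, Tendsto (fun z : (∀ i, U i) × (∀ i, U i) × (Fin (m + 1) → Q) => z.2.2 j) (𝓝 z₀)
      (𝓝 (trajectory F q₀ u₀ j)) := fun j => Continuous.tendsto' (by fun_prop) _ _ rfl
  have c4 : ∀ j, Tendsto (fun z : (∀ i, U i) × (∀ i, U i) × (Fin (m + 1) → Q) =>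
      F j (precedingState q₀ z.2.2 j, z.1 j)) (𝓝 z₀) (𝓝 (trajectory F q₀ u₀ j)) := fun j =>
    Continuous.tendsto' ((hF j).comp (((continuous_precedingState q₀ j).comp (by fun_prop)).prodMk
      (by fun_prop))) _ _ (by simp only [hz₀, Function.comp_apply, precedingState_trajectory]; rfl)
  have hU : ∀ j, ∀ᶠ x in 𝓝 (u₀ j), Θ j x = extChartAt 𝓘(ℝ, W j) (u₀ j) x ∧
      x ∈ (extChartAt 𝓘(ℝ, W j) (u₀ j)).source := fun j =>
    (hΘ j).and (extChartAt_source_mem_nhds _)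
  have hQ : ∀ j, ∀ᶠ x in 𝓝 (trajectory F q₀ u₀ j),
      Ψ j x = extChartAt 𝓘(ℝ, V) (trajectory F q₀ u₀ j) x ∧
      x ∈ (extChartAt 𝓘(ℝ, V) (trajectory F q₀ u₀ j)).source := fun j =>
    (hΨ j).and (extChartAt_source_mem_nhds _)
  filter_upwards [eventually_all.2 fun j => (c1 j).eventually (hU j),
    eventually_all.2 fun j => (c2 j).eventually (hU j),
    eventually_all.2 fun j => (c3 j).eventually (hQ j),
    eventually_all.2 fun j => (c4 j).eventually (hQ j)] with z h1 h2 h3 h4 hz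
  have s1 : ∀ j ∈ (Finset.univ : Finset (Fin (m + 1))),
      0 ≤ euclideanSq (Ψ j (z.2.2 j) - Ψ j (F j (precedingState q₀ z.2.2 j, z.1 j))) :=
    fun _ _ => euclideanSq_nonneg _
  have s2 : ∀ j ∈ (Finset.univ : Finset (Fin (m + 1))),
      0 ≤ euclideanSq (Θ j (z.2.1 j) - Θ j (z.1 j)) := fun _ _ => euclideanSq_nonneg _
  obtain ⟨e1, e2⟩ := (add_eq_zero_iff_of_nonneg (Finset.sum_nonneg s1)
    (Finset.sum_nonneg s2)).1 hz
  constructor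
  · funext j
    have := (Finset.sum_eq_zero_iff_of_nonneg s2).1 e2 j (Finset.mem_univ j)
    have h := sub_eq_zero.1 (euclideanSq_eq_zero.1 this)
    rw [(h1 j).1, (h2 j).1] at h
    exact (extChartAt 𝓘(ℝ, W j) (u₀ j)).injOn (h2 j).2 (h1 j).2 h
  · refine eq_trajectory F q₀ z.1 z.2.2 fun j => ?_
    have := (Finset.sum_eq_zero_iff_of_nonneg s1).1 e1 j (Finset.mem_univ j)
    have h := sub_eq_zero.1 (euclideanSq_eq_zero.1 this)
    rw [(h3 j).1, (h4 j).1] at h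
    -- Equal coordinates imply equal states only inside the chart domain; this is why the images
    -- under `F j` were also required to stay there.
    exact (extChartAt 𝓘(ℝ, V) (trajectory F q₀ u₀ j)).injOn (h3 j).2 (h4 j).2 h

/-- The constant depends only on the model spaces, not on `Θ`, `η` or the controls. It can therefore
be fixed before `κ` and the parameters of the perturbation are chosen. -/
lemma exists_norm_controlMultiplier_le (W : Fin (m + 1) → Type*) [∀ i, NormedAddCommGroup (W i)]
    [∀ i, NormedSpace ℝ (W i)] [∀ i, FiniteDimensional ℝ (W i)] :
    ∃ c > (0 : ℝ), ∀ (Θ : ∀ i, U i → W i) (η : ℝ), 0 ≤ η → ∀ (w u : ∀ i, U i) (j : Fin (m + 1)),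
      ‖controlMultiplier Θ η w u j‖ ≤ η * (c * Real.sqrt (proximityCost Θ w u)) := by
  choose c hc hcN using fun j => exists_norm_fderiv_euclideanSq_le (W j)
  refine ⟨∑ j, c j, Finset.sum_pos (fun j _ => hc j) Finset.univ_nonempty,
    fun Θ η hη w u j => ?_⟩
  rw [controlMultiplier, norm_smul, Real.norm_of_nonneg hη]
  refine mul_le_mul_of_nonneg_left ((hcN j _).trans ?_) hη
  exact mul_le_mul (Finset.single_le_sum (f := c) (fun i _ => (hc i).le) (Finset.mem_univ j))
    (Real.sqrt_le_sqrt (euclideanSq_le_proximityCost Θ w u j)) (Real.sqrt_nonneg _)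
    (Finset.sum_nonneg fun i _ => (hc i).le)

/-- If the error bound fails for every constant, then the decoupled problem has local minimizers
arbitrarily close to the reference trajectory at which the stage cost is positive and the
proximity term has an arbitrarily small differential. -/
lemma exists_decoupled_minimizer [MetricSpace E]
    [∀ i, IsManifold 𝓘(ℝ, W i) ∞ (U i)]
    [∀ i, RiemannianBundle (fun x : U i => TangentSpace 𝓘(ℝ, W i) x)]
    [∀ i, IsContinuousRiemannianBundle (W i) (fun x : U i => TangentSpace 𝓘(ℝ, W i) x)]
    [∀ i, IsRiemannianManifold 𝓘(ℝ, W i) (U i)]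
    {𝕌 : ∀ i, Set (U i)} (h𝕌_closed : ∀ i, IsClosed (𝕌 i))
    {F : ∀ i, Q × U i → Q} (hF : ∀ i, Continuous (F i)) {q₀ : Q}
    {φ₀ : E → U 0 → ℝ} {φ : ∀ i : Fin m, E → Q × U i.succ → ℝ} {φₙ : E → Q → ℝ}
    (hφ₀_nonneg : ∀ e x, 0 ≤ φ₀ e x) (hφ_nonneg : ∀ i e x, 0 ≤ φ i e x)
    (hφₙ_nonneg : ∀ e x, 0 ≤ φₙ e x)
    (hφ₀_lip : LocallyLipschitzUniformly φ₀) (hφ_lip : ∀ i, LocallyLipschitzUniformly (φ i))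
    (hφₙ_lip : LocallyLipschitzUniformly φₙ)
    (hP_cont : ContinuousOn (fun x : E × (∀ i, U i) => penalty F q₀ φ₀ φ φₙ x.1 x.2)
      (univ ×ˢ controlSet 𝕌))
    {e₀ : E} {u₀ : ∀ i, U i} (hu₀ : u₀ ∈ feasibleSet F q₀ 𝕌 φ₀ φ φₙ e₀)
    {Ψ : Fin (m + 1) → Q → V} {Θ : ∀ i, U i → W i}
    (hΨ_cont : ∀ j, Continuous (Ψ j)) (hΘ_cont : ∀ j, Continuous (Θ j))
    (hΨ : ∀ j, Ψ j =ᶠ[𝓝 (trajectory F q₀ u₀ j)] extChartAt 𝓘(ℝ, V) (trajectory F q₀ u₀ j))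
    (hΘ : ∀ j, Θ j =ᶠ[𝓝 (u₀ j)] extChartAt 𝓘(ℝ, W j) (u₀ j))
    (hfail : ∀ ε > (0 : ℝ), ∀ κ > (0 : ℝ), ∃ (e : E), ∃ w ∈ controlSet 𝕌,
      edist e e₀ + piEDist w u₀ < ENNReal.ofReal ε ∧
        ENNReal.ofReal (κ * penalty F q₀ φ₀ φ φₙ e w) <
          distFeasible (feasibleSet F q₀ 𝕌 φ₀ φ φₙ e) w)
    {N : Set E} (hN : N ∈ 𝓝 e₀) {O : Set ((∀ i, U i) × (∀ i, U i) × (Fin (m + 1) → Q))}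
    (hO : O ∈ 𝓝 (u₀, u₀, trajectory F q₀ u₀)) {δ : ℝ} (hδ : 0 < δ) :
    ∃ e ∈ N, ∃ (w : ∀ i, U i) (η K : ℝ), ∃ z ∈ O, z.1 ∈ controlSet 𝕌 ∧
      0 < stageCost φ₀ φ φₙ e z.2.1 z.2.2 ∧
      (∀ᶠ y in 𝓝 z, y.1 ∈ controlSet 𝕌 →
        decoupledCost Ψ Θ F q₀ φ₀ φ φₙ e w η K z ≤ decoupledCost Ψ Θ F q₀ φ₀ φ φₙ e w η K y) ∧
      ∀ j, ‖controlMultiplier Θ η w z.1 j‖ ≤ δ := by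
  have hlcQ : LocallyCompactSpace Q := ChartedSpace.locallyCompactSpace V Q
  have hlcU : ∀ i, LocallyCompactSpace (U i) := fun i => ChartedSpace.locallyCompactSpace (W i) (U i)
  obtain ⟨c, hc, hcN⟩ := exists_norm_controlMultiplier_le (U := U) W
  obtain ⟨D, hD, A, hA, hDA⟩ := exists_piEDist_le hΘ
  have hA' : ∀ᶠ z : (∀ i, U i) × (∀ i, U i) × (Fin (m + 1) → Q) in
      𝓝 (u₀, u₀, trajectory F q₀ u₀), z.1 ∈ A := continuous_fst.continuousAt hA
  have hchart : ∀ᶠ u in 𝓝 u₀, ∀ j, Θ j (u j) = extChartAt 𝓘(ℝ, W j) (u₀ j) (u j) ∧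
      u j ∈ (extChartAt 𝓘(ℝ, W j) (u₀ j)).source := by
    refine eventually_all.2 fun j => ?_
    exact ((continuous_apply j).tendsto u₀).eventually
      ((hΘ j).and (extChartAt_source_mem_nhds (I := 𝓘(ℝ, W j)) (u₀ j)))
  have hchart' : ∀ᶠ z : (∀ i, U i) × (∀ i, U i) × (Fin (m + 1) → Q) in
      𝓝 (u₀, u₀, trajectory F q₀ u₀), ∀ j, Θ j (z.1 j) = extChartAt 𝓘(ℝ, W j) (u₀ j) (z.1 j) ∧
      z.1 j ∈ (extChartAt 𝓘(ℝ, W j) (u₀ j)).source :=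
    (continuous_fst.tendsto (u₀, u₀, trajectory F q₀ u₀)).eventually hchart
  obtain ⟨C, hCmem, hCsub, hC⟩ := local_compact_nhds (inter_mem hO (hA'.and (hchart'.and
    (eventually_eq_trajectory_of_couplingCost_eq_zero hF hΨ hΘ))))
  have hgraph : Continuous fun u : ∀ i, U i => (u, u, trajectory F q₀ u) :=
    continuous_id.prodMk (continuous_id.prodMk (continuous_trajectory hF q₀))
  have hG : {u : ∀ i, U i | (u, u, trajectory F q₀ u) ∈ interior C} ∈ 𝓝 u₀ :=
    hgraph.continuousAt (isOpen_interior.mem_nhds (mem_interior_iff_mem_nhds.2 hCmem))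
  obtain ⟨r, hr, hrG⟩ := exists_mem_of_proximityCost_lt (Θ := Θ) hG
  -- parameters close to the reference
  set ρ := min (r / 8) ((δ / (2 * c)) ^ 2) with hρ
  have hρ0 : 0 < ρ := by positivity
  have hP₀ : penalty F q₀ φ₀ φ φₙ e₀ u₀ = 0 := by
    obtain ⟨-, h0, h, hn⟩ := hu₀
    have h' : ∀ i, φ i e₀ (stateControl F q₀ u₀ i.succ) = 0 := h
    change φ₀ e₀ (u₀ 0) = 0 at h0
    change φₙ e₀ (finalState F q₀ u₀) = 0 at hn
    simp [penalty, h0, hn, h']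
  have hPsmall : ∀ᶠ x : E × (∀ i, U i) in 𝓝 (e₀, u₀), x.2 ∈ controlSet 𝕌 →
      penalty F q₀ φ₀ φ φₙ x.1 x.2 < ρ := by
    have h1 := (hP_cont (e₀, u₀) ⟨trivial, hu₀.1⟩).tendsto
    simp only [hP₀] at h1
    filter_upwards [eventually_nhdsWithin_iff.1 (h1.eventually (gt_mem_nhds hρ0))] with x hx hxu
    exact hx ⟨trivial, hxu⟩
  have hprox : ∀ᶠ u in 𝓝 u₀, proximityCost Θ u₀ u < r / 8 := by
    have h1 := (continuous_proximityCost hΘ_cont u₀).tendsto u₀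
    rw [proximityCost_self] at h1
    exact h1.eventually (gt_mem_nhds (by positivity))
  obtain ⟨ε, hε, hεN⟩ := exists_pos_of_mem_nhds (hPsmall.and
    ((continuous_fst.tendsto (e₀, u₀)).eventually hN |>.and
      ((continuous_snd.tendsto (e₀, u₀)).eventually
        (hprox.and (Filter.Eventually.and hA hG)))))
  -- Chosen so that `1 / κ = δ / (2c)`, the size allowed for `P / l` below. The failure of the bound
  -- is invoked with `D * κ`, since `D` converts coordinate distance into Riemannian distance.
  set κ := 2 * c / δ with hκ
  have hκ0 : 0 < κ := by positivity
  obtain ⟨e, w, hw𝕌, hew, hdist⟩ := hfail ε hε (D * κ) (by positivity)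
  obtain ⟨hPρ, heN, hwr, hwA, hwG⟩ := hεN e w hew
  simp only at hPρ heN hwr hwA hwG
  set P := penalty F q₀ φ₀ φ φₙ e w with hP
  have hPρ : P < ρ := hPρ hw𝕌
  have hP0 : 0 < P := by
    refine lt_of_le_of_ne (stageCost_nonneg hφ₀_nonneg hφ_nonneg hφₙ_nonneg e w
      (trajectory F q₀ w)) fun h => ?_
    have hmem := mem_feasibleSet_of_penalty_eq_zero hφ₀_nonneg hφ_nonneg hφₙ_nonneg hw𝕌 h.symm
    have : distFeasible (feasibleSet F q₀ 𝕌 φ₀ φ φₙ e) w ≤ 0 :=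
      (iInf₂_le w hmem).trans (piEDist_self w).le
    exact absurd hdist (this.trans zero_le).not_gt
  -- The term `κ * P` keeps the `l`-ball around `w` free of feasible points. The term `√P` gives `l²
  -- ≤ P`, so that this ball also stays near the reference.
  set l := min (κ * P) (Real.sqrt P) with hl
  have hl0 : 0 < l := lt_min (by positivity) (Real.sqrt_pos.2 hP0)
  have hlκ : l ≤ κ * P := min_le_left _ _
  have hlP : l ^ 2 ≤ P := by
    calc l ^ 2 ≤ Real.sqrt P ^ 2 := pow_le_pow_left₀ hl0.le (min_le_right _ _) 2
      _ = P := Real.sq_sqrt hP0.le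
  -- With this weight, not exceeding the value `P` at `w` forces `proximityCost ≤ l²`.
  set η := P / l ^ 2 with hη
  have hη0 : 0 < η := by positivity
  have hcont_stage := continuous_stageCost hφ₀_lip hφ_lip hφₙ_lip e
  have hcont_prox := continuous_proximityCost hΘ_cont w
  have hcont_coup := continuous_couplingCost (q₀ := q₀) hΨ_cont hΘ_cont hF
  have h𝕌c : IsClosed {z : (∀ i, U i) × (∀ i, U i) × (Fin (m + 1) → Q) |
      z.1 ∈ controlSet 𝕌} := by
    have : IsClosed (controlSet 𝕌) := by
      have h : controlSet 𝕌 = Set.pi univ 𝕌 := by ext; simp [controlSet]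
      rw [h]; exact isClosed_set_pi fun i _ => h𝕌_closed i
    exact this.preimage continuous_fst
  obtain ⟨K, hK, z, hzC, hzO, hzh, hmin⟩ := exists_penalized_minimizer
    (C := C ∩ {z | z.1 ∈ controlSet 𝕌}) (O := interior C)
    (f := fun z => stageCost φ₀ φ φₙ e z.2.1 z.2.2 + η * proximityCost Θ w z.1)
    (g := fun z => couplingCost Ψ Θ F q₀ z.1 z.2.1 z.2.2)
    -- One strict inequality encodes both properties wanted of the minimizer. On exact trajectories
    -- the proximity is at most `l²`, so the threshold `4 * l ^ 2` leaves the room needed for the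
    -- condition to survive penalization.
    (h := fun z => min (stageCost φ₀ φ φₙ e z.2.1 z.2.2) (4 * l ^ 2 - proximityCost Θ w z.1))
    (z₀ := (w, w, trajectory F q₀ w)) (hC.inter_right h𝕌c)
    ((hcont_stage.comp continuous_snd).add
      (continuous_const.mul (hcont_prox.comp continuous_fst))).continuousOn
    hcont_coup.continuousOn
    ((hcont_stage.comp continuous_snd).min
      (continuous_const.sub (hcont_prox.comp continuous_fst))).continuousOn
    (fun z _ => couplingCost_nonneg _ _ _ _ _ _ _)
    ⟨interior_subset hwG, hw𝕌⟩ (couplingCost_trajectory _ _ _ _ _) isOpen_interior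
    (by
      rintro ⟨u, v, q⟩ ⟨hzC, hu𝕌⟩ hg hf
      obtain ⟨-, huA, huchart, huq⟩ := hCsub hzC
      obtain ⟨hvu, hq⟩ : v = u ∧ q = trajectory F q₀ u := huq hg
      subst hq hvu
      simp only [proximityCost_self, mul_zero, add_zero, stageCost_trajectory] at hf huA huchart hu𝕌 ⊢
      rw [← hP] at hf
      have hst0 : 0 ≤ penalty F q₀ φ₀ φ φₙ e v := stageCost_nonneg hφ₀_nonneg hφ_nonneg
        hφₙ_nonneg e v (trajectory F q₀ v)
      have hpl : proximityCost Θ w v ≤ l ^ 2 := by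
        have h1 : η * proximityCost Θ w v ≤ P := by linarith
        rw [hη, div_mul_eq_mul_div, div_le_iff₀ (by positivity)] at h1
        exact le_of_mul_le_mul_left h1 hP0
      have hvG : (v, v, trajectory F q₀ v) ∈ interior C := by
        refine hrG v (fun j => (huchart j).1) (fun j => (huchart j).2)
          (fun j => (hΘ j).self_of_nhds) ?_
        -- The proximity of `v` to `u₀` is at most `2l²` plus twice that of `w`, and both `l² ≤ P <
        -- ρ ≤ r/8` and the proximity of `w` are below `r/8`; the total is less than `r`.
        have h1 := proximityCost_triangle Θ u₀ w v
        have h2 : ρ ≤ r / 8 := min_le_left _ _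
        linarith
      refine ⟨hvG, lt_min (lt_of_le_of_ne hst0 fun h => ?_) (by nlinarith)⟩
      have hmem := mem_feasibleSet_of_penalty_eq_zero hφ₀_nonneg hφ_nonneg hφₙ_nonneg hu𝕌 h.symm
      -- If `v` were feasible, its Riemannian distance to `w` would be at most `D l ≤ D κ P`,
      -- against the choice of `w`.
      refine absurd hdist (not_lt.2 ((iInf₂_le v hmem).trans
        ((hDA w hwA v huA).trans (ENNReal.ofReal_le_ofReal ?_))))
      rw [mul_assoc]
      refine mul_le_mul_of_nonneg_left ?_ hD.le
      exact (Real.sqrt_le_iff.2 ⟨hl0.le, hpl⟩).trans hlκ)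
  rw [lt_min_iff] at hzh
  refine ⟨e, heN, w, η, K, z, (hCsub hzC.1).1, hzC.2, hzh.1, ?_, fun j => ?_⟩
  · filter_upwards [mem_interior_iff_mem_nhds.1 hzO] with y hy hy𝕌
    exact hmin ⟨hy, hy𝕌⟩
  · have h1 : Real.sqrt (proximityCost Θ w z.1) ≤ 2 * l :=
      Real.sqrt_le_iff.2 ⟨by positivity, by nlinarith [hzh.2]⟩
    -- `P / l` is the larger of `1 / κ` and `√P`. The first equals `δ / (2c)` by the choice of `κ`,
    -- and the second is below it because `P < ρ`.
    have h2 : P / l ≤ δ / (2 * c) := by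
      rw [div_le_iff₀ hl0, hl, mul_min_of_nonneg _ _ (by positivity)]
      refine le_min (le_of_eq ?_) ?_
      · rw [hκ]; field_simp
      · have h3 : Real.sqrt P ≤ δ / (2 * c) :=
          Real.sqrt_le_iff.2 ⟨by positivity, (hPρ.trans_le (min_le_right _ _)).le⟩
        calc P = Real.sqrt P * Real.sqrt P := (Real.mul_self_sqrt hP0.le).symm
          _ ≤ _ := mul_le_mul_of_nonneg_right h3 (Real.sqrt_nonneg _)
    calc ‖controlMultiplier Θ η w z.1 j‖ ≤ η * (c * Real.sqrt (proximityCost Θ w z.1)) :=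
          hcN Θ η hη0.le w z.1 j
      _ ≤ η * (c * (2 * l)) := by gcongr
      _ = 2 * c * (P / l) := by rw [hη]; field_simp
      _ ≤ 2 * c * (δ / (2 * c)) := by gcongr
      _ = δ := by field_simp

end Construction

/-! ### Coordinate differentials of the dynamics at the reference -/

section Linearization

variable {V V' : Type*} [NormedAddCommGroup V] [NormedSpace ℝ V]
  [NormedAddCommGroup V'] [NormedSpace ℝ V']
  {Q U : Type*} [TopologicalSpace Q] [ChartedSpace V Q] [IsManifold 𝓘(ℝ, V) ∞ Q]
  [TopologicalSpace U] [ChartedSpace V' U] [IsManifold 𝓘(ℝ, V') ∞ U]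
  {F : Q × U → Q} {Ψ : Q → V}

/-- In the coordinates of a chart at `F a`, the differential of `F` at `a` is unchanged. -/
lemma mfderivCoord_comp_self (hF : ContMDiff (𝓘(ℝ, V).prod 𝓘(ℝ, V')) 𝓘(ℝ, V) 1 F)
    (hΨ : ContMDiff 𝓘(ℝ, V) 𝓘(ℝ, V) 1 Ψ) {a : Q × U}
    (hΨa : Ψ =ᶠ[𝓝 (F a)] extChartAt 𝓘(ℝ, V) (F a)) (w : V × V') :
    mfderivCoord (𝓘(ℝ, V).prod 𝓘(ℝ, V')) (fun x => Ψ (F x)) a a w =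
      mfderiv (𝓘(ℝ, V).prod 𝓘(ℝ, V')) 𝓘(ℝ, V) F a w := by
  rw [mfderivCoord_self]
  have h1 : MDifferentiableAt 𝓘(ℝ, V) 𝓘(ℝ, V) Ψ (F a) := (hΨ.mdifferentiable one_ne_zero) _
  have h2 : MDifferentiableAt (𝓘(ℝ, V).prod 𝓘(ℝ, V')) 𝓘(ℝ, V) F a :=
    (hF.mdifferentiable one_ne_zero) _
  have h3 := DFunLike.congr_fun (mfderiv_comp a h1 h2) w
  refine h3.trans ?_
  -- The tangent space at `F a` is identified with `V` by the chart at `F a`, and `Ψ` agrees with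
  -- that chart near the point, so its differential there is the identity.
  have h4 : ∀ y : V, mfderiv 𝓘(ℝ, V) 𝓘(ℝ, V) Ψ (F a) y = y := fun y => by
    rw [← mfderivCoord_self, mfderivCoord_of_eventuallyEq hΨa (mem_chart_source V (F a))]
    rfl
  exact h4 _

lemma mfderivCoord_comp_self_inl (hF : ContMDiff (𝓘(ℝ, V).prod 𝓘(ℝ, V')) 𝓘(ℝ, V) 1 F)
    (hΨ : ContMDiff 𝓘(ℝ, V) 𝓘(ℝ, V) 1 Ψ) {a : Q × U}
    (hΨa : Ψ =ᶠ[𝓝 (F a)] extChartAt 𝓘(ℝ, V) (F a)) (w : V) :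
    (mfderivCoord (𝓘(ℝ, V).prod 𝓘(ℝ, V')) (fun x => Ψ (F x)) a a).comp
      (ContinuousLinearMap.inl ℝ V V') w = partialFst (V := V) F a w :=
  (mfderivCoord_comp_self hF hΨ hΨa (w, 0)).trans (mfderiv_comp_prodMk_left hF a w).symm

lemma mfderivCoord_comp_self_inr (hF : ContMDiff (𝓘(ℝ, V).prod 𝓘(ℝ, V')) 𝓘(ℝ, V) 1 F)
    (hΨ : ContMDiff 𝓘(ℝ, V) 𝓘(ℝ, V) 1 Ψ) {a : Q × U}
    (hΨa : Ψ =ᶠ[𝓝 (F a)] extChartAt 𝓘(ℝ, V) (F a)) (w : V') :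
    (mfderivCoord (𝓘(ℝ, V).prod 𝓘(ℝ, V')) (fun x => Ψ (F x)) a a).comp
      (ContinuousLinearMap.inr ℝ V V') w = partialSnd (V := V) (V' := V') F a w :=
  (mfderivCoord_comp_self hF hΨ hΨa (0, w)).trans (mfderiv_comp_prodMk_right hF a w).symm

end Linearization

/-! ### The error bound -/

/-- A local error bound for the distance to the feasible controls. -/
lemma exists_distFeasible_le {m : ℕ}
    {E : Type*} [MetricSpace E]
    {V : Type*} [NormedAddCommGroup V] [NormedSpace ℝ V] [FiniteDimensional ℝ V]
    {Q : Type*} [EMetricSpace Q] [ChartedSpace V Q] [IsManifold 𝓘(ℝ, V) ∞ Q]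
    [RiemannianBundle (fun x : Q => TangentSpace 𝓘(ℝ, V) x)]
    [IsContinuousRiemannianBundle V (fun x : Q => TangentSpace 𝓘(ℝ, V) x)]
    {W : Fin (m + 1) → Type*} [∀ i, NormedAddCommGroup (W i)] [∀ i, NormedSpace ℝ (W i)]
    [∀ i, FiniteDimensional ℝ (W i)]
    {U : Fin (m + 1) → Type*} [∀ i, EMetricSpace (U i)] [∀ i, ChartedSpace (W i) (U i)]
    [∀ i, IsManifold 𝓘(ℝ, W i) ∞ (U i)]
    [∀ i, RiemannianBundle (fun x : U i => TangentSpace 𝓘(ℝ, W i) x)]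
    [∀ i, IsContinuousRiemannianBundle (W i) (fun x : U i => TangentSpace 𝓘(ℝ, W i) x)]
    [∀ i, IsRiemannianManifold 𝓘(ℝ, W i) (U i)]
    {𝕌 : ∀ i, Set (U i)} (h𝕌_closed : ∀ i, IsClosed (𝕌 i))
    {F : ∀ i, Q × U i → Q}
    (hF : ∀ i, ContMDiff (𝓘(ℝ, V).prod 𝓘(ℝ, W i)) 𝓘(ℝ, V) 1 (F i))
    {q₀ : Q}
    {φ₀ : E → U 0 → ℝ} {φ : ∀ i : Fin m, E → Q × U i.succ → ℝ} {φₙ : E → Q → ℝ}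
    (hφ₀_nonneg : ∀ e x, 0 ≤ φ₀ e x) (hφ_nonneg : ∀ i e x, 0 ≤ φ i e x)
    (hφₙ_nonneg : ∀ e x, 0 ≤ φₙ e x)
    (hφ₀_lip : LocallyLipschitzUniformly φ₀) (hφ_lip : ∀ i, LocallyLipschitzUniformly (φ i))
    (hφₙ_lip : LocallyLipschitzUniformly φₙ)
    (hP_cont : ContinuousOn (fun x : E × (∀ i, U i) => penalty F q₀ φ₀ φ φₙ x.1 x.2)
      (univ ×ˢ controlSet 𝕌))
    {e₀ : E} {u₀ : ∀ i, U i} (hu₀ : u₀ ∈ feasibleSet F q₀ 𝕌 φ₀ φ φₙ e₀)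
    (hreg : IsPhiRegularAlong (V := V) (W := W) F q₀ φ₀ φ φₙ e₀ u₀)
    (hnormal : IsStrictlyNormal (V := V) (W := W) F q₀ 𝕌 φ₀ φ φₙ e₀ u₀) :
    ∃ ε > (0 : ℝ), ∃ κ > (0 : ℝ), ∀ (e : E), ∀ u ∈ controlSet 𝕌,
      edist e e₀ + piEDist u u₀ < ENNReal.ofReal ε →
        distFeasible (feasibleSet F q₀ 𝕌 φ₀ φ φₙ e) u ≤
          ENNReal.ofReal (κ * penalty F q₀ φ₀ φ φₙ e u) := by
  by_contra! hfail
  choose Ψ hΨ hΨc using fun j =>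
    exists_contMDiff_eventuallyEq_extChartAt (V := V) (trajectory F q₀ u₀ j)
  choose Θ hΘ hΘc using fun j => exists_contMDiff_eventuallyEq_extChartAt (V := W j) (u₀ j)
  set z₀ : (∀ i, U i) × (∀ i, U i) × (Fin (m + 1) → Q) := (u₀, u₀, trajectory F q₀ u₀) with hz₀
  have c1 : ∀ j, Tendsto (fun z : (∀ i, U i) × (∀ i, U i) × (Fin (m + 1) → Q) => z.1 j) (𝓝 z₀)
      (𝓝 (u₀ j)) := fun j => Continuous.tendsto' (by fun_prop) _ _ rfl
  have c2 : ∀ j, Tendsto (fun z : (∀ i, U i) × (∀ i, U i) × (Fin (m + 1) → Q) => z.2.1 j) (𝓝 z₀)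
      (𝓝 (u₀ j)) := fun j => Continuous.tendsto' (by fun_prop) _ _ rfl
  have c3 : ∀ j, Tendsto (fun z : (∀ i, U i) × (∀ i, U i) × (Fin (m + 1) → Q) => z.2.2 j) (𝓝 z₀)
      (𝓝 (trajectory F q₀ u₀ j)) := fun j => Continuous.tendsto' (by fun_prop) _ _ rfl
  have c4 : ∀ j, Tendsto (fun z : (∀ i, U i) × (∀ i, U i) × (Fin (m + 1) → Q) =>
      precedingState q₀ z.2.2 j) (𝓝 z₀) (𝓝 (stateControl F q₀ u₀ j).1) := fun j =>
    Continuous.tendsto' ((continuous_precedingState q₀ j).comp (by fun_prop)) _ _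
      (by simp only [hz₀, Function.comp_apply, precedingState_trajectory]; rfl)
  have hU : ∀ j, ∀ᶠ x in 𝓝 (u₀ j),
      mfderivCoord 𝓘(ℝ, W j) (Θ j) (u₀ j) x = ContinuousLinearMap.id ℝ (W j) ∧
      x ∈ (chartAt (W j) (u₀ j)).source := fun j => by
    filter_upwards [(hΘc j).eventuallyEq_nhds,
      (chartAt (W j) (u₀ j)).open_source.mem_nhds (mem_chart_source _ _)] with x hx hxs
    exact ⟨mfderivCoord_of_eventuallyEq hx hxs, hxs⟩
  have hQ : ∀ j, ∀ᶠ x in 𝓝 (trajectory F q₀ u₀ j),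
      mfderivCoord 𝓘(ℝ, V) (Ψ j) (trajectory F q₀ u₀ j) x = ContinuousLinearMap.id ℝ V ∧
      x ∈ (chartAt V (trajectory F q₀ u₀ j)).source := fun j => by
    filter_upwards [(hΨc j).eventuallyEq_nhds,
      (chartAt V (trajectory F q₀ u₀ j)).open_source.mem_nhds (mem_chart_source _ _)] with x hx hxs
    exact ⟨mfderivCoord_of_eventuallyEq hx hxs, hxs⟩
  have hgood := (eventually_all.2 fun j => (c1 j).eventually (hU j)).and
    ((eventually_all.2 fun j => (c2 j).eventually (hU j)).and
    ((eventually_all.2 fun j => (c3 j).eventually (hQ j)).and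
    (eventually_all.2 fun j => (c4 j).eventually
      ((chartAt V (stateControl F q₀ u₀ j).1).open_source.mem_nhds (mem_chart_source _ _)))))
  obtain ⟨N, hN⟩ := (𝓝 e₀).exists_antitone_basis
  obtain ⟨O, hO⟩ := (𝓝 z₀).exists_antitone_basis
  -- Neighbourhood bases make the parameters and the minimizers converge to the reference. The
  -- tolerance `1 / (k + 1)` makes the proximity multipliers tend to zero.
  choose e he w η K z hz hz𝕌 hpos hmin hS using fun k : ℕ =>
    exists_decoupled_minimizer h𝕌_closed (fun i => (hF i).continuous) hφ₀_nonneg hφ_nonneg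
      hφₙ_nonneg hφ₀_lip hφ_lip hφₙ_lip hP_cont hu₀ (fun j => (hΨ j).continuous)
      (fun j => (hΘ j).continuous) hΨc hΘc hfail (hN.mem k) (inter_mem (hO.mem k) hgood)
      (Nat.one_div_pos_of_nat (α := ℝ) (n := k))
  have hzt : Tendsto z atTop (𝓝 z₀) := hO.tendsto fun k => (hz k).1
  have hgood1 := fun k => (hz k).2.1
  have hgood2 := fun k => (hz k).2.2.1
  have hgood3 := fun k => (hz k).2.2.2.1
  have hgood4 := fun k => (hz k).2.2.2.2
  have hΨF : ∀ j, ContMDiff (𝓘(ℝ, V).prod 𝓘(ℝ, W j)) 𝓘(ℝ, V) 1 fun x => Ψ j (F j x) :=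
    fun j => (hΨ j).comp (hF j)
  -- The full differential of `F j` in coordinates. Its restrictions to the two factors are the
  -- state and control linearizations `A` and `B`, so their convergence follows from that of `T`.
  set T : ∀ j, Q × U j → V × W j →L[ℝ] V := fun j =>
    mfderivCoord (𝓘(ℝ, V).prod 𝓘(ℝ, W j)) (fun x => Ψ j (F j x)) (stateControl F q₀ u₀ j) with hT
  have hTlim : ∀ j, Tendsto (fun k => T j (precedingState q₀ (z k).2.2 j, (z k).1 j)) atTop
      (𝓝 (T j (stateControl F q₀ u₀ j))) := fun j =>
    (tendsto_mfderivCoord _ (hΨF j) (stateControl F q₀ u₀ j)).comp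
      ((((c4 j).prodMk_nhds (c1 j))).comp hzt)
  obtain ⟨k, hk⟩ := exists_stageCost_eq_zero (e := e) (u := fun k => (z k).1)
    (v := fun k => (z k).2.1) (q := fun k => (z k).2.2) hφ₀_nonneg hφ_nonneg hφₙ_nonneg
    hu₀.1 hreg hnormal (hN.tendsto he) (fun j => (c1 j).comp hzt) (fun j => (c2 j).comp hzt)
    (fun j => (c3 j).comp hzt) hz𝕌
    (P := fun k => stateMultiplier Ψ F q₀ (K k) (z k).1 (z k).2.2)
    (R := fun k => controlMultiplier Θ (K k) (z k).1 (z k).2.1)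
    (S := fun k => controlMultiplier Θ (η k) (w k) (z k).1)
    (A := fun k i => (T i.succ (precedingState q₀ (z k).2.2 i.succ, (z k).1 i.succ)).comp
      (ContinuousLinearMap.inl ℝ V (W i.succ)))
    (B := fun k j => (T j (precedingState q₀ (z k).2.2 j, (z k).1 j)).comp
      (ContinuousLinearMap.inr ℝ V (W j)))
    (fun j => squeeze_zero_norm (fun k => hS k j) tendsto_one_div_add_atTop_nhds_zero_nat)
    (fun i => tendsto_clm_comp (hTlim i.succ) tendsto_const_nhds)
    (fun j => tendsto_clm_comp (hTlim j) tendsto_const_nhds)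
    (fun i w => mfderivCoord_comp_self_inl (hF i.succ) (hΨ i.succ) (hΨc i.succ) w)
    (fun j w => mfderivCoord_comp_self_inr (hF j) (hΨ j) (hΨc j) w)
    (fun k => by
      obtain ⟨b, hb, hbc⟩ := exists_initial_subgradient hΘ (hz𝕌 k) (hmin k)
      refine ⟨b, hb, (hbc (u₀ 0)).trans ?_⟩
      rw [(hgood2 k 0).1]
      rfl)
    (fun k => by
      obtain ⟨a, ha, hac⟩ := exists_final_subgradient hΨ (hz𝕌 k) (hmin k)
      refine ⟨a, ha, (hac (trajectory F q₀ u₀ (Fin.last m))).trans ?_⟩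
      rw [(hgood3 k (Fin.last m)).1]
      rfl)
    (fun k i => by
      obtain ⟨ξ, hξ, hξc⟩ := exists_intermediate_subgradient hΨ hΘ hF (hz𝕌 k) (hmin k) i
      refine ⟨ξ, hξ, (hξc (trajectory F q₀ u₀ i.castSucc, u₀ i.succ) (hgood3 k i.castSucc).2
        (hgood2 k i.succ).2).trans ?_⟩
      have h1 : mfderivCoord 𝓘(ℝ, V) (fun x => Ψ i.succ (F i.succ (x, (z k).1 i.succ)))
          (trajectory F q₀ u₀ i.castSucc) ((z k).2.2 i.castSucc) =
          (T i.succ (precedingState q₀ (z k).2.2 i.succ, (z k).1 i.succ)).comp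
            (ContinuousLinearMap.inl ℝ V (W i.succ)) := by
        ext y
        exact mfderivCoord_partial_left (hΨF i.succ) (a := stateControl F q₀ u₀ i.succ)
          (x := ((z k).2.2 i.castSucc, (z k).1 i.succ)) (hgood3 k i.castSucc).2
          (hgood1 k i.succ).2 y
      simp only
      rw [h1, (hgood3 k i.castSucc).1, (hgood2 k i.succ).1]
      rfl)
    (fun k j => by
      obtain ⟨ν, hν, hνc⟩ := exists_normal hΨ hΘ hF (hz𝕌 k) (hmin k) j
      refine ⟨ν, hν, (hνc (u₀ j)).trans ?_⟩
      have h1 : mfderivCoord 𝓘(ℝ, W j) (fun x => Ψ j (F j (precedingState q₀ (z k).2.2 j, x)))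
          (u₀ j) ((z k).1 j) = (T j (precedingState q₀ (z k).2.2 j, (z k).1 j)).comp
            (ContinuousLinearMap.inr ℝ V (W j)) := by
        ext y
        exact mfderivCoord_partial_right (hΨF j) (a := stateControl F q₀ u₀ j)
          (x := (precedingState q₀ (z k).2.2 j, (z k).1 j)) (hgood4 k j) (hgood1 k j).2 y
      rw [h1, (hgood1 k j).1]
      rfl)
  exact (hpos k).ne' hk

end

theorem mainTheorem6 {m : ℕ}
    {E : Type*} [MetricSpace E]
    {V : Type*} [NormedAddCommGroup V] [NormedSpace ℝ V] [FiniteDimensional ℝ V]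
    {Q : Type*} [EMetricSpace Q] [ChartedSpace V Q] [IsManifold 𝓘(ℝ, V) ∞ Q]
    [RiemannianBundle (fun x : Q => TangentSpace 𝓘(ℝ, V) x)]
    [IsContMDiffRiemannianBundle 𝓘(ℝ, V) ∞ V (fun x : Q => TangentSpace 𝓘(ℝ, V) x)]
    [IsRiemannianManifold 𝓘(ℝ, V) Q]
    {W : Fin (m + 1) → Type*} [∀ i, NormedAddCommGroup (W i)] [∀ i, NormedSpace ℝ (W i)]
    [∀ i, FiniteDimensional ℝ (W i)]
    {U : Fin (m + 1) → Type*} [∀ i, EMetricSpace (U i)] [∀ i, ChartedSpace (W i) (U i)]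
    [∀ i, IsManifold 𝓘(ℝ, W i) ∞ (U i)]
    [∀ i, RiemannianBundle (fun x : U i => TangentSpace 𝓘(ℝ, W i) x)]
    [∀ i, IsContMDiffRiemannianBundle 𝓘(ℝ, W i) ∞ (W i)
      (fun x : U i => TangentSpace 𝓘(ℝ, W i) x)]
    [∀ i, IsRiemannianManifold 𝓘(ℝ, W i) (U i)]
    (𝕌 : ∀ i, Set (U i)) (h𝕌_closed : ∀ i, IsClosed (𝕌 i))
    (F : ∀ i, Q × U i → Q)
    (hF : ∀ i, ContMDiff (𝓘(ℝ, V).prod 𝓘(ℝ, W i)) 𝓘(ℝ, V) 1 (F i))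
    (q₀ : Q)
    (φ₀ : E → U 0 → ℝ) (φ : ∀ i : Fin m, E → Q × U i.succ → ℝ) (φₙ : E → Q → ℝ)
    (hφ₀_nonneg : ∀ e x, 0 ≤ φ₀ e x) (hφ_nonneg : ∀ i e x, 0 ≤ φ i e x)
    (hφₙ_nonneg : ∀ e x, 0 ≤ φₙ e x)
    (hφ₀_lip : LocallyLipschitzUniformly φ₀) (hφ_lip : ∀ i, LocallyLipschitzUniformly (φ i))
    (hφₙ_lip : LocallyLipschitzUniformly φₙ)
    (hP_cont : ContinuousOn (fun x : E × (∀ i, U i) => penalty F q₀ φ₀ φ φₙ x.1 x.2)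
      (univ ×ˢ controlSet 𝕌))
    (e_bar : E) (u_bar : ∀ i, U i) (hu_bar : u_bar ∈ feasibleSet F q₀ 𝕌 φ₀ φ φₙ e_bar)
    (h𝕌_regular : ∀ i, IsClarkeRegular 𝓘(ℝ, W i) (𝕌 i))
    (hφ_regular : IsPhiRegularAlong (V := V) (W := W) F q₀ φ₀ φ φₙ e_bar u_bar)
    (hu_normal : IsStrictlyNormal (V := V) (W := W) F q₀ 𝕌 φ₀ φ φₙ e_bar u_bar) :
    ∃ ε > (0 : ℝ), ∃ κ > (0 : ℝ),
      (∀ (e : E), ∀ u ∈ controlSet 𝕌,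
        edist e e_bar + piEDist u u_bar < ENNReal.ofReal ε →
          distFeasible (feasibleSet F q₀ 𝕌 φ₀ φ φₙ e) u ≤
            ENNReal.ofReal (κ * penalty F q₀ φ₀ φ φₙ e u)) ∧
      (∀ e : E, dist e e_bar < ε → (feasibleSet F q₀ 𝕌 φ₀ φ φₙ e).Nonempty) := by
  have : IsContinuousRiemannianBundle V (fun x : Q => TangentSpace 𝓘(ℝ, V) x) :=
    isContinuousRiemannianBundle_of_contMDiff
  have : ∀ i, IsContinuousRiemannianBundle (W i) (fun x : U i => TangentSpace 𝓘(ℝ, W i) x) :=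
    fun i => isContinuousRiemannianBundle_of_contMDiff
  obtain ⟨ε, hε, κ, hκ, h⟩ := exists_distFeasible_le h𝕌_closed hF hφ₀_nonneg hφ_nonneg
    hφₙ_nonneg hφ₀_lip hφ_lip hφₙ_lip hP_cont hu_bar hφ_regular hu_normal
  refine ⟨ε, hε, κ, hκ, h, fun e he => ?_⟩
  -- The bound at the reference control has a finite right-hand side, whereas the distance to an
  -- empty feasible set is `∞`.
  have h1 := h e u_bar hu_bar.1 (by
    rw [piEDist_self, add_zero, edist_dist]
    exact (ENNReal.ofReal_lt_ofReal_iff hε).2 he)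
  by_contra hne
  rw [Set.not_nonempty_iff_eq_empty] at hne
  simp [hne, distFeasible] at h1
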